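/- **Setting.** A bandit problem has $A\ge 1$ arms, horizon $T\ge 1$ and expected reward vectors $r_1,\dots,r_T\in[0,1]^A$ fixed in advance and unknown to the learner. In round $t$ the learner plays an arm $a_t$ and receives $R_t\in[0,1]$ with conditional mean $r_{t,a_t}$ given the past (past rewards and the learner's randomization so far). Let $\delta\in(0,1)$ with $T/\delta\ge 2$, and put $\iota=\log(T/\delta)$, $r_t^\star=\max_a r_{t,a}$, $\text{D-Reg}=\sum_{t=1}^T(r_t^\star-R_t)$, $\Delta(t)=\|r_t-r_{t+1}\|_\infty$, $\Delta_{[s,e]}=\sum_{\tau=s}^{e-1}\Delta(\tau)$, $\Delta=\Delta_{[1,T]}$, $L=1+\#\{t<T:\Delta(t)\ne 0\}$. **UCB1** (with a constant $c$) plays in round $t$ an arm maximizing $\widetilde r_{t,a}=\widehat r_{t,a}+c\sqrt{\iota/N_{t,a}^+}$ (ties broken by any fixed rule), where $N_{t,a}^+=\max\{1,\#\text{earlier pulls of }a\}$ and $\widehat r_{t,a}$ is the sum of the earlier rewards of $a$ divided by $N_{t,a}^+$; it outputs $\widetilde f_t=\min\{1,\max_a\widetilde r_{t,a}\}$. **Assumption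 1** for a base algorithm, with $\rho$ and $\Delta(\cdot)$ (and $C(t)=t\rho(t)$): $\widetilde f_t\in[0,1]$; $\Delta(t)\ge\max_a|r_{t,a}-r_{t+1,a}|$; on $\{1,\dots,T\}$ the function $\rho$ is non-increasing, $C$ is non-decreasing and $\rho(t)\ge 1/\sqrt t$; and for every environment and every $t\le T$ with $\Delta_{[1,t]}\le\rho(t)$, running the algorithm alone gives, with probability at least $1-\delta/T$, $$\widetilde f_t\ \ge\ \min_{\tau\le t} r_\tau^\star-\Delta_{[1,t]}\qquad\text{and}\qquad \frac1t\sum_{\tau=1}^t(\widetilde f_\tau-R_\tau)\ \le\ \rho(t)+\Delta_{[1,t]}.$$ **MASTER** with a base algorithm and input $\rho$ uses $\widehat\rho(t)=6(\log_2T+1)\,\iota\,\rho(t)$. It plays blocks of length $2^n$, $n=0,1,2,\dots$. In a block starting in round $t_n$, each sub-interval $[t_n+j2^m,\,t_n+(j+1)2^m-1]$ ($0\le m\le n$, $0\le j<2^{n-m}$) independently receives, with probability $\rho(2^n)/\rho(2^m)$, an order-$m$ instance of the base algorithm. In each round the shortest instance covering the round is active: it alone chooses the arm and is updated with the reward, the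 others are paused; $\widetilde g_t$ is the $\widetilde f$ that it outputs. After round $t$, with $U_t=\min_{t_n\le\tau\le t}\widetilde g_\tau$, MASTER restarts in round $t+1$ with $n=0$ if (Test 1) some order-$m$ instance with interval $[s,t]$ has $2^{-m}\sum_{\tau=s}^tR_\tau\ge U_t+9\widehat\rho(2^m)$, or (Test 2) $\frac1{t-t_n+1}\sum_{\tau=t_n}^t(\widetilde g_\tau-R_\tau)\ge3\widehat\rho(t-t_n+1)$. **Theorem.** There are universal constants $c,K,B>0$ and $k\in\mathbb N$ such that for all $A$, $T$, $\delta$ and all tie-breaking rules as above, with $\rho_0(t)=K\big(\sqrt{A\iota/t}+A\iota/t\big)$: 1. UCB1 satisfies Assumption 1 with $\rho=\rho_0$ and $\Delta(t)=\|r_t-r_{t+1}\|_\infty$, and $C(t)=t\rho_0(t)\le B\,\iota^k(\sqrt{At}+A)$ for all $t\le T$; it also satisfies Assumption 1 with $\rho=\min\{\rho_0,1\}$ and the same $\Delta(\cdot)$. 2. For every environment, MASTER with base algorithm UCB1 and input $\rho=\min\{\rho_0,1\}$, which knows neither $L$ nor $\Delta$, satisfies with probability at least $1-\delta$ $$\text{D-Reg}\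 \le\ B\,\iota^{k}\,\min\Big\{\sqrt{ALT},\ (A\Delta)^{1/3}T^{2/3}+\sqrt{AT}\Big\}.$$ -/

import Mathlib

open MeasureTheory ProbabilityTheory

universe u

noncomputable section

namespace Bandit

/-! ## Environment: expected rewards, regret and non-stationarity -/

section Environment

variable {Pol : Type*}

/-- The mean reward functions `f 1, …, f T` take values in `[0, 1]`. -/
def IsEnvironment (T : ℕ) (f : ℕ → Pol → ℝ) : Prop :=
  ∀ t ∈ Finset.Icc 1 T, ∀ p, f t p ∈ Set.Icc (0 : ℝ) 1

/-- `f⋆ t`, the expected reward of the best policy in round `t`. -/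
def optValue (f : ℕ → Pol → ℝ) (t : ℕ) : ℝ := ⨆ p, f t p

/-- Dynamic regret against a realized reward sequence `R 1, …, R T`. -/
def dynRegret (T : ℕ) (f : ℕ → Pol → ℝ) (R : ℕ → ℝ) : ℝ :=
  ∑ t ∈ Finset.Icc 1 T, (optValue f t - R t)

/-- `Δ_{[s, e]} = ∑_{τ = s}^{e - 1} Δ(τ)`. -/
def totalVar (D : ℕ → ℝ) (s e : ℕ) : ℝ := ∑ τ ∈ Finset.Ico s e, D τ

open Classical in
/-- `L_{[s, e]} = 1 + ∑_{τ = s}^{e - 1} 1[Δ(τ) ≠ 0]`. -/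
def numStationary (D : ℕ → ℝ) (s e : ℕ) : ℕ :=
  1 + ((Finset.Ico s e).filter (fun τ => D τ ≠ 0)).card

/-- `D` is a non-stationarity measure for the mean rewards `f 1, …, f T`. -/
def IsNonstatMeasure (T : ℕ) (f : ℕ → Pol → ℝ) (D : ℕ → ℝ) : Prop :=
  ∀ t ∈ Finset.Ico 1 T, ∀ p, |f t p - f (t + 1) p| ≤ D t

/-- The random rewards `R 1, …, R T` lie in `[0, 1]`, and the mean of `R t`, given the information
`info t` available when the policy `pol t` of round `t` is executed, is `f t (pol t)`. -/
structure IsRewardProcess {Ω : Type*} [MeasurableSpace Ω] (P : Measure Ω) (T : ℕ)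
    (f : ℕ → Pol → ℝ) (info : ℕ → MeasurableSpace Ω) (pol : ℕ → Ω → Pol)
    (R : ℕ → Ω → ℝ) : Prop where
  measurable : ∀ t ∈ Finset.Icc 1 T, Measurable (R t)
  mem_Icc : ∀ t ∈ Finset.Icc 1 T, ∀ ω, R t ω ∈ Set.Icc (0 : ℝ) 1
  mean : ∀ t ∈ Finset.Icc 1 T, P[R t | info t] =ᵐ[P] fun ω => f t (pol t ω)

/-- The information contained in the rewards of the rounds `1, …, t - 1`. -/
abbrev pastRewards {Ω : Type*} (R : ℕ → Ω → ℝ) (t : ℕ) : MeasurableSpace Ω :=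
  ⨆ s ∈ Finset.Ico 1 t, MeasurableSpace.comap (R s) inferInstance

end Environment

/-! ## Base algorithms -/

/-- A base algorithm with reward feedback. From the list of the (policy, reward) pairs of the
rounds in which it was run (latest first), it determines the auxiliary quantity `est` and the
policy `act` of its next round. -/
structure BaseAlg (Pol : Type*) where
  act : List (Pol × ℝ) → Pol
  est : List (Pol × ℝ) → ℝ

namespace BaseAlg

variable {Pol : Type*}

/-- The history after `t` rounds when the algorithm is run alone and the rewards are `R`. -/
def hist (alg : BaseAlg Pol) (R : ℕ → ℝ) : ℕ → List (Pol × ℝ)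
  | 0 => []
  | t + 1 => (alg.act (alg.hist R t), R (t + 1)) :: alg.hist R t

/-- The policy of round `t ≥ 1` when the algorithm is run alone. -/
def policy (alg : BaseAlg Pol) (R : ℕ → ℝ) (t : ℕ) : Pol := alg.act (alg.hist R (t - 1))

/-- The auxiliary quantity `f̃ t` of round `t ≥ 1` when the algorithm is run alone. -/
def estimate (alg : BaseAlg Pol) (R : ℕ → ℝ) (t : ℕ) : ℝ := alg.est (alg.hist R (t - 1))

/-- The requirement on a base algorithm, with average regret bound `ρ` (so that `C(t) = t ρ(t)`)
and with the non-stationarity measure `dev f` for the mean rewards `f`. -/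
structure NearStationaryGuarantee (alg : BaseAlg Pol) (T : ℕ) (δ : ℝ) (ρ : ℕ → ℝ)
    (dev : (ℕ → Pol → ℝ) → ℕ → ℝ) : Prop where
  est_mem : ∀ h : List (Pol × ℝ), (∀ x ∈ h, x.2 ∈ Set.Icc (0 : ℝ) 1) →
    alg.est h ∈ Set.Icc (0 : ℝ) 1
  nonstat : ∀ f : ℕ → Pol → ℝ, IsEnvironment T f → IsNonstatMeasure T f (dev f)
  antitone : AntitoneOn ρ (Set.Icc 1 T)
  monotone : MonotoneOn (fun t : ℕ => (t : ℝ) * ρ t) (Set.Icc 1 T)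
  lower : ∀ t ∈ Finset.Icc 1 T, 1 / √(t : ℝ) ≤ ρ t
  guarantee : ∀ f : ℕ → Pol → ℝ, IsEnvironment T f →
    ∀ {Ω : Type u} [MeasurableSpace Ω] (P : Measure Ω) [IsProbabilityMeasure P] (R : ℕ → Ω → ℝ),
    IsRewardProcess P T f (pastRewards R) (fun t ω => alg.policy (fun s => R s ω) t) R →
    ∀ t ∈ Finset.Icc 1 T, totalVar (dev f) 1 t ≤ ρ t →
      1 - δ / T ≤ P.real {ω |
        (⨅ τ : Set.Icc 1 t, optValue f τ) - totalVar (dev f) 1 t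
            ≤ alg.estimate (fun s => R s ω) t ∧
        (1 / (t : ℝ)) * ∑ τ ∈ Finset.Icc 1 t, (alg.estimate (fun s => R s ω) τ - R τ ω)
            ≤ ρ t + totalVar (dev f) 1 t}

end BaseAlg

/-! ## UCB1 -/

section UCB1

variable {A : ℕ}

/-- `N⁺`: the number of pulls of arm `a` recorded in the history `h`, or `1` if there is none. -/
def pullsPos (h : List (Fin A × ℝ)) (a : Fin A) : ℕ :=
  max 1 (h.filter (fun x => x.1 = a)).length

/-- The empirical mean of the rewards of arm `a`. -/
def empMean (h : List (Fin A × ℝ)) (a : Fin A) : ℝ :=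
  ((h.filter (fun x => x.1 = a)).map Prod.snd).sum / (pullsPos h a : ℝ)

/-- The optimistic reward estimate of arm `a`. -/
def ucbIndex (c : ℝ) (T : ℕ) (δ : ℝ) (h : List (Fin A × ℝ)) (a : Fin A) : ℝ :=
  empMean h a + c * √(Real.log (T / δ) / (pullsPos h a : ℝ))

open Classical in
/-- UCB1 plays an arm of largest index, ties being broken by the rule `tie`. Its auxiliary quantity
is the largest index, capped at `1`. -/
def ucb1 (A : ℕ) (c : ℝ) (T : ℕ) (δ : ℝ) (tie : Finset (Fin A) → Fin A) : BaseAlg (Fin A) where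
  act h := tie (Finset.univ.filter fun a => ∀ b, ucbIndex c T δ h b ≤ ucbIndex c T δ h a)
  est h := min (⨆ a, ucbIndex c T δ h a) 1

/-- `ρ(t) = K (√(A log(T/δ) / t) + A log(T/δ) / t)`. -/
def ucbRho (K : ℝ) (A T : ℕ) (δ : ℝ) (t : ℕ) : ℝ :=
  K * (√(A * Real.log (T / δ) / t) + A * Real.log (T / δ) / t)

/-- The sup-norm variation of the expected reward vector between the rounds `t` and `t + 1`. -/
def supVar (r : ℕ → Fin A → ℝ) (t : ℕ) : ℝ := ‖r t - r (t + 1)‖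

end UCB1

/-! ## The multi-scale schedule -/

/-- The first round of the order-`m` sub-interval, containing round `t`, of a block that starts in
round `tn`. -/
def cellStart (tn m t : ℕ) : ℕ := tn + 2 ^ m * ((t - tn) / 2 ^ m)

/-- In a block of order `n`, an order-`m` instance is scheduled to start in round `s`. The number
`ξ s m` is uniform on `[0, 1]`, so that this has probability `ρ(2^n) / ρ(2^m)`. -/
def Scheduled (ρ : ℕ → ℝ) (ξ : ℕ → ℕ → unitInterval) (n s m : ℕ) : Prop :=
  (ξ s m : ℝ) ≤ ρ (2 ^ n) / ρ (2 ^ m)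

/-- The order of the active instance in round `t` of a block of order `n` that starts in round
`tn`: the shortest of the scheduled instances that cover `t`. -/
def activeOrder (ρ : ℕ → ℝ) (ξ : ℕ → ℕ → unitInterval) (tn n t : ℕ) : ℕ :=
  sInf {m | m ≤ n ∧ Scheduled ρ ξ n (cellStart tn m t) m}

/-! ## MASTER -/

/-- The record of one round: the start and the order of the active instance, the executed policy,
the output `g̃` and the reward. -/
structure Round (Pol : Type*) where
  inst : ℕ × ℕ
  pol : Pol
  est : ℝ
  rew : ℝ

/-- The state of MASTER between two rounds: the first round `start` and the order `order` of the
current block (of length `2 ^ order`), and the rounds of this block played so far. -/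
structure MasterState (Pol : Type*) where
  start : ℕ
  order : ℕ
  log : List (Round Pol)

section Master

variable {Pol : Type*}

open Classical in
/-- The own history of the instance `i`: the rounds in which it was active. -/
def instHist (log : List (Round Pol)) (i : ℕ × ℕ) : List (Pol × ℝ) :=
  (log.filter (fun x => x.inst = i)).map (fun x => (x.pol, x.rew))

/-- The active instance (start and order) in round `t`. -/
def activeInst (ρ : ℕ → ℝ) (ξ : ℕ → ℕ → unitInterval) (S : MasterState Pol) (t : ℕ) : ℕ × ℕ :=
  let m := activeOrder ρ ξ S.start S.order t
  (cellStart S.start m t, m)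

/-- Round `t`: the active instance decides, and is updated with the reward `x`. -/
def playRound (alg : BaseAlg Pol) (ρ : ℕ → ℝ) (ξ : ℕ → ℕ → unitInterval) (S : MasterState Pol)
    (t : ℕ) (x : ℝ) : Round Pol where
  inst := activeInst ρ ξ S t
  pol := alg.act (instHist S.log (activeInst ρ ξ S t))
  est := alg.est (instHist S.log (activeInst ρ ξ S t))
  rew := x

/-- `ρ̂(t) = 6 (log₂ T + 1) log(T/δ) ρ(t)`. -/
def rhoHat (T : ℕ) (δ : ℝ) (ρ : ℕ → ℝ) (t : ℕ) : ℝ :=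
  6 * (Real.logb 2 T + 1) * Real.log (T / δ) * ρ t

/-- `U`: the smallest output `g̃` in the block, `g` being the latest one and `log` the record of
the earlier rounds. -/
def minEst (g : ℝ) (log : List (Round Pol)) : ℝ := log.foldr (fun x u => min x.est u) g

/-- Test 1 fails at the end of round `t`: some scheduled order-`m` instance ends in round `t`, and
the average reward over its interval is at least `U + 9 ρ̂(2^m)`. -/
def Test1Fails (ρ ρhat : ℕ → ℝ) (ξ : ℕ → ℕ → unitInterval) (tn n t : ℕ) (R : ℕ → ℝ) (U : ℝ) :
    Prop :=
  ∃ m s : ℕ, m ≤ n ∧ cellStart tn m t = s ∧ t = s + 2 ^ m - 1 ∧ Scheduled ρ ξ n s m ∧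
    U + 9 * ρhat (2 ^ m) ≤ (1 / (2 : ℝ) ^ m) * ∑ τ ∈ Finset.Icc s t, R τ

/-- Test 2 fails at the end of round `t`: the average of `g̃ - R` over the block so far, whose
record including round `t` is `log`, is at least `3 ρ̂(t - tn + 1)`. -/
def Test2Fails (ρhat : ℕ → ℝ) (tn t : ℕ) (log : List (Round Pol)) : Prop :=
  3 * ρhat (t - tn + 1) ≤ (1 / ((t - tn + 1 : ℕ) : ℝ)) * (log.map fun x => x.est - x.rew).sum

open Classical in
/-- The state of MASTER after `t` rounds with rewards `R`. If a test fails, it restarts with a block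
of order `0`; a block that is completed is followed by one of twice its length. -/
def masterState (alg : BaseAlg Pol) (ρ ρhat : ℕ → ℝ) (ξ : ℕ → ℕ → unitInterval) (R : ℕ → ℝ) :
    ℕ → MasterState Pol
  | 0 => ⟨1, 0, []⟩
  | t + 1 =>
    let S := masterState alg ρ ρhat ξ R t
    let x := playRound alg ρ ξ S (t + 1) (R (t + 1))
    if Test1Fails ρ ρhat ξ S.start S.order (t + 1) R (minEst x.est S.log) ∨
        Test2Fails ρhat S.start (t + 1) (x :: S.log) then
      ⟨t + 2, 0, []⟩
    else if t + 2 = S.start + 2 ^ S.order then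
      ⟨t + 2, S.order + 1, []⟩
    else
      ⟨S.start, S.order, x :: S.log⟩

/-- The policy executed by MASTER in round `t ≥ 1`. -/
def masterPolicy (alg : BaseAlg Pol) (ρ ρhat : ℕ → ℝ) (ξ : ℕ → ℕ → unitInterval) (R : ℕ → ℝ)
    (t : ℕ) : Pol :=
  (playRound alg ρ ξ (masterState alg ρ ρhat ξ R (t - 1)) t 0).pol

/-- The information contained in the scheduling randomness of the rounds `1, …, t`. -/
abbrev coinInfo {Ω : Type*} (ξ : ℕ → Ω → ℕ → unitInterval) (t : ℕ) : MeasurableSpace Ω :=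
  ⨆ s ∈ Finset.Icc 1 t, MeasurableSpace.comap (ξ s) inferInstance

/-- MASTER, with base algorithm `alg` and input `ρ`, is run for `T` rounds in the environment with
mean rewards `f`. The scheduling randomness `ξ t` of round `t` consists of independent uniform
numbers and is independent of all that happened before; the rewards have the right conditional
means given the past rewards and the scheduling randomness used so far. -/
structure IsMasterRun {Ω : Type*} [MeasurableSpace Ω] (P : Measure Ω) (alg : BaseAlg Pol) (T : ℕ)
    (δ : ℝ) (ρ : ℕ → ℝ) (f : ℕ → Pol → ℝ) (ξ : ℕ → Ω → ℕ → unitInterval) (R : ℕ → Ω → ℝ) :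
    Prop where
  coin_measurable : ∀ t ∈ Finset.Icc 1 T, Measurable (ξ t)
  coin_law : ∀ t ∈ Finset.Icc 1 T,
    P.map (ξ t) = Measure.infinitePi fun _ : ℕ => (volume : Measure unitInterval)
  coin_indep : ∀ t ∈ Finset.Icc 1 T,
    Indep (MeasurableSpace.comap (ξ t) inferInstance) (pastRewards R t ⊔ coinInfo ξ (t - 1)) P
  reward : IsRewardProcess P T f (fun t => pastRewards R t ⊔ coinInfo ξ t)
    (fun t ω => masterPolicy alg ρ (rhoHat T δ ρ) (fun s m => ξ s ω m) (fun s => R s ω) t) R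

end Master

end Bandit

end

namespace Bandit

/-! ## Exponential supermartingales -/

section Supermartingale

variable {Ω : Type*} {m0 : MeasurableSpace Ω} {P : Measure Ω}

/-! UCB1. Products of the factors `exp (l (X - μ) - l²)` along the pulls of an arm are
supermartingales. So the rewards of N pulls differ from their means by at most `17 √(ι N)` in total,
outside an event whose probability is a high power of δ/T up to polynomial factors
(`reward_concentration`). If the means vary by at most V, the index of every arm is at least its
mean minus V (`le_indexOf`), and over N rounds the estimates exceed the rewards by at most `N V +
119 √(A ι N)` in total (`sum_ucb_est_sub_le`). These bounds hold along arbitrary sets of rounds,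
hence also for an instance that is paused and resumed by MASTER.

MASTER. On an event of high probability (`GoodRun`, `goodRun_probability`) the analysis is
deterministic. In a block of order n, order-k cells receive instances with probability
ρ(2^n)/ρ(2^k), so there are few of them. Adding up their regrets shows that, over the first l rounds
of the cell of a scheduled instance, the estimates exceed the rewards on average by at most the
variation plus ρ̂(l) (`sum_cell_le`).

This has two consequences. A restart forces the variation in its block to exceed ρ at the length
reached (`lt_totalVar_of_restarts`), so restarts can be charged to changes. Conversely, let some
estimate of the block lie 14 ρ̂(2^m) below the optimal value. If the variation is small in the
current and the next order-m cell, an instance scheduled for the next cell would collect enough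
reward to fail Test 1 (`restarts_of_badStart`). Whether it is scheduled is decided by a fresh coin,
so a block survives only about ι ρ(2^m)/ρ(2^n) such opportunities (`card_badStart_le`). Rounds with
a gap of this size are therefore confined to few cells: the last two, those followed by an
opportunity, and those with a large variation nearby (`card_gap_le`).

Summing the gaps dyadically, the regret of a block is, up to logarithms, `√(A 2^n)` plus the sum
over m of `√(A 2^m)` times the number V of varying pairs of order-m cells (`block_regret`). Since V
2^m is at most the length, V at most twice the number of changes and V ρ(2^m) at most twice the
variation, the second part is of order √(A · changes · length), and also of order (A ·
variation)^{1/3} length^{2/3}. Cauchy–Schwarz and Hölder sum this over the blocks, and the charging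
of restarts bounds the number of blocks (`regret_le_change`, `regret_le_variation`). For T ≤ A the
trivial bound T suffices. -/

theorem integrable_of_bounded [IsFiniteMeasure P] {f : Ω → ℝ} (hf : Measurable f) {C : ℝ}
    (hC : ∀ ω, |f ω| ≤ C) : Integrable f P :=
  Integrable.of_bound hf.aestronglyMeasurable C (Filter.Eventually.of_forall hC)

/-- `Y` is an increment at time `t` of the logarithm of an exponential supermartingale. -/
def ExpStep (P : Measure Ω) (F : MeasurableSpace Ω) (Y : Ω → ℝ) : Prop :=
  ∀ W : Ω → ℝ, Measurable[F] W → (∀ ω, 0 ≤ W ω) → (∃ C, ∀ ω, W ω ≤ C) →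
    ∫ ω, W ω * Real.exp (Y ω) ∂P ≤ ∫ ω, W ω ∂P

theorem ExpStep.mono {F G : MeasurableSpace Ω} (h : F ≤ G) {Y : Ω → ℝ} (hY : ExpStep P G Y) :
    ExpStep P F Y := fun W hW => hY W (hW.mono h le_rfl)

/-- The product of the earlier factors is a bounded weight known before the last step, so `ExpStep`
removes one factor at a time. -/
theorem integral_exp_sum_le_one [IsProbabilityMeasure P] {T : ℕ} {F : ℕ → MeasurableSpace Ω}
    (mono : Monotone F) {Y : ℕ → Ω → ℝ} {C : ℝ}
    (hY : ∀ t ∈ Finset.Icc 1 T, Measurable[F t] (Y t))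
    (hC : ∀ t ∈ Finset.Icc 1 T, ∀ ω, Y t ω ≤ C)
    (step : ∀ t ∈ Finset.Icc 1 T, ExpStep P (F (t - 1)) (Y t)) {t : ℕ} (ht : t ≤ T) :
    ∫ ω, Real.exp (∑ q ∈ Finset.Icc 1 t, Y q ω) ∂P ≤ 1 := by
  induction t with
  | zero => simp
  | succ t ih =>
    have hmem : t + 1 ∈ Finset.Icc 1 T := Finset.mem_Icc.2 ⟨by omega, ht⟩
    refine le_trans ?_ (ih (by omega))
    simp_rw [Finset.sum_Icc_succ_top (Nat.le_add_left 1 t), Real.exp_add]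
    refine step (t + 1) hmem _ ?_ (fun ω => (Real.exp_pos _).le)
      ⟨Real.exp (∑ q ∈ Finset.Icc 1 t, C), fun ω => Real.exp_le_exp.2 (Finset.sum_le_sum
        fun q hq => hC q ?_ ω)⟩
    · refine Real.measurable_exp.comp (Finset.measurable_sum _ fun q hq => ?_)
      rw [Finset.mem_Icc] at hq
      exact (hY q (Finset.mem_Icc.2 ⟨hq.1, by omega⟩)).mono (mono (by simpa using hq.2)) le_rfl
    · rw [Finset.mem_Icc] at hq ⊢
      omega

theorem measureReal_le_exp_neg [IsProbabilityMeasure P] {T : ℕ} {F : ℕ → MeasurableSpace Ω}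
    (mono : Monotone F) (le : ∀ t ≤ T, F t ≤ m0) {Y : ℕ → Ω → ℝ} {C : ℝ}
    (hY : ∀ t ∈ Finset.Icc 1 T, Measurable[F t] (Y t))
    (hC : ∀ t ∈ Finset.Icc 1 T, ∀ ω, Y t ω ≤ C)
    (step : ∀ t ∈ Finset.Icc 1 T, ExpStep P (F (t - 1)) (Y t)) {t : ℕ} (ht : t ≤ T) (a : ℝ) :
    P.real {ω | a ≤ ∑ q ∈ Finset.Icc 1 t, Y q ω} ≤ Real.exp (-a) := by
  have hmem : ∀ q ∈ Finset.Icc 1 t, q ∈ Finset.Icc 1 T := fun q hq => by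
    rw [Finset.mem_Icc] at hq ⊢; omega
  have hm : Measurable fun ω => Real.exp (∑ q ∈ Finset.Icc 1 t, Y q ω) := by
    refine Real.measurable_exp.comp (Finset.measurable_sum _ fun q hq => ?_)
    exact (hY q (hmem q hq)).mono (le q (Finset.mem_Icc.1 (hmem q hq)).2) le_rfl
  have hi : Integrable (fun ω => Real.exp (∑ q ∈ Finset.Icc 1 t, Y q ω)) P := by
    refine integrable_of_bounded hm (C := Real.exp (∑ q ∈ Finset.Icc 1 t, C)) fun ω => ?_
    rw [abs_of_pos (Real.exp_pos _)]
    exact Real.exp_le_exp.2 (Finset.sum_le_sum fun q hq => hC q (hmem q hq) ω)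
  have h := mul_meas_ge_le_integral_of_nonneg (μ := P)
    (Filter.Eventually.of_forall fun ω => (Real.exp_pos _).le) hi (Real.exp a)
  simp only [Real.exp_le_exp] at h
  rw [Real.exp_neg, ← one_div, le_div_iff₀ (Real.exp_pos a), mul_comm]
  exact h.trans (integral_exp_sum_le_one mono hY hC step ht)

theorem exp_le_one_add_add_sq {x : ℝ} (hx : |x| ≤ 1) : Real.exp x ≤ 1 + x + x ^ 2 := by
  have := (abs_le.1 (Real.abs_exp_sub_one_sub_id_le hx)).2
  linarith

/-- From e^y ≤ 1 + y + y² on [-1, 1] and 1 + l² ≤ exp(l²), the exponential lies below a function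
affine in `X`. Only the conditional mean of `X` then enters, and its linear term integrates to zero.
-/
theorem expStep_reward [IsProbabilityMeasure P] {F : MeasurableSpace Ω} (hF : F ≤ m0)
    {X μ Z : Ω → ℝ} (hX : Measurable[m0] X) (hX01 : ∀ ω, X ω ∈ Set.Icc (0 : ℝ) 1)
    (hμ : Measurable[F] μ) (hμ01 : ∀ ω, μ ω ∈ Set.Icc (0 : ℝ) 1) (hZ : Measurable[F] Z)
    (hZ01 : ∀ ω, Z ω = 0 ∨ Z ω = 1) (hmean : P[X | F] =ᵐ[P] μ) {l : ℝ} (hl : |l| ≤ 1) :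
    ExpStep P F fun ω => Z ω * (l * (X ω - μ ω) - l ^ 2) := by
  rintro W hW hW0 ⟨C, hC⟩
  set V : Ω → ℝ := fun ω => W ω * (Z ω * (Real.exp (-l ^ 2) * l)) with hV
  have hVm : Measurable[F] V := hW.mul (hZ.mul measurable_const)
  have hWm : Measurable[m0] W := hW.mono hF le_rfl
  have hZm : Measurable[m0] Z := hZ.mono hF le_rfl
  have hμm : Measurable[m0] μ := hμ.mono hF le_rfl
  have hVm' : Measurable[m0] V := hVm.mono hF le_rfl
  have hl2 : Real.exp (-l ^ 2) ≤ 1 := by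
    rw [Real.exp_le_one_iff]; nlinarith
  have hVb : ∀ ω, |V ω| ≤ C := by
    intro ω
    rw [hV, abs_mul, abs_of_nonneg (hW0 ω)]
    refine (mul_le_of_le_one_right (hW0 ω) ?_).trans (hC ω)
    rw [abs_mul, abs_mul, abs_of_pos (Real.exp_pos _)]
    rcases hZ01 ω with h | h
    · simp [h]
    · rw [h, abs_one, one_mul]
      exact mul_le_one₀ hl2 (abs_nonneg _) hl
  have hXi : Integrable X P := integrable_of_bounded hX (C := 1) fun ω => by
    rw [abs_of_nonneg (hX01 ω).1]; exact (hX01 ω).2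
  have hμi : Integrable μ P := integrable_of_bounded hμm (C := 1) fun ω => by
    rw [abs_of_nonneg (hμ01 ω).1]; exact (hμ01 ω).2
  have hVX : Integrable (V * X) P := hXi.bdd_mul hVm'.aestronglyMeasurable
    (Filter.Eventually.of_forall hVb)
  have hVμ : Integrable (V * μ) P := hμi.bdd_mul hVm'.aestronglyMeasurable
    (Filter.Eventually.of_forall hVb)
  have hWi : Integrable W P := integrable_of_bounded hWm (C := C) fun ω => by
    rw [abs_of_nonneg (hW0 ω)]; exact hC ω
  have heq : ∫ ω, (V * X) ω ∂P = ∫ ω, (V * μ) ω ∂P := by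
    rw [← integral_condExp hF (f := V * X)]
    refine integral_congr_ae ?_
    refine (condExp_mul_of_stronglyMeasurable_left hVm.stronglyMeasurable hVX hXi).trans ?_
    filter_upwards [hmean] with ω hω
    simp [hω]
  have hb : ∀ ω, W ω * Real.exp (Z ω * (l * (X ω - μ ω) - l ^ 2))
      ≤ W ω + ((V * X) ω - (V * μ) ω) := by
    intro ω
    rcases hZ01 ω with h | h
    · simp [hV, h]
    · have hd : |l * (X ω - μ ω)| ≤ 1 := by
        rw [abs_mul]
        refine mul_le_one₀ hl (abs_nonneg _) (abs_le.2 ⟨?_, ?_⟩) <;>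
          linarith [(hX01 ω).1, (hX01 ω).2, (hμ01 ω).1, (hμ01 ω).2]
      have hd2 : (X ω - μ ω) ^ 2 ≤ 1 := by
        nlinarith [(hX01 ω).1, (hX01 ω).2, (hμ01 ω).1, (hμ01 ω).2]
      have h1 : Real.exp (l * (X ω - μ ω)) ≤ 1 + l * (X ω - μ ω) + l ^ 2 := by
        have := exp_le_one_add_add_sq hd
        have : (l * (X ω - μ ω)) ^ 2 ≤ l ^ 2 := by
          rw [mul_pow]; exact mul_le_of_le_one_right (sq_nonneg _) hd2
        linarith
      have h2 : Real.exp (-l ^ 2) * (1 + l ^ 2) ≤ 1 := by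
        rw [Real.exp_neg, inv_mul_le_iff₀ (Real.exp_pos _), mul_one]
        linarith [Real.add_one_le_exp (l ^ 2)]
      have h3 : Real.exp (l * (X ω - μ ω) - l ^ 2)
          ≤ 1 + Real.exp (-l ^ 2) * l * (X ω - μ ω) := by
        rw [sub_eq_add_neg, Real.exp_add, mul_comm]
        have := mul_le_mul_of_nonneg_left h1 (Real.exp_pos (-l ^ 2)).le
        nlinarith
      have h4 := mul_le_mul_of_nonneg_left h3 (hW0 ω)
      simp only [hV, h, Pi.mul_apply, one_mul]
      linarith
  calc _ ≤ ∫ ω, (W ω + ((V * X) ω - (V * μ) ω)) ∂P := by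
        refine integral_mono_of_nonneg (Filter.Eventually.of_forall fun ω => ?_)
          (hWi.add (hVX.sub hVμ)) (Filter.Eventually.of_forall hb)
        exact mul_nonneg (hW0 ω) (Real.exp_pos _).le
    _ = _ := by
        refine (integral_add hWi (hVX.sub hVμ)).trans ?_
        rw [integral_sub' hVX hVμ, heq, sub_self, add_zero]

/-- As `Z` and the coin take the values 0 and 1, the weighted exponential is affine in the coin, and
independence factors its integral. What remains is 1 + (e^l - 1)p ≤ exp((e^l - 1)p). -/
theorem expStep_coin [IsProbabilityMeasure P] {F : MeasurableSpace Ω} (hF : F ≤ m0)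
    {E : Type*} [MeasurableSpace E] {ξ : Ω → E} (hξ : Measurable[m0] ξ)
    (hind : Indep (MeasurableSpace.comap ξ inferInstance) F P) {B : Set E} (hB : MeasurableSet B)
    {p : ℝ} (hp : P.real (ξ ⁻¹' B) = p) {Z : Ω → ℝ} (hZ : Measurable[F] Z)
    (hZ01 : ∀ ω, Z ω = 0 ∨ Z ω = 1) (l : ℝ) :
    ExpStep P F fun ω => Z ω * (l * B.indicator 1 (ξ ω) - (Real.exp l - 1) * p) := by
  rintro W hW hW0 ⟨C, hC⟩
  set e : ℝ := Real.exp (-((Real.exp l - 1) * p)) with he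
  set b : Ω → ℝ := fun ω => B.indicator 1 (ξ ω) with hb
  have hWm : Measurable[m0] W := hW.mono hF le_rfl
  have hZm : Measurable[m0] Z := hZ.mono hF le_rfl
  have hbm' : Measurable[MeasurableSpace.comap ξ inferInstance] b :=
    (measurable_one.indicator hB).comp (comap_measurable ξ)
  have hbm : Measurable[m0] b := hbm'.mono hξ.comap_le le_rfl
  have hb01 : ∀ ω, b ω = 0 ∨ b ω = 1 := fun ω => by
    by_cases h : ξ ω ∈ B <;> simp [hb, h]
  have hWi : Integrable W P := integrable_of_bounded hWm (C := C) fun ω => by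
    rw [abs_of_nonneg (hW0 ω)]; exact hC ω
  have hZb : ∀ ω, ‖Z ω‖ ≤ 1 := fun ω => by rcases hZ01 ω with h | h <;> simp [h]
  have hbb : ∀ ω, ‖b ω‖ ≤ 1 := fun ω => by rcases hb01 ω with h | h <;> simp [h]
  have hZW : Integrable (fun ω => Z ω * W ω) P := hWi.bdd_mul hZm.aestronglyMeasurable
    (Filter.Eventually.of_forall hZb)
  have hbZW : Integrable (fun ω => b ω * (Z ω * W ω)) P := hZW.bdd_mul hbm.aestronglyMeasurable
    (Filter.Eventually.of_forall hbb)
  have hmean : ∫ ω, b ω ∂P = p := by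
    have : b = (ξ ⁻¹' B).indicator 1 := by
      ext ω; by_cases h : ξ ω ∈ B <;> simp [hb, h]
    rw [this, integral_indicator_one (hξ hB), hp]
  have hprod : ∫ ω, b ω * (Z ω * W ω) ∂P = p * ∫ ω, Z ω * W ω ∂P := by
    rw [← hmean]
    refine IndepFun.integral_fun_mul_eq_mul_integral ?_ hbm.aestronglyMeasurable
      (hZm.mul hWm).aestronglyMeasurable
    rw [IndepFun_iff_Indep]
    exact indep_of_indep_of_le_left (indep_of_indep_of_le_right hind (hZ.mul hW).comap_le)
      hbm'.comap_le
  have heq : ∀ ω, W ω * Real.exp (Z ω * (l * b ω - (Real.exp l - 1) * p))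
      = W ω + ((e - 1) * (Z ω * W ω) + e * (Real.exp l - 1) * (b ω * (Z ω * W ω))) := by
    intro ω
    rcases hZ01 ω with h | h
    · simp [h]
    · rw [h, one_mul, sub_eq_add_neg, Real.exp_add, ← he]
      rcases hb01 ω with h' | h' <;> simp [h'] <;> ring
  have hle : e * (1 + (Real.exp l - 1) * p) ≤ 1 := by
    rw [he, Real.exp_neg, inv_mul_le_iff₀ (Real.exp_pos _), mul_one]
    linarith [Real.add_one_le_exp ((Real.exp l - 1) * p)]
  have h0 : 0 ≤ ∫ ω, Z ω * W ω ∂P := integral_nonneg fun ω => by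
    rcases hZ01 ω with h | h <;> simp [h, hW0 ω]
  change ∫ ω, W ω * Real.exp (Z ω * (l * b ω - (Real.exp l - 1) * p)) ∂P ≤ _
  simp_rw [heq]
  refine (integral_add hWi ((hZW.const_mul _).add (hbZW.const_mul _))).trans_le ?_
  rw [integral_add' (hZW.const_mul _) (hbZW.const_mul _), integral_const_mul, integral_const_mul,
    hprod]
  nlinarith

theorem measureReal_biUnion_le_mul [IsProbabilityMeasure P] {ι : Type*} (s : Finset ι)
    {E : ι → Set Ω} {b : ℝ} (h : ∀ i ∈ s, P.real (E i) ≤ b) :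
    P.real (⋃ i ∈ s, E i) ≤ s.card * b := by
  refine (measureReal_biUnion_finset_le s E).trans ?_
  simpa using Finset.sum_le_card_nsmul s _ b h

theorem measureReal_exists_le_exp_neg [IsProbabilityMeasure P] {T : ℕ} {F : ℕ → MeasurableSpace Ω}
    (mono : Monotone F) (le : ∀ t ≤ T, F t ≤ m0) {Y : ℕ → Ω → ℝ} {C : ℝ}
    (hY : ∀ t ∈ Finset.Icc 1 T, Measurable[F t] (Y t))
    (hC : ∀ t ∈ Finset.Icc 1 T, ∀ ω, Y t ω ≤ C)
    (step : ∀ t ∈ Finset.Icc 1 T, ExpStep P (F (t - 1)) (Y t)) (a : ℝ) :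
    P.real {ω | ∃ t ≤ T, a ≤ ∑ q ∈ Finset.Icc 1 t, Y q ω} ≤ (T + 1) * Real.exp (-a) := by
  have h := measureReal_biUnion_le_mul (P := P) (Finset.range (T + 1))
    (E := fun t => {ω | a ≤ ∑ q ∈ Finset.Icc 1 t, Y q ω}) (b := Real.exp (-a)) fun t ht =>
      measureReal_le_exp_neg mono le hY hC step (by simpa [Nat.lt_succ_iff] using ht) a
  rw [Finset.card_range] at h
  push_cast at h
  refine (measureReal_mono ?_ (measure_ne_top _ _)).trans h
  rintro ω ⟨t, ht, hω⟩
  exact Set.mem_biUnion (Finset.mem_coe.2 (Finset.mem_range.2 (Nat.lt_succ_of_le ht))) hω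

theorem exists_nat_eq_sum {s : Finset ℕ} {Z : ℕ → ℝ} (hZ : ∀ q ∈ s, Z q = 0 ∨ Z q = 1) :
    ∃ N ≤ s.card, (N : ℝ) = ∑ q ∈ s, Z q := by
  classical
  refine ⟨(s.filter fun q => Z q = 1).card, Finset.card_filter_le _ _, ?_⟩
  rw [Finset.card_filter]
  push_cast
  refine Finset.sum_congr rfl fun q hq => ?_
  rcases hZ q hq with h | h <;> simp [h]

/-- The tilt √(ι/N) balances both terms: its square times N is ι, and its product with √(ιN) is ι.
-/
theorem le_of_tilted_le {ι p N S : ℝ} (hι : 0 < ι) (hN : ι ≤ N)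
    (h : √(ι / N) * S - √(ι / N) ^ 2 * N ≤ p * ι) : S ≤ (1 + p) * √(ι * N) := by
  have hN0 : 0 < N := hι.trans_le hN
  have hl : 0 < √(ι / N) := Real.sqrt_pos.2 (div_pos hι hN0)
  have h1 : √(ι / N) ^ 2 * N = ι := by
    rw [Real.sq_sqrt (div_pos hι hN0).le]; field_simp
  have h2 : √(ι / N) * √(ι * N) = ι := by
    rw [← Real.sqrt_mul (div_pos hι hN0).le, show ι / N * (ι * N) = ι * ι by field_simp,
      Real.sqrt_mul_self hι.le]
  refine le_of_mul_le_mul_left ?_ hl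
  calc _ ≤ (1 + p) * ι := by linarith
    _ = _ := by rw [mul_left_comm, h2]

/-- Self-normalized concentration of a bounded reward process along a predictable set of rounds. -/
theorem reward_concentration [IsProbabilityMeasure P] {T : ℕ} {F info : ℕ → MeasurableSpace Ω}
    (mono : Monotone F) (le : ∀ t ≤ T, F t ≤ m0)
    (hinfo : ∀ t ∈ Finset.Icc 1 T, F (t - 1) ≤ info t ∧ info t ≤ F t)
    {X μ Z : ℕ → Ω → ℝ} (hX : ∀ t ∈ Finset.Icc 1 T, Measurable[F t] (X t))
    (hX01 : ∀ t ∈ Finset.Icc 1 T, ∀ ω, X t ω ∈ Set.Icc (0 : ℝ) 1)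
    (hμ : ∀ t ∈ Finset.Icc 1 T, Measurable[info t] (μ t))
    (hμ01 : ∀ t ∈ Finset.Icc 1 T, ∀ ω, μ t ω ∈ Set.Icc (0 : ℝ) 1)
    (hZ : ∀ t ∈ Finset.Icc 1 T, Measurable[info t] (Z t))
    (hZ01 : ∀ t ω, Z t ω = 0 ∨ Z t ω = 1)
    (hmean : ∀ t ∈ Finset.Icc 1 T, P[X t | info t] =ᵐ[P] μ t) {ι p : ℝ} (hι : 0 < ι) (hp : 0 ≤ p) :
    P.real {ω | ¬ ∀ t ≤ T, |∑ q ∈ Finset.Icc 1 t, Z q ω * (X q ω - μ q ω)|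
      ≤ (1 + p) * √(ι * ∑ q ∈ Finset.Icc 1 t, Z q ω)} ≤ 2 * (T + 1) ^ 2 * Real.exp (-(p * ι)) := by
  -- The optimal tilt depends on the random number of selected rounds, so one tilt is prepared for
  -- every possible value N. For N < ι the optimal tilt would exceed 1; the value 0 is a dummy
  -- there, since the trivial bound N ≤ √(ιN) is good enough.
  set lam : ℕ → ℝ := fun N => if ι ≤ N then √(ι / N) else 0 with hlam
  have hl1 : ∀ N, |lam N| ≤ 1 := by
    intro N
    simp only [hlam]
    split_ifs with h
    · rw [abs_of_nonneg (Real.sqrt_nonneg _)]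
      exact Real.sqrt_le_one.2 (div_le_one_of_le₀ h (Nat.cast_nonneg N))
    · simp
  set E : ℝ → Set Ω := fun l => {ω | ∃ t ≤ T, p * ι ≤
    ∑ q ∈ Finset.Icc 1 t, Z q ω * (l * (X q ω - μ q ω) - l ^ 2)} with hE
  have hEb : ∀ l : ℝ, |l| ≤ 1 → P.real (E l) ≤ (T + 1) * Real.exp (-(p * ι)) := by
    intro l hl
    refine measureReal_exists_le_exp_neg (C := 1) mono le ?_ ?_ ?_ _
    · intro t ht
      have hμ' := (hμ t ht).mono (hinfo t ht).2 le_rfl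
      have hZ' := (hZ t ht).mono (hinfo t ht).2 le_rfl
      exact hZ'.mul ((((hX t ht).sub hμ').const_mul l).sub measurable_const)
    · intro t ht ω
      have h1 := hX01 t ht ω
      have h2 := hμ01 t ht ω
      rw [abs_le] at hl
      rcases hZ01 t ω with h | h
      · simp [h]
      · rw [h, one_mul]
        nlinarith [h1.1, h1.2, h2.1, h2.2, sq_nonneg l, mul_nonneg (sub_nonneg.2 hl.2)
          (by linarith [h1.1, h2.2] : 0 ≤ 1 + (X t ω - μ t ω)), mul_nonneg (by linarith :
            0 ≤ 1 + l) (by linarith [h1.2, h2.1] : 0 ≤ 1 - (X t ω - μ t ω))]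
    · intro t ht
      have hle := (hinfo t ht).2.trans (le t (Finset.mem_Icc.1 ht).2)
      refine (expStep_reward hle ((hX t ht).mono (le t (Finset.mem_Icc.1 ht).2) le_rfl)
        (hX01 t ht) (hμ t ht) (hμ01 t ht) (hZ t ht) (hZ01 t) (hmean t ht) hl).mono (hinfo t ht).1
  -- Union over the T + 1 possible counts and both signs of the tilt.
  have hU := measureReal_biUnion_le_mul (P := P) (Finset.range (T + 1))
    (E := fun N => E (lam N) ∪ E (-lam N)) (b := 2 * ((T + 1) * Real.exp (-(p * ι)))) fun N _ => by
      refine (measureReal_union_le _ _).trans ?_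
      have h1 := hEb _ (hl1 N)
      have h2 := hEb (-lam N) (by rw [abs_neg]; exact hl1 N)
      linarith
  rw [Finset.card_range] at hU
  push_cast at hU
  refine (measureReal_mono ?_ (measure_ne_top _ _)).trans (hU.trans (le_of_eq (by ring)))
  intro ω hω
  simp only [Set.mem_ofPred_eq, not_forall] at hω
  obtain ⟨t, ht, hω⟩ := hω
  obtain ⟨N, hN, hNs⟩ := exists_nat_eq_sum (s := Finset.Icc 1 t) (Z := fun q => Z q ω)
    fun q _ => hZ01 q ω
  rw [Nat.card_Icc, Nat.add_sub_cancel] at hN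
  refine Set.mem_biUnion (Finset.mem_coe.2 (Finset.mem_range.2
    (Nat.lt_succ_of_le (hN.trans ht)))) ?_
  rw [← hNs] at hω
  by_contra hcon
  simp only [Set.mem_union, not_or, hE, Set.mem_ofPred_eq, not_exists, not_and, not_le] at hcon
  have h1 := (hcon.1 t ht).le
  have h2 := (hcon.2 t ht).le
  have hsplit : ∀ l : ℝ, ∑ q ∈ Finset.Icc 1 t, Z q ω * (l * (X q ω - μ q ω) - l ^ 2)
      = l * (∑ q ∈ Finset.Icc 1 t, Z q ω * (X q ω - μ q ω)) - l ^ 2 * N := by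
    intro l
    rw [hNs, Finset.mul_sum, Finset.mul_sum, ← Finset.sum_sub_distrib]
    exact Finset.sum_congr rfl fun q _ => by ring
  rw [hsplit] at h1 h2
  refine hω ?_
  by_cases hιN : ι ≤ N
  · simp only [hlam, if_pos hιN] at h1 h2
    rw [abs_le]
    constructor
    · have := le_of_tilted_le (p := p) (S := -∑ q ∈ Finset.Icc 1 t, Z q ω * (X q ω - μ q ω)) hι hιN
        (by rw [neg_sq] at h2; linarith)
      linarith
    · exact le_of_tilted_le hι hιN h1
  · have hN' : (N : ℝ) ≤ √(ι * N) := by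
      refine Real.le_sqrt_of_sq_le ?_
      nlinarith [not_le.1 hιN, (Nat.cast_nonneg N : (0 : ℝ) ≤ N)]
    calc _ ≤ ∑ q ∈ Finset.Icc 1 t, |Z q ω * (X q ω - μ q ω)| := Finset.abs_sum_le_sum_abs _ _
      _ ≤ ∑ q ∈ Finset.Icc 1 t, Z q ω := by
        refine Finset.sum_le_sum fun q hq => ?_
        have hq' : q ∈ Finset.Icc 1 T := by
          rw [Finset.mem_Icc] at hq ⊢; omega
        have h3 := hX01 q hq' ω
        have h4 := hμ01 q hq' ω
        rcases hZ01 q ω with h | h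
        · simp [h]
        · rw [h, one_mul, abs_le]
          constructor <;> linarith [h3.1, h3.2, h4.1, h4.2]
      _ = N := hNs.symm
      _ ≤ √(ι * N) := hN'
      _ ≤ _ := le_mul_of_one_le_left (Real.sqrt_nonneg _) (by linarith)

/-- Concentration of the number of successes among predictably chosen independent coins. -/
theorem coin_concentration [IsProbabilityMeasure P] {T : ℕ} {F : ℕ → MeasurableSpace Ω}
    (mono : Monotone F) (le : ∀ t ≤ T, F t ≤ m0) {E : Type*} [MeasurableSpace E]
    {ξ : ℕ → Ω → E} (hξ : ∀ t ∈ Finset.Icc 1 T, Measurable[F t] (ξ t))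
    (hind : ∀ t ∈ Finset.Icc 1 T, Indep (MeasurableSpace.comap (ξ t) inferInstance) (F (t - 1)) P)
    {B : Set E} (hB : MeasurableSet B) {p : ℝ}
    (hp : ∀ t ∈ Finset.Icc 1 T, P.real (ξ t ⁻¹' B) = p) {Z : ℕ → Ω → ℝ}
    (hZ : ∀ t ∈ Finset.Icc 1 T, Measurable[F (t - 1)] (Z t))
    (hZ01 : ∀ t ω, Z t ω = 0 ∨ Z t ω = 1) (l a : ℝ) :
    P.real {ω | ∃ t ≤ T, a ≤ ∑ q ∈ Finset.Icc 1 t,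
      Z q ω * (l * B.indicator 1 (ξ q ω) - (Real.exp l - 1) * p)} ≤ (T + 1) * Real.exp (-a) := by
  refine measureReal_exists_le_exp_neg (C := |l| + |(Real.exp l - 1) * p|) mono le ?_ ?_ ?_ a
  · intro t ht
    have h1 : Measurable[F t] fun ω => B.indicator (1 : E → ℝ) (ξ t ω) :=
      (measurable_one.indicator hB).comp (hξ t ht)
    exact ((hZ t ht).mono (mono (Nat.sub_le t 1)) le_rfl).mul
      ((h1.const_mul l).sub measurable_const)
  · intro t ht ω
    rcases hZ01 t ω with h | h
    · rw [h, zero_mul]; positivity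
    · rw [h, one_mul]
      have h1 : l * B.indicator 1 (ξ t ω) ≤ |l| := by
        by_cases h : ξ t ω ∈ B <;> simp [h, le_abs_self]
      linarith [neg_abs_le ((Real.exp l - 1) * p)]
  · intro t ht
    have htT := (Finset.mem_Icc.1 ht).2
    exact expStep_coin (le (t - 1) (by omega)) ((hξ t ht).mono (le t htT) le_rfl) (hind t ht) hB
      (hp t ht) (hZ t ht) (hZ01 t) l

end Supermartingale

end Bandit

namespace Bandit

/-! ## Deterministic analysis of UCB1 -/

section UCBAnalysis

theorem sum_sqrt_le {ι : Type*} (s : Finset ι) {x : ι → ℝ} (hx : ∀ i ∈ s, 0 ≤ x i) :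
    ∑ i ∈ s, √(x i) ≤ √(s.card * ∑ i ∈ s, x i) := by
  refine Real.le_sqrt_of_sq_le ?_
  refine (sq_sum_le_card_mul_sum_sq (s := s) (f := fun i => √(x i))).trans (le_of_eq ?_)
  congr 1
  exact Finset.sum_congr rfl fun i hi => Real.sq_sqrt (hx i hi)

/-- The optimistic index of an arm with `N` pulls and total reward `S`. -/
noncomputable def indexOf (c ι : ℝ) (N : ℕ) (S : ℝ) : ℝ :=
  S / ((max 1 N : ℕ) : ℝ) + c * √(ι / ((max 1 N : ℕ) : ℝ))

theorem ucbIndex_eq {A : ℕ} (c : ℝ) (T : ℕ) (δ : ℝ) (h : List (Fin A × ℝ)) (a : Fin A) :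
    ucbIndex c T δ h a = indexOf c (Real.log (T / δ)) (h.filter (fun x => x.1 = a)).length
      ((h.filter (fun x => x.1 = a)).map Prod.snd).sum := rfl

theorem sqrt_mul_div_self {ι N : ℝ} (hι : 0 ≤ ι) (hN : 0 < N) : √(ι * N) / N = √(ι / N) := by
  rw [div_eq_iff hN.ne']
  conv_rhs => rw [show N = √(N ^ 2) by rw [Real.sqrt_sq hN.le]]
  rw [← Real.sqrt_mul (by positivity)]
  congr 1
  rw [Real.sqrt_sq hN.le]
  field_simp

theorem abs_indexOf_sub_le {c ι x V : ℝ} (hι : 0 ≤ ι) {Q : Finset ℕ} {R g : ℕ → ℝ}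
    (hQ : Q.Nonempty) (hconc : |∑ q ∈ Q, (R q - g q)| ≤ c * √(ι * Q.card))
    (hV : ∀ q ∈ Q, |g q - x| ≤ V) :
    |(∑ q ∈ Q, R q) / ((max 1 Q.card : ℕ) : ℝ) - x| ≤
      V + c * √(ι / ((max 1 Q.card : ℕ) : ℝ)) := by
  have hN1 : 1 ≤ Q.card := hQ.card_pos
  have hN : (0 : ℝ) < Q.card := by exact_mod_cast hN1
  rw [max_eq_right hN1]
  have h1 : |∑ q ∈ Q, (g q - x)| ≤ Q.card * V := by
    refine (Finset.abs_sum_le_sum_abs _ _).trans ?_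
    simpa using Finset.sum_le_card_nsmul Q _ V hV
  have h2 : (∑ q ∈ Q, R q) / (Q.card : ℝ) - x
      = (∑ q ∈ Q, (R q - g q) + ∑ q ∈ Q, (g q - x)) / Q.card := by
    rw [← Finset.sum_add_distrib]
    simp only [sub_add_sub_cancel]
    rw [Finset.sum_sub_distrib, Finset.sum_const, nsmul_eq_mul]
    field_simp
  rw [h2, abs_div, abs_of_pos hN, div_le_iff₀ hN, ← sqrt_mul_div_self hι hN]
  calc _ ≤ |∑ q ∈ Q, (R q - g q)| + |∑ q ∈ Q, (g q - x)| := abs_add_le _ _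
    _ ≤ c * √(ι * Q.card) + Q.card * V := add_le_add hconc h1
    _ = _ := by field_simp; ring

/-- The bonus outweighs the deviation of the empirical mean. An arm without pulls has `N⁺ = 1` and
index c√ι ≥ 1, which is optimistic by itself. -/
theorem le_indexOf {c ι x V : ℝ} (hι : 0 ≤ ι) (hc : 1 ≤ c * √ι) (hx : x ≤ 1) (hV0 : 0 ≤ V)
    {Q : Finset ℕ} {R g : ℕ → ℝ} (hconc : |∑ q ∈ Q, (R q - g q)| ≤ c * √(ι * Q.card))
    (hV : ∀ q ∈ Q, |g q - x| ≤ V) : x - V ≤ indexOf c ι Q.card (∑ q ∈ Q, R q) := by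
  rw [indexOf]
  rcases Q.eq_empty_or_nonempty with rfl | hQ
  · simp; linarith
  · have := (abs_le.1 (abs_indexOf_sub_le hι hQ hconc hV)).1
    linarith

theorem indexOf_le {c ι x V : ℝ} (hι : 0 ≤ ι) (hc : 0 ≤ c) (hx : 0 ≤ x) (hV0 : 0 ≤ V)
    {Q : Finset ℕ} {R g : ℕ → ℝ} (hconc : |∑ q ∈ Q, (R q - g q)| ≤ c * √(ι * Q.card))
    (hV : ∀ q ∈ Q, |g q - x| ≤ V) :
    indexOf c ι Q.card (∑ q ∈ Q, R q) ≤ x + V + 2 * c * √(ι / ((max 1 Q.card : ℕ) : ℝ)) := by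
  rw [indexOf]
  rcases Q.eq_empty_or_nonempty with rfl | hQ
  · simp
    nlinarith [mul_nonneg hc (Real.sqrt_nonneg ι)]
  · have := (abs_le.1 (abs_indexOf_sub_le hι hQ hconc hV)).2
    linarith

/-- A telescoping form of the integral of 1/√N. The factor 3 comes from √(N+1) + √N ≤ 3√N for N ≥ 1,
and leaves room at N = 0, where `N⁺` is 1. -/
theorem sqrt_div_le_sub {N : ℕ} {ι : ℝ} (hι : 0 ≤ ι) :
    √(ι / ((max 1 N : ℕ) : ℝ)) ≤ 3 * √(ι * ((N + 1 : ℕ) : ℝ)) - 3 * √(ι * N) := by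
  rcases Nat.eq_zero_or_pos N with rfl | hN
  · simp
    linarith [Real.sqrt_nonneg ι]
  · rw [max_eq_right hN, Real.sqrt_div hι, Real.sqrt_mul hι, Real.sqrt_mul hι]
    have hN' : (1 : ℝ) ≤ N := by exact_mod_cast hN
    have h1 : 0 < √(N : ℝ) := Real.sqrt_pos.2 (by linarith)
    have h2 : √(N : ℝ) ^ 2 = N := Real.sq_sqrt (by linarith)
    have h3 : √((N + 1 : ℕ) : ℝ) ^ 2 = N + 1 := by
      rw [Real.sq_sqrt (Nat.cast_nonneg _)]; push_cast; ring
    have h4 := Real.sqrt_nonneg ((N + 1 : ℕ) : ℝ)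
    have h5 : √((N + 1 : ℕ) : ℝ) ≤ 2 * √(N : ℝ) := by nlinarith
    have h6 : 1 ≤ 3 * (√((N + 1 : ℕ) : ℝ) - √(N : ℝ)) * √(N : ℝ) := by
      have : (√((N + 1 : ℕ) : ℝ) - √(N : ℝ)) * (√((N + 1 : ℕ) : ℝ) + √(N : ℝ)) = 1 := by
        nlinarith
      have h7 : 0 ≤ √((N + 1 : ℕ) : ℝ) - √(N : ℝ) := by nlinarith
      nlinarith
    rw [div_le_iff₀ h1]
    nlinarith [Real.sqrt_nonneg ι, mul_le_mul_of_nonneg_left h6 (Real.sqrt_nonneg ι)]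

theorem sum_sqrt_div_card_lt_le {ι : ℝ} (hι : 0 ≤ ι) (Q : Finset ℕ) :
    ∑ r ∈ Q, √(ι / ((max 1 (Q.filter (· < r)).card : ℕ) : ℝ)) ≤ 3 * √(ι * Q.card) := by
  induction Q using Finset.induction_on_max with
  | empty => simp
  | insert r Q hr ih =>
    have hnot : r ∉ Q := fun h => lt_irrefl _ (hr r h)
    rw [Finset.sum_insert hnot, Finset.card_insert_of_notMem hnot]
    have h1 : (insert r Q).filter (· < r) = Q := by
      ext q
      simp only [Finset.mem_filter, Finset.mem_insert]
      constructor
      · rintro ⟨rfl | h, h'⟩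
        · exact absurd h' (lt_irrefl _)
        · exact h
      · exact fun h => ⟨Or.inr h, hr q h⟩
    have h2 : ∀ q ∈ Q, (insert r Q).filter (· < q) = Q.filter (· < q) := by
      intro q hq
      rw [Finset.filter_insert, if_neg (by have := hr q hq; omega)]
    rw [h1, Finset.sum_congr rfl fun q hq => by rw [h2 q hq]]
    linarith [sqrt_div_le_sub (N := Q.card) hι]

variable {A : ℕ}

theorem sum_sqrt_card_filter_le {ι : ℝ} (hι : 0 ≤ ι) (S : Finset ℕ) (pol : ℕ → Fin A) :
    ∑ a, √(ι * (S.filter fun q => pol q = a).card) ≤ √(A * ι * S.card) := by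
  refine (sum_sqrt_le Finset.univ fun a _ => by positivity).trans (le_of_eq ?_)
  rw [← Finset.mul_sum, ← Nat.cast_sum,
    ← Finset.card_eq_sum_card_fiberwise (f := pol) (t := Finset.univ) fun _ _ => Finset.mem_univ _,
    Finset.card_univ, Fintype.card_fin, mul_assoc]

theorem sum_sqrt_div_count_le {ι : ℝ} (hι : 0 ≤ ι) (S : Finset ℕ) (pol : ℕ → Fin A) :
    ∑ r ∈ S, √(ι / ((max 1 (S.filter fun q => q < r ∧ pol q = pol r).card : ℕ) : ℝ))
      ≤ 3 * √(A * ι * S.card) := by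
  rw [← Finset.sum_fiberwise_of_maps_to (t := Finset.univ) (g := pol) fun _ _ => Finset.mem_univ _]
  calc _ ≤ ∑ a, 3 * √(ι * (S.filter fun q => pol q = a).card) := by
        refine Finset.sum_le_sum fun a _ => ?_
        refine (Finset.sum_congr rfl fun r hr => ?_).trans_le
          (sum_sqrt_div_card_lt_le hι (S.filter fun q => pol q = a))
        rw [(Finset.mem_filter.1 hr).2, Finset.filter_filter]
        simp only [and_comm]
    _ ≤ _ := by
        rw [← Finset.mul_sum]
        exact mul_le_mul_of_nonneg_left (sum_sqrt_card_filter_le hι S pol) (by norm_num)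

/-- The rewards of every arm, summed over its pulls before any round, concentrate. -/
def Concentrated (c ι : ℝ) (S : Finset ℕ) (pol : ℕ → Fin A) (R : ℕ → ℝ) (f : ℕ → Fin A → ℝ)
    (a : Fin A) : Prop :=
  ∀ r, |∑ q ∈ S.filter (fun q => q < r ∧ pol q = a), (R q - f q a)|
    ≤ c * √(ι * (S.filter fun q => q < r ∧ pol q = a).card)

theorem Concentrated.filter {c ι : ℝ} {S : Finset ℕ} {pol : ℕ → Fin A} {R : ℕ → ℝ}
    {f : ℕ → Fin A → ℝ} {a : Fin A} (h : Concentrated c ι S pol R f a) :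
    |∑ q ∈ S.filter (fun q => pol q = a), (R q - f q a)|
      ≤ c * √(ι * (S.filter fun q => pol q = a).card) := by
  -- A cutoff beyond all elements of `S` selects every pull.
  have := h (S.sup id + 1)
  rwa [Finset.filter_congr (q := fun q => pol q = a) fun q hq => by
    have : q ≤ S.sup id := Finset.le_sup (f := id) hq
    simp only [and_iff_right_iff_imp]
    omega] at this

/-- The regret of UCB1 against its own estimates, along the set `S` of rounds in which it is
active. -/
theorem sum_ucb_est_sub_le {c ι V : ℝ} (hι : 0 ≤ ι) (hc : 0 ≤ c) (hV0 : 0 ≤ V) {S : Finset ℕ}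
    {pol : ℕ → Fin A} {R est : ℕ → ℝ} {f : ℕ → Fin A → ℝ} (hf : ∀ q ∈ S, ∀ a, 0 ≤ f q a)
    (hV : ∀ q ∈ S, ∀ r ∈ S, ∀ a, |f q a - f r a| ≤ V)
    (hconc : ∀ a, Concentrated c ι S pol R f a)
    (hest : ∀ r ∈ S, est r ≤ indexOf c ι (S.filter fun q => q < r ∧ pol q = pol r).card
      (∑ q ∈ S.filter (fun q => q < r ∧ pol q = pol r), R q)) :
    ∑ r ∈ S, (est r - R r) ≤ S.card * V + 7 * c * √(A * ι * S.card) := by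
  -- Estimates against means cost 2c times the factor 3 of the telescoping sum; means against
  -- rewards cost c more in `h2`. Hence 7c, which is 119 for c = 17.
  have h1 : ∑ r ∈ S, (est r - f r (pol r)) ≤ S.card * V + 6 * c * √(A * ι * S.card) := by
    calc _ ≤ ∑ r ∈ S, (V + 2 * c *
          √(ι / ((max 1 (S.filter fun q => q < r ∧ pol q = pol r).card : ℕ) : ℝ))) := by
          refine Finset.sum_le_sum fun r hr => ?_
          have := indexOf_le hι hc (hf r hr (pol r)) hV0 (hconc (pol r) r) fun q hq =>
            hV q (Finset.mem_filter.1 hq).1 r hr _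
          linarith [hest r hr]
      _ ≤ _ := by
          rw [Finset.sum_add_distrib, Finset.sum_const, nsmul_eq_mul, ← Finset.mul_sum]
          have := mul_le_mul_of_nonneg_left (sum_sqrt_div_count_le hι S pol)
            (by positivity : 0 ≤ 2 * c)
          linarith
  have h2 : ∑ r ∈ S, (f r (pol r) - R r) ≤ c * √(A * ι * S.card) := by
    rw [← Finset.sum_fiberwise_of_maps_to (t := Finset.univ) (g := pol)
      fun _ _ => Finset.mem_univ _]
    calc _ ≤ ∑ a, c * √(ι * (S.filter fun q => pol q = a).card) := by
          refine Finset.sum_le_sum fun a _ => ?_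
          have h := (abs_le.1 (hconc a).filter).1
          rw [Finset.sum_congr rfl fun r hr => by rw [(Finset.mem_filter.1 hr).2]]
          rw [Finset.sum_sub_distrib] at h ⊢
          linarith
      _ ≤ _ := by
          rw [← Finset.mul_sum]
          exact mul_le_mul_of_nonneg_left (sum_sqrt_card_filter_le hι S pol) hc
  calc _ = ∑ r ∈ S, (est r - f r (pol r)) + ∑ r ∈ S, (f r (pol r) - R r) := by
        rw [← Finset.sum_add_distrib]; simp
    _ ≤ _ := by linarith

variable {c δ : ℝ} {T : ℕ} {tie : Finset (Fin A) → Fin A}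

/-- The set of maximizers is nonempty, so the tie-breaking rule picks one of them. -/
theorem ucbIndex_le_act (hA : 1 ≤ A) (htie : ∀ s : Finset (Fin A), s.Nonempty → tie s ∈ s)
    (h : List (Fin A × ℝ)) (b : Fin A) :
    ucbIndex c T δ h b ≤ ucbIndex c T δ h ((ucb1 A c T δ tie).act h) := by
  classical
  have : Nonempty (Fin A) := ⟨⟨0, hA⟩⟩
  obtain ⟨a, ha⟩ := Finite.exists_max (ucbIndex c T δ h)
  have hne : (Finset.univ.filter fun a => ∀ b, ucbIndex c T δ h b ≤ ucbIndex c T δ h a).Nonempty :=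
    ⟨a, by simpa using ha⟩
  have := htie _ hne
  simp only [Finset.mem_filter, Finset.mem_univ, true_and] at this
  exact (by convert this b : _)

theorem ucb1_est_eq (hA : 1 ≤ A) (htie : ∀ s : Finset (Fin A), s.Nonempty → tie s ∈ s)
    (h : List (Fin A × ℝ)) :
    (ucb1 A c T δ tie).est h = min (ucbIndex c T δ h ((ucb1 A c T δ tie).act h)) 1 := by
  have : Nonempty (Fin A) := ⟨⟨0, hA⟩⟩
  change min (⨆ a, ucbIndex c T δ h a) 1 = _
  congr 1
  exact le_antisymm (ciSup_le (ucbIndex_le_act hA htie h))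
    (le_ciSup (Set.finite_range _).bddAbove _)

theorem le_ucb1_est (h : List (Fin A × ℝ)) {a : Fin A} {x : ℝ} (hx : x ≤ 1)
    (hxa : x ≤ ucbIndex c T δ h a) : x ≤ (ucb1 A c T δ tie).est h :=
  le_min (hxa.trans (le_ciSup (Set.finite_range _).bddAbove a)) hx

theorem ucb1_est_mem (hc : 0 ≤ c) {h : List (Fin A × ℝ)}
    (hh : ∀ x ∈ h, x.2 ∈ Set.Icc (0 : ℝ) 1) : (ucb1 A c T δ tie).est h ∈ Set.Icc (0 : ℝ) 1 := by
  refine ⟨le_min (Real.iSup_nonneg fun a => ?_) zero_le_one, min_le_right _ _⟩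
  refine add_nonneg (div_nonneg (List.sum_nonneg fun x hx => ?_) (Nat.cast_nonneg _))
    (mul_nonneg hc (Real.sqrt_nonneg _))
  obtain ⟨y, hy, rfl⟩ := List.mem_map.1 hx
  exact (hh y (List.mem_filter.1 hy).1).1

theorem ucb1_est_le_one (h : List (Fin A × ℝ)) : (ucb1 A c T δ tie).est h ≤ 1 := min_le_right _ _

end UCBAnalysis

end Bandit

namespace Bandit

/-! ## Variation of the mean rewards -/

section Variation

variable {A : ℕ}

theorem supVar_nonneg (r : ℕ → Fin A → ℝ) (t : ℕ) : 0 ≤ supVar r t := norm_nonneg _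

theorem abs_sub_le_supVar (r : ℕ → Fin A → ℝ) (t : ℕ) (a : Fin A) :
    |r t a - r (t + 1) a| ≤ supVar r t := by
  simpa [supVar] using norm_le_pi_norm (r t - r (t + 1)) a

theorem totalVar_nonneg {D : ℕ → ℝ} (hD : ∀ t, 0 ≤ D t) (s e : ℕ) : 0 ≤ totalVar D s e :=
  Finset.sum_nonneg fun _ _ => hD _

theorem totalVar_mono {D : ℕ → ℝ} (hD : ∀ t, 0 ≤ D t) {s s' e e' : ℕ} (hs : s' ≤ s)
    (he : e ≤ e') : totalVar D s e ≤ totalVar D s' e' :=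
  Finset.sum_le_sum_of_subset_of_nonneg (Finset.Ico_subset_Ico hs he) fun _ _ _ => hD _

theorem abs_sub_le_totalVar_of_le (r : ℕ → Fin A → ℝ) (a : Fin A) {s e : ℕ} (h : s ≤ e) :
    |r s a - r e a| ≤ totalVar (supVar r) s e := by
  induction e, h using Nat.le_induction with
  | base => simp [totalVar]
  | succ e hse ih =>
    rw [totalVar, Finset.sum_Ico_succ_top hse]
    have := abs_sub_le_supVar r e a
    have h2 := abs_sub_le (r s a) (r e a) (r (e + 1) a)
    rw [totalVar] at ih
    linarith

theorem abs_sub_le_totalVar (r : ℕ → Fin A → ℝ) (a : Fin A) {s e q q' : ℕ}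
    (hq : q ∈ Finset.Icc s e) (hq' : q' ∈ Finset.Icc s e) :
    |r q a - r q' a| ≤ totalVar (supVar r) s e := by
  rw [Finset.mem_Icc] at hq hq'
  rcases le_total q q' with h | h
  · exact (abs_sub_le_totalVar_of_le r a h).trans (totalVar_mono (supVar_nonneg r) hq.1 hq'.2)
  · rw [abs_sub_comm]
    exact (abs_sub_le_totalVar_of_le r a h).trans (totalVar_mono (supVar_nonneg r) hq'.1 hq.2)

theorem exists_eq_optValue (hA : 1 ≤ A) (r : ℕ → Fin A → ℝ) (t : ℕ) :
    ∃ a, r t a = optValue r t := by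
  have : Nonempty (Fin A) := ⟨⟨0, hA⟩⟩
  exact exists_eq_ciSup_of_finite

theorem le_optValue (r : ℕ → Fin A → ℝ) (t : ℕ) (a : Fin A) : r t a ≤ optValue r t :=
  le_ciSup (Set.finite_range (r t)).bddAbove a

theorem optValue_sub_le_totalVar (hA : 1 ≤ A) (r : ℕ → Fin A → ℝ) {s e q q' : ℕ}
    (hq : q ∈ Finset.Icc s e) (hq' : q' ∈ Finset.Icc s e) :
    optValue r q - optValue r q' ≤ totalVar (supVar r) s e := by
  obtain ⟨a, ha⟩ := exists_eq_optValue hA r q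
  have h1 := (abs_le.1 (abs_sub_le_totalVar r a hq hq')).2
  have h2 := le_optValue r q' a
  linarith

end Variation

/-! ## Concentration along the pulls of an arm -/

section Conversion

theorem abs_sum_filter_lt_le {T : ℕ} {D : ℕ → Prop} [DecidablePred D] {Y : ℕ → ℝ} {C ι : ℝ}
    (H : ∀ t ≤ T, |∑ q ∈ Finset.Icc 1 t, (if D q then 1 else 0) * Y q|
      ≤ C * √(ι * ∑ q ∈ Finset.Icc 1 t, (if D q then 1 else 0))) {t : ℕ} (ht : t ≤ T) (r : ℕ) :
    |∑ q ∈ (Finset.Icc 1 t).filter (fun q => q < r ∧ D q), Y q|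
      ≤ C * √(ι * ((Finset.Icc 1 t).filter fun q => q < r ∧ D q).card) := by
  have h := H (min t (r - 1)) ((min_le_left _ _).trans ht)
  have hs : (Finset.Icc 1 t).filter (fun q => q < r ∧ D q)
      = (Finset.Icc 1 (min t (r - 1))).filter D := by
    ext q
    simp only [Finset.mem_filter, Finset.mem_Icc, le_min_iff]
    constructor
    · rintro ⟨⟨h1, h2⟩, h3, h4⟩
      exact ⟨⟨h1, h2, by omega⟩, h4⟩
    · rintro ⟨⟨h1, h2, h3⟩, h4⟩
      exact ⟨⟨h1, h2⟩, by omega, h4⟩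
  rw [hs, Finset.sum_filter]
  simpa [Finset.sum_boole] using h

/-- For x ≥ 2 and T ≤ x one has T + 1 ≤ x². Each factor T + 1 of a union bound thus costs two of the
sixteen powers of x = T/δ that the tail provides. -/
theorem pow_mul_exp_le {T : ℕ} {x : ℝ} (hT : 1 ≤ T) (hx : 2 ≤ x) (hTx : (T : ℝ) ≤ x) (k : ℕ) :
    ((T : ℝ) + 1) ^ k * Real.exp (-(16 * Real.log x)) ≤ x ^ (2 * k) / x ^ 16 := by
  have hT' : (1 : ℝ) ≤ T := by exact_mod_cast hT
  have h1 : Real.exp (-(16 * Real.log x)) = 1 / x ^ 16 := by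
    rw [Real.exp_neg, show (16 : ℝ) * Real.log x = Real.log (x ^ 16) by
      rw [Real.log_pow]; norm_num, Real.exp_log (by positivity), one_div]
  rw [h1, mul_one_div, pow_mul]
  gcongr
  nlinarith

/-- Subadditivity and monotonicity suffice, so neither event has to be measurable. -/
theorem one_sub_le_measureReal {Ω : Type*} {m0 : MeasurableSpace Ω} {P : Measure Ω}
    [IsProbabilityMeasure P] {E G : Set Ω} {b : ℝ} (hE : P.real E ≤ b) (h : Eᶜ ⊆ G) :
    1 - b ≤ P.real G := by
  have h1 : P.real (Set.univ : Set Ω) ≤ P.real (E ∪ G) :=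
    measureReal_mono (fun ω _ => by
      by_cases hω : ω ∈ E
      · exact Or.inl hω
      · exact Or.inr (h hω)) (measure_ne_top _ _)
  have h2 := measureReal_union_le (μ := P) E G
  rw [probReal_univ] at h1
  linarith

end Conversion

/-! ## Measurability of the decisions of UCB1 -/

section UCBMeasurable

variable {A : ℕ} {c δ : ℝ} {T : ℕ} {tie : Finset (Fin A) → Fin A} {Ω : Type*}

theorem measurable_indexOf {m : MeasurableSpace Ω} {c ι : ℝ} {N : Ω → ℕ} {S : Ω → ℝ}
    (hN : Measurable N) (hS : Measurable S) : Measurable fun ω => indexOf c ι (N ω) (S ω) := by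
  have h1 : Measurable fun N : ℕ => ((max 1 N : ℕ) : ℝ) := Measurable.of_discrete
  have h2 := h1.comp hN
  exact (hS.div h2).add ((h2.const_div ι).sqrt.const_mul c)

theorem measurable_ucbIndex {m : MeasurableSpace Ω} {h : Ω → List (Fin A × ℝ)} {a : Fin A}
    (hN : Measurable fun ω => ((h ω).filter (fun x => x.1 = a)).length)
    (hS : Measurable fun ω => (((h ω).filter (fun x => x.1 = a)).map Prod.snd).sum) :
    Measurable fun ω => ucbIndex c T δ (h ω) a :=
  measurable_indexOf hN hS

/-- The played arm depends on the history only through the finite table of comparisons between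
indices. On a finite space of tables every tie-breaking rule is measurable. -/
theorem measurable_ucb1_act {m : MeasurableSpace Ω} {h : Ω → List (Fin A × ℝ)}
    (hidx : ∀ a, Measurable fun ω => ucbIndex c T δ (h ω) a) :
    Measurable fun ω => (ucb1 A c T δ tie).act (h ω) := by
  classical
  have h1 : Measurable fun (ω : Ω) (a b : Fin A) =>
      (ucbIndex c T δ (h ω) b ≤ ucbIndex c T δ (h ω) a : Prop) := by
    refine measurable_pi_lambda _ fun a => measurable_pi_lambda _ fun b => ?_
    exact measurableSet_setOfPred.1 (measurableSet_le (hidx b) (hidx a))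
  have h2 : Measurable fun rel : Fin A → Fin A → Prop =>
      tie (Finset.univ.filter fun a => ∀ b, rel a b) := measurable_of_finite _
  exact h2.comp h1

theorem measurable_ucb1_est {m : MeasurableSpace Ω} {h : Ω → List (Fin A × ℝ)}
    (hidx : ∀ a, Measurable fun ω => ucbIndex c T δ (h ω) a) :
    Measurable fun ω => (ucb1 A c T δ tie).est (h ω) :=
  (Measurable.iSup hidx).min measurable_const

end UCBMeasurable

/-! ## UCB1 run alone -/

section Alone

variable {A : ℕ}

theorem hist_count (alg : BaseAlg (Fin A)) (R : ℕ → ℝ) (a : Fin A) (n : ℕ) :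
    ((alg.hist R n).filter (fun x => x.1 = a)).length
      = ((Finset.Icc 1 n).filter fun q => alg.policy R q = a).card := by
  rw [Finset.card_filter]
  induction n with
  | zero => simp [BaseAlg.hist]
  | succ n ih =>
    rw [Finset.sum_Icc_succ_top (Nat.le_add_left 1 n), ← ih, BaseAlg.hist, List.filter_cons]
    have : alg.policy R (n + 1) = alg.act (alg.hist R n) := rfl
    rw [this]
    by_cases h : alg.act (alg.hist R n) = a <;> simp [h]

theorem hist_sum (alg : BaseAlg (Fin A)) (R : ℕ → ℝ) (a : Fin A) (n : ℕ) :
    (((alg.hist R n).filter (fun x => x.1 = a)).map Prod.snd).sum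
      = ∑ q ∈ (Finset.Icc 1 n).filter (fun q => alg.policy R q = a), R q := by
  rw [Finset.sum_filter]
  induction n with
  | zero => simp [BaseAlg.hist]
  | succ n ih =>
    rw [Finset.sum_Icc_succ_top (Nat.le_add_left 1 n), ← ih, BaseAlg.hist, List.filter_cons]
    have : alg.policy R (n + 1) = alg.act (alg.hist R n) := rfl
    rw [this]
    by_cases h : alg.act (alg.hist R n) = a <;> simp [h, add_comm]

theorem ucbIndex_hist (c : ℝ) (T : ℕ) (δ : ℝ) (alg : BaseAlg (Fin A)) (R : ℕ → ℝ) (a : Fin A)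
    {r t : ℕ} (hr : 1 ≤ r) (hrt : r ≤ t) :
    ucbIndex c T δ (alg.hist R (r - 1)) a = indexOf c (Real.log (T / δ))
      ((Finset.Icc 1 t).filter fun q => q < r ∧ alg.policy R q = a).card
      (∑ q ∈ (Finset.Icc 1 t).filter (fun q => q < r ∧ alg.policy R q = a), R q) := by
  have : (Finset.Icc 1 (r - 1)).filter (fun q => alg.policy R q = a)
      = (Finset.Icc 1 t).filter (fun q => q < r ∧ alg.policy R q = a) := by
    ext q
    simp only [Finset.mem_filter, Finset.mem_Icc]
    constructor
    · rintro ⟨⟨h1, h2⟩, h3⟩; exact ⟨⟨h1, by omega⟩, by omega, h3⟩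
    · rintro ⟨⟨h1, h2⟩, h3, h4⟩; exact ⟨⟨h1, by omega⟩, h4⟩
  rw [ucbIndex_eq, hist_count, hist_sum, this]

theorem pastRewards_mono {Ω : Type*} (R : ℕ → Ω → ℝ) :
    Monotone (pastRewards R) := fun _ _ h =>
  biSup_mono fun _ hs => Finset.Ico_subset_Ico_right h hs

theorem measurable_pastRewards {Ω : Type*} (R : ℕ → Ω → ℝ) {q t : ℕ}
    (h1 : 1 ≤ q) (h2 : q < t) : Measurable[pastRewards R t] (R q) :=
  (comap_measurable (R q)).mono
    (le_iSup₂ (f := fun s _ => MeasurableSpace.comap (R s) inferInstance) q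
      (Finset.mem_Ico.2 ⟨h1, h2⟩)) le_rfl

theorem measurable_alone_policy {c δ : ℝ} {T : ℕ} {tie : Finset (Fin A) → Fin A} {Ω : Type*}
    (R : ℕ → Ω → ℝ) (t : ℕ) :
    Measurable[pastRewards R t] fun ω => (ucb1 A c T δ tie).policy (fun s => R s ω) t := by
  induction t using Nat.strong_induction_on with
  | _ t ih =>
    have hpol : ∀ q ∈ Finset.Icc 1 (t - 1), ∀ a, MeasurableSet[pastRewards R t]
        {ω | (ucb1 A c T δ tie).policy (fun s => R s ω) q = a} := fun q hq a => by
      rw [Finset.mem_Icc] at hq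
      exact ((ih q (by omega)).mono (pastRewards_mono R (by omega)) le_rfl)
        (measurableSet_singleton a)
    refine @measurable_ucb1_act A c δ T tie Ω (pastRewards R t) _ fun a =>
      @measurable_ucbIndex A c δ T Ω (pastRewards R t) _ a ?_ ?_
    · simp_rw [hist_count, Finset.card_filter]
      refine Finset.measurable_sum _ fun q hq => ?_
      exact Measurable.ite (hpol q hq a) measurable_const measurable_const
    · simp_rw [hist_sum, Finset.sum_filter]
      refine Finset.measurable_sum _ fun q hq => ?_
      refine Measurable.ite (hpol q hq a) ?_ measurable_const
      rw [Finset.mem_Icc] at hq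
      exact measurable_pastRewards R hq.1 (by omega)

theorem alone_arm_concentration {δ c : ℝ} {T : ℕ} {tie : Finset (Fin A) → Fin A}
    (hι : 0 < Real.log (T / δ)) {f : ℕ → Fin A → ℝ} (hf : IsEnvironment T f)
    {Ω : Type*} [MeasurableSpace Ω] (P : Measure Ω) [IsProbabilityMeasure P] {R : ℕ → Ω → ℝ}
    (hR : IsRewardProcess P T f (pastRewards R)
      (fun t ω => (ucb1 A c T δ tie).policy (fun s => R s ω) t) R) (a : Fin A) :
    P.real {ω | ¬ ∀ t ≤ T, Concentrated 17 (Real.log (T / δ)) (Finset.Icc 1 t)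
        (fun q => (ucb1 A c T δ tie).policy (fun s => R s ω) q) (fun s => R s ω) f a}
      ≤ 2 * (T + 1) ^ 2 * Real.exp (-(16 * Real.log (T / δ))) := by
  set pol : ℕ → Ω → Fin A := fun t ω => (ucb1 A c T δ tie).policy (fun s => R s ω) t with hpol
  have hpolm : ∀ t, Measurable[pastRewards R t] (pol t) := measurable_alone_policy R
  -- `pastRewards R t` stops before round t, so the information after round t is `pastRewards R (t +
  -- 1)`, and the policy of round t is known already under `pastRewards R t`.
  have h := reward_concentration (P := P) (T := T) (F := fun t => pastRewards R (t + 1))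
    (info := pastRewards R) (X := R) (μ := fun t ω => f t (pol t ω))
    (Z := fun t ω => if pol t ω = a then 1 else 0) (ι := Real.log (T / δ)) (p := 16)
    (fun s t hst => pastRewards_mono R (by omega))
    (fun t ht => iSup₂_le fun s hs => (hR.measurable s (by
      rw [Finset.mem_Ico] at hs; rw [Finset.mem_Icc]; omega)).comap_le)
    (fun t ht => by
      rw [Finset.mem_Icc] at ht
      exact ⟨pastRewards_mono R (by omega), pastRewards_mono R (by omega)⟩)
    (fun t ht => measurable_pastRewards R (Finset.mem_Icc.1 ht).1 (Nat.lt_succ_self t))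
    hR.mem_Icc
    (fun t ht => (measurable_of_finite (f t)).comp (hpolm t))
    (fun t ht ω => hf t ht _)
    (fun t ht => Measurable.ite ((hpolm t) (measurableSet_singleton a)) measurable_const
      measurable_const)
    (fun t ω => by by_cases h : pol t ω = a <;> simp [h])
    hR.mean hι (by norm_num)
  refine (measureReal_mono ?_ (measure_ne_top _ _)).trans h
  intro ω hω hcon
  refine hω fun t ht r => ?_
  have h2 := abs_sum_filter_lt_le (D := fun q => pol q ω = a)
    (Y := fun q => R q ω - f q (pol q ω)) hcon ht r
  rw [Finset.sum_congr rfl fun q hq => by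
    rw [show pol q ω = a from (Finset.mem_filter.1 hq).2.2]] at h2
  rw [show (1 + 16 : ℝ) = 17 by norm_num] at h2
  exact h2

end Alone

/-! ## The guarantee of UCB1 -/

section Guarantee

variable {A T : ℕ} {K δ : ℝ}

theorem log_two_le_log (hδ : 0 < δ) (h2 : 2 * δ ≤ T) :
    Real.log 2 ≤ Real.log (T / δ) :=
  Real.log_le_log (by norm_num) (by rwa [le_div_iff₀ hδ])

theorem half_lt_log_two : (1 : ℝ) / 2 < Real.log 2 := by
  have := Real.log_two_gt_d9; linarith

theorem mul_ucbRho (hι : 0 ≤ Real.log (T / δ)) {t : ℕ} (ht : 1 ≤ t) :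
    t * ucbRho K A T δ t = K * (√(A * Real.log (T / δ) * t) + A * Real.log (T / δ)) := by
  have ht' : (0 : ℝ) < t := by exact_mod_cast ht
  have h := sqrt_mul_div_self (ι := A * Real.log (T / δ)) (by positivity) ht'
  rw [ucbRho, ← h]
  field_simp

theorem one_le_seventeen_mul_sqrt {ι : ℝ} (h : Real.log 2 ≤ ι) : 1 ≤ 17 * √ι := by
  have h1 : (1 / 2 : ℝ) ≤ √ι := by
    refine Real.le_sqrt_of_sq_le ?_
    have := half_lt_log_two
    linarith
  linarith

/-- For t ≤ A the term K A ι / t alone is at least 1, since K ≥ 2 and ι > 1/2. An uncapped rate thus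
leaves fewer than T arms for a union bound. -/
theorem lt_of_ucbRho_lt_one (hA : 1 ≤ A) (hK : 2 ≤ K) (hι : Real.log 2 ≤ Real.log (T / δ)) {t : ℕ}
    (ht : 1 ≤ t) (h : ucbRho K A T δ t < 1) : A < t := by
  by_contra! hcon
  have ht' : (0 : ℝ) < t := by exact_mod_cast ht
  have h0 := half_lt_log_two
  have h1 : (t : ℝ) ≤ A := by exact_mod_cast hcon
  have h2 := mul_ucbRho (K := K) (A := A) (by linarith : 0 ≤ Real.log (T / δ)) ht
  have h3 : t * ucbRho K A T δ t < t := by nlinarith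
  have h4 := Real.sqrt_nonneg (A * Real.log (T / δ) * t)
  have h5 : (A : ℝ) * (1 / 2) ≤ A * Real.log (T / δ) := by gcongr; linarith
  have h6 : 2 * (√(A * Real.log (T / δ) * t) + A * Real.log (T / δ))
      ≤ K * (√(A * Real.log (T / δ) * t) + A * Real.log (T / δ)) := by
    gcongr
    nlinarith [(Nat.cast_nonneg A : (0 : ℝ) ≤ A)]
  linarith

theorem ucb1_guarantee {tie : Finset (Fin A) → Fin A} (hA : 1 ≤ A) (hT : 1 ≤ T) (hδ : 0 < δ)
    (hδ1 : δ < 1) (h2 : 2 * δ ≤ T) (htie : ∀ s : Finset (Fin A), s.Nonempty → tie s ∈ s)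
    (hK : 119 ≤ K) {f : ℕ → Fin A → ℝ} (hf : IsEnvironment T f)
    {Ω : Type*} [MeasurableSpace Ω] (P : Measure Ω) [IsProbabilityMeasure P] {R : ℕ → Ω → ℝ}
    (hR : IsRewardProcess P T f (pastRewards R)
      (fun t ω => (ucb1 A 17 T δ tie).policy (fun s => R s ω) t) R) {t : ℕ}
    (ht : t ∈ Finset.Icc 1 T) :
    1 - δ / T ≤ P.real {ω |
      (⨅ τ : Set.Icc 1 t, optValue f τ) - totalVar (supVar f) 1 t
          ≤ (ucb1 A 17 T δ tie).estimate (fun s => R s ω) t ∧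
      (1 / (t : ℝ)) * ∑ τ ∈ Finset.Icc 1 t,
          ((ucb1 A 17 T δ tie).estimate (fun s => R s ω) τ - R τ ω)
        ≤ min (ucbRho K A T δ t) 1 + totalVar (supVar f) 1 t} := by
  classical
  set alg := ucb1 A 17 T δ tie with halg
  set ι := Real.log (T / δ) with hι
  have hι2 : Real.log 2 ≤ ι := log_two_le_log hδ h2
  have hι0 : 0 < ι := by linarith [half_lt_log_two]
  have hx : (2 : ℝ) ≤ T / δ := by rwa [le_div_iff₀ hδ]
  have hTx : (T : ℝ) ≤ T / δ := by
    rw [le_div_iff₀ hδ]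
    exact mul_le_of_le_one_right (Nat.cast_nonneg T) hδ1.le
  have htT := (Finset.mem_Icc.1 ht).2
  have ht1 := (Finset.mem_Icc.1 ht).1
  have ht0 : (0 : ℝ) < t := by exact_mod_cast ht1
  obtain ⟨a₀, ha₀⟩ := exists_eq_optValue hA f t
  -- A union bound over all arms is affordable only if A ≤ T. Otherwise the rate is capped at 1, the
  -- regret claim is trivial, and optimism needs nothing but the best arm `a₀` of round t.
  set arms : Finset (Fin A) := if A ≤ T then Finset.univ else {a₀} with harms
  have hcard : arms.card ≤ T := by
    by_cases h : A ≤ T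
    · simp [harms, h]
    · simp [harms, h]; exact hT
  have hmem : a₀ ∈ arms := by
    by_cases h : A ≤ T <;> simp [harms, h]
  set E : Set Ω := ⋃ a ∈ arms, {ω | ¬ ∀ t ≤ T, Concentrated 17 ι (Finset.Icc 1 t)
        (fun q => alg.policy (fun s => R s ω) q) (fun s => R s ω) f a} with hE
  have hEb : P.real E ≤ δ / T := by
    refine (measureReal_biUnion_le_mul arms fun a _ =>
      alone_arm_concentration hι0 hf P hR a).trans ?_
    have h3 := pow_mul_exp_le hT hx hTx 3
    have h4 : (arms.card : ℝ) ≤ T := by exact_mod_cast hcard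
    calc _ ≤ ((T : ℝ) + 1) * (2 * (T + 1) ^ 2 * Real.exp (-(16 * ι))) := by
          gcongr; linarith
      _ = 2 * (((T : ℝ) + 1) ^ 3 * Real.exp (-(16 * ι))) := by ring
      -- The factor 2 is absorbed into T/δ ≥ 2.
      _ ≤ (T / δ) * ((T / δ) ^ (2 * 3) / (T / δ) ^ 16) := by gcongr
      _ = 1 / (T / δ) ^ 9 := by
          generalize (T / δ : ℝ) = x at hx ⊢
          have : x ≠ 0 := by linarith
          field_simp
      _ ≤ 1 / (T / δ) ^ 1 := by
          refine one_div_le_one_div_of_le (by positivity) ?_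
          exact pow_le_pow_right₀ (by linarith) (by norm_num)
      _ = _ := by field_simp
  refine one_sub_le_measureReal hEb ?_
  intro ω hω
  simp only [hE, Set.mem_compl_iff, Set.mem_iUnion, Set.mem_ofPred_eq, not_exists, not_not] at hω
  set V := totalVar (supVar f) 1 t with hV
  have hV0 : 0 ≤ V := totalVar_nonneg (supVar_nonneg f) _ _
  have hc17 := one_le_seventeen_mul_sqrt hι2
  refine ⟨?_, ?_⟩
  · have h3 : (⨅ τ : Set.Icc 1 t, optValue f τ) ≤ optValue f t :=
      ciInf_le (Set.finite_range _).bddBelow (⟨t, ht1, le_rfl⟩ : Set.Icc 1 t)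
    have hle := (hf t ht a₀).2
    refine le_trans (sub_le_sub_right h3 V) (le_ucb1_est _ (a := a₀) (by linarith) ?_)
    rw [ucbIndex_hist _ _ _ _ _ _ ht1 le_rfl, ← ha₀]
    exact le_indexOf hι0.le hc17 hle hV0 (hω a₀ hmem t htT t) fun q hq =>
      abs_sub_le_totalVar f a₀ (Finset.mem_filter.1 hq).1 (Finset.mem_Icc.2 ⟨ht1, le_rfl⟩)
  · rw [one_div, inv_mul_le_iff₀ ht0]
    by_cases hρ : 1 ≤ ucbRho K A T δ t
    · rw [min_eq_right hρ]
      calc _ ≤ ∑ τ ∈ Finset.Icc 1 t, (1 : ℝ) := by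
            refine Finset.sum_le_sum fun τ hτ => ?_
            have h3 := ucb1_est_le_one (c := 17) (T := T) (δ := δ) (tie := tie)
              (alg.hist (fun s => R s ω) (τ - 1))
            have h4 := (hR.mem_Icc τ (by rw [Finset.mem_Icc] at hτ ⊢; omega) ω).1
            change alg.est _ - _ ≤ _
            linarith
        _ = t := by simp
        _ ≤ _ := by nlinarith
    · push Not at hρ
      rw [min_eq_left hρ.le]
      have hAt := lt_of_ucbRho_lt_one hA (by linarith) hι2 ht1 hρ
      have harms' : arms = Finset.univ := by rw [harms, if_pos (by omega)]
      have hsub : ∀ q ∈ Finset.Icc 1 t, q ∈ Finset.Icc 1 T := fun q hq => by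
        rw [Finset.mem_Icc] at hq ⊢; omega
      have h3 := sum_ucb_est_sub_le (c := 17) (ι := ι) (V := V) (S := Finset.Icc 1 t)
        (pol := fun q => alg.policy (fun s => R s ω) q) (R := fun s => R s ω)
        (est := fun q => alg.estimate (fun s => R s ω) q) (f := f) hι0.le (by norm_num) hV0
        (fun q hq a => (hf q (hsub q hq) a).1)
        (fun q hq r hr a => abs_sub_le_totalVar f a hq hr)
        (fun a => hω a (by rw [harms']; exact Finset.mem_univ a) t htT)
        (fun r hr => by
          rw [Finset.mem_Icc] at hr
          rw [← ucbIndex_hist _ _ _ _ _ _ hr.1 hr.2]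
          exact (ucb1_est_eq hA htie _).trans_le (min_le_left _ _))
      refine h3.trans ?_
      rw [mul_add, mul_ucbRho hι0.le ht1, Nat.card_Icc, Nat.add_sub_cancel]
      have h5 : 0 ≤ A * ι := by positivity
      have h6 := Real.sqrt_nonneg (A * ι * t)
      nlinarith

theorem ucbRho_antitoneOn (hK : 0 ≤ K) (hι : 0 ≤ Real.log (T / δ)) :
    AntitoneOn (ucbRho K A T δ) (Set.Ici 1) := by
  intro s hs t _ hst
  have hs' : (0 : ℝ) < s := by exact_mod_cast hs
  have hst' : (s : ℝ) ≤ t := by exact_mod_cast hst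
  have h : A * Real.log (T / δ) / t ≤ A * Real.log (T / δ) / s := by gcongr
  rw [ucbRho, ucbRho]
  gcongr

theorem mul_ucbRho_monotoneOn (hK : 0 ≤ K) (hι : 0 ≤ Real.log (T / δ)) :
    MonotoneOn (fun t : ℕ => (t : ℝ) * ucbRho K A T δ t) (Set.Ici 1) := by
  intro s hs t ht hst
  have hst' : (s : ℝ) ≤ t := by exact_mod_cast hst
  simp only
  rw [mul_ucbRho hι hs, mul_ucbRho hι ht]
  gcongr

theorem one_div_sqrt_le_ucbRho (hA : 1 ≤ A) (hK : 2 ≤ K) (hι : Real.log 2 ≤ Real.log (T / δ))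
    (t : ℕ) : 1 / √(t : ℝ) ≤ ucbRho K A T δ t := by
  have h0 := half_lt_log_two
  have hA' : (1 : ℝ) ≤ A := by exact_mod_cast hA
  have h1 : (1 / 2 : ℝ) ≤ √(A * Real.log (T / δ)) := by
    refine Real.le_sqrt_of_sq_le ?_
    nlinarith
  have h2 : (0 : ℝ) ≤ A * Real.log (T / δ) / t := by
    have : 0 ≤ Real.log (T / δ) := by linarith
    positivity
  rw [ucbRho, Real.sqrt_div (by nlinarith), mul_add]
  have h3 : 1 / √(t : ℝ) ≤ K * (√(A * Real.log (T / δ)) / √(t : ℝ)) := by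
    rw [← mul_div_assoc]
    gcongr
    nlinarith
  have : 0 ≤ K * (A * Real.log (T / δ) / t) := mul_nonneg (by linarith) h2
  linarith

theorem ucb1_nearStationaryGuarantee {tie : Finset (Fin A) → Fin A} (hA : 1 ≤ A) (hT : 1 ≤ T)
    (hδ : 0 < δ) (hδ1 : δ < 1) (h2 : 2 * δ ≤ T)
    (htie : ∀ s : Finset (Fin A), s.Nonempty → tie s ∈ s) (hK : 119 ≤ K) :
    BaseAlg.NearStationaryGuarantee.{u, 0} (ucb1 A 17 T δ tie) T δ (ucbRho K A T δ) supVar where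
  est_mem h hh := ucb1_est_mem (by norm_num) hh
  nonstat f _ t _ a := abs_sub_le_supVar f t a
  antitone := (ucbRho_antitoneOn (by linarith) (by
    linarith [log_two_le_log hδ h2, half_lt_log_two])).mono fun t ht => ht.1
  monotone := (mul_ucbRho_monotoneOn (by linarith) (by
    linarith [log_two_le_log hδ h2, half_lt_log_two])).mono fun t ht => ht.1
  lower t _ := one_div_sqrt_le_ucbRho hA (by linarith) (log_two_le_log hδ h2) t
  guarantee f hf {Ω} _ P _ R hR t ht _ := by
    refine (ucb1_guarantee hA hT hδ hδ1 h2 htie hK hf P hR ht).trans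
      (measureReal_mono ?_ (measure_ne_top _ _))
    rintro ω ⟨h1, h2⟩
    exact ⟨h1, h2.trans (by gcongr; exact min_le_left _ _)⟩

theorem ucb1_nearStationaryGuarantee_min {tie : Finset (Fin A) → Fin A} (hA : 1 ≤ A) (hT : 1 ≤ T)
    (hδ : 0 < δ) (hδ1 : δ < 1) (h2 : 2 * δ ≤ T)
    (htie : ∀ s : Finset (Fin A), s.Nonempty → tie s ∈ s) (hK : 119 ≤ K) :
    BaseAlg.NearStationaryGuarantee.{u, 0} (ucb1 A 17 T δ tie) T δ
      (fun t => min (ucbRho K A T δ t) 1) supVar where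
  est_mem h hh := ucb1_est_mem (by norm_num) hh
  nonstat f _ t _ a := abs_sub_le_supVar f t a
  antitone s hs t ht hst := min_le_min_right 1 (ucbRho_antitoneOn (by linarith) (by
    linarith [log_two_le_log hδ h2, half_lt_log_two]) hs.1 ht.1 hst)
  monotone s hs t ht hst := by
    have h := mul_ucbRho_monotoneOn (K := K) (A := A) (by linarith) (by
      linarith [log_two_le_log hδ h2, half_lt_log_two]) hs.1 ht.1 hst
    simp only [mul_min_of_nonneg _ _ (Nat.cast_nonneg (α := ℝ) _)]
    exact min_le_min h (by simpa using hst)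
  lower t ht := le_min (one_div_sqrt_le_ucbRho hA (by linarith) (log_two_le_log hδ h2) t) (by
    have : (1 : ℝ) ≤ √t := Real.one_le_sqrt.2 (by exact_mod_cast (Finset.mem_Icc.1 ht).1)
    exact div_le_one_of_le₀ this (Real.sqrt_nonneg _))
  guarantee f hf {Ω} _ P _ R hR t ht _ := ucb1_guarantee hA hT hδ hδ1 h2 htie hK hf P hR ht

end Guarantee

end Bandit

namespace Bandit

/-! ## The structure of a run of MASTER -/

section Cells

theorem le_cellStart (tn m t : ℕ) : tn ≤ cellStart tn m t := Nat.le_add_right _ _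

theorem cellStart_le {tn t : ℕ} (m : ℕ) (h : tn ≤ t) : cellStart tn m t ≤ t := by
  have := Nat.mul_div_le (t - tn) (2 ^ m)
  rw [cellStart]
  omega

theorem lt_cellStart_add {tn t : ℕ} (m : ℕ) (h : tn ≤ t) : t < cellStart tn m t + 2 ^ m := by
  have := Nat.lt_mul_div_succ (t - tn) (Nat.pos_of_ne_zero (NeZero.ne (2 ^ m)))
  rw [mul_add, mul_one] at this
  rw [cellStart]
  omega

theorem cellStart_eq_of_mem {tn m t q : ℕ} (h1 : cellStart tn m t ≤ q)
    (h2 : q < cellStart tn m t + 2 ^ m) : cellStart tn m q = cellStart tn m t := by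
  rw [cellStart] at h1 h2
  rw [cellStart, cellStart]
  congr 2
  refine Nat.div_eq_of_lt_le ?_ ?_
  · rw [mul_comm]; omega
  · rw [Nat.succ_mul, mul_comm]; omega

/-- Dyadic cells are nested. -/
theorem cellStart_le_cellStart (tn : ℕ) {m m' : ℕ} (h : m' ≤ m) (t : ℕ) :
    cellStart tn m t ≤ cellStart tn m' t := by
  obtain ⟨d, rfl⟩ := Nat.exists_eq_add_of_le h
  rw [cellStart, cellStart, pow_add, ← Nat.div_div_eq_div_mul, mul_assoc]
  gcongr
  exact Nat.mul_div_le _ _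

theorem dvd_cellStart_sub (tn m t : ℕ) : 2 ^ m ∣ cellStart tn m t - tn := by
  rw [cellStart, Nat.add_sub_cancel_left]
  exact Nat.dvd_mul_right _ _

theorem cellStart_eq_self {tn m s : ℕ} (h : tn ≤ s) (hd : 2 ^ m ∣ s - tn) :
    cellStart tn m s = s := by
  rw [cellStart, Nat.mul_div_cancel' hd]
  omega

end Cells

section Run

variable {Pol : Type*} (alg : BaseAlg Pol) (ρ ρhat : ℕ → ℝ) (ξ : ℕ → ℕ → unitInterval) (R : ℕ → ℝ)

/-- The record of round `t ≥ 1`. -/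
noncomputable def masterRound (t : ℕ) : Round Pol :=
  playRound alg ρ ξ (masterState alg ρ ρhat ξ R (t - 1)) t (R t)

/-- A test fails at the end of round `t ≥ 1`. -/
def MasterRestarts (t : ℕ) : Prop :=
  Test1Fails ρ ρhat ξ (masterState alg ρ ρhat ξ R (t - 1)).start
      (masterState alg ρ ρhat ξ R (t - 1)).order t R
      (minEst (masterRound alg ρ ρhat ξ R t).est (masterState alg ρ ρhat ξ R (t - 1)).log) ∨
    Test2Fails ρhat (masterState alg ρ ρhat ξ R (t - 1)).start t
      (masterRound alg ρ ρhat ξ R t :: (masterState alg ρ ρhat ξ R (t - 1)).log)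

local notation "𝒮" => masterState alg ρ ρhat ξ R
local notation "𝓇" => masterRound alg ρ ρhat ξ R
local notation "𝒳" => MasterRestarts alg ρ ρhat ξ R

/-- The three ways in which the state of MASTER evolves. -/
theorem masterState_cases (t : ℕ) :
    (𝒳 (t + 1) ∧ 𝒮 (t + 1) = ⟨t + 2, 0, []⟩) ∨
    (¬ 𝒳 (t + 1) ∧ t + 2 = (𝒮 t).start + 2 ^ (𝒮 t).order ∧
      𝒮 (t + 1) = ⟨t + 2, (𝒮 t).order + 1, []⟩) ∨
    (¬ 𝒳 (t + 1) ∧ t + 2 ≠ (𝒮 t).start + 2 ^ (𝒮 t).order ∧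
      𝒮 (t + 1) = ⟨(𝒮 t).start, (𝒮 t).order, 𝓇 (t + 1) :: (𝒮 t).log⟩) := by
  rw [masterState]
  by_cases h1 : 𝒳 (t + 1)
  · exact Or.inl ⟨h1, if_pos h1⟩
  · by_cases h2 : t + 2 = (𝒮 t).start + 2 ^ (𝒮 t).order
    · exact Or.inr (Or.inl ⟨h1, h2, (if_neg h1).trans (if_pos h2)⟩)
    · exact Or.inr (Or.inr ⟨h1, h2, (if_neg h1).trans (if_neg h2)⟩)

/-- The last inequality holds since completing a block advances the start by the old length and
doubles the length. It keeps the order of every block played up to round T below log₂ T. -/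
theorem masterState_bounds (t : ℕ) : (𝒮 t).start ≤ t + 1 ∧ t + 1 < (𝒮 t).start + 2 ^ (𝒮 t).order ∧
    2 ^ (𝒮 t).order ≤ (𝒮 t).start := by
  induction t with
  | zero => simp [masterState]
  | succ t ih =>
    obtain ⟨h1, h2, h3⟩ := ih
    rcases masterState_cases alg ρ ρhat ξ R t with ⟨_, h⟩ | ⟨_, h4, h⟩ | ⟨_, h4, h⟩ <;> rw [h]
    · simp
    · simp only [pow_succ]; omega
    · simp only; omega

theorem one_le_start (t : ℕ) : 1 ≤ (𝒮 t).start :=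
  Nat.one_le_two_pow.trans (masterState_bounds alg ρ ρhat ξ R t).2.2

theorem start_le {t : ℕ} (ht : 1 ≤ t) : (𝒮 (t - 1)).start ≤ t := by
  have := (masterState_bounds alg ρ ρhat ξ R (t - 1)).1
  omega

theorem sum_map_log {M : Type*} [AddCommMonoid M] (g : Round Pol → M) (t : ℕ) :
    ((𝒮 t).log.map g).sum = ∑ q ∈ Finset.Ico (𝒮 t).start (t + 1), g (𝓇 q) := by
  induction t with
  | zero => simp [masterState]
  | succ t ih =>
    rcases masterState_cases alg ρ ρhat ξ R t with ⟨_, h⟩ | ⟨_, h4, h⟩ | ⟨_, h4, h⟩ <;> rw [h]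
    · simp
    · simp
    · rw [Finset.sum_Ico_succ_top (masterState_bounds alg ρ ρhat ξ R t).1]
      simp [ih, add_comm]

theorem mem_log {x : Round Pol} {t : ℕ} :
    x ∈ (𝒮 t).log ↔ ∃ q ∈ Finset.Ico (𝒮 t).start (t + 1), 𝓇 q = x := by
  induction t with
  | zero => simp [masterState]
  | succ t ih =>
    rcases masterState_cases alg ρ ρhat ξ R t with ⟨_, h⟩ | ⟨_, h4, h⟩ | ⟨_, h4, h⟩ <;> rw [h]
    · simp
    · simp
    · rw [List.mem_cons, ih]
      dsimp only
      have h1 := (masterState_bounds alg ρ ρhat ξ R t).1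
      constructor
      · rintro (rfl | ⟨q, hq, rfl⟩)
        · exact ⟨t + 1, Finset.mem_Ico.2 ⟨h1, by omega⟩, rfl⟩
        · exact ⟨q, Finset.mem_Ico.2 (by rw [Finset.mem_Ico] at hq; omega), rfl⟩
      · rintro ⟨q, hq, rfl⟩
        rw [Finset.mem_Ico] at hq
        rcases Nat.lt_succ_iff_lt_or_eq.1 hq.2 with h' | rfl
        · exact Or.inr ⟨q, Finset.mem_Ico.2 ⟨hq.1, h'⟩, rfl⟩
        · exact Or.inl rfl

theorem masterState_eq_of_le {t q : ℕ} (h1 : (𝒮 t).start ≤ q + 1) (h2 : q ≤ t) :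
    (𝒮 q).start = (𝒮 t).start ∧ (𝒮 q).order = (𝒮 t).order := by
  induction t with
  | zero =>
    obtain rfl : q = 0 := by omega
    exact ⟨rfl, rfl⟩
  | succ t ih =>
    rcases Nat.le_succ_iff.1 h2 with h2' | rfl
    · rcases masterState_cases alg ρ ρhat ξ R t with ⟨_, h⟩ | ⟨_, h4, h⟩ | ⟨_, h4, h⟩ <;>
        rw [h] at h1 ⊢ <;> simp only at h1 ⊢
      · omega
      · omega
      · exact ih h1 h2'
    · exact ⟨rfl, rfl⟩

theorem start_eq_of_restarts {t : ℕ} (ht : 1 ≤ t) (h : 𝒳 t) :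
    (𝒮 t).start = t + 1 ∧ (𝒮 t).order = 0 := by
  obtain ⟨t, rfl⟩ := Nat.exists_eq_add_of_le' ht
  rcases masterState_cases alg ρ ρhat ξ R t with ⟨_, h'⟩ | ⟨h', _⟩ | ⟨h', _⟩
  · rw [h']; simp
  · exact absurd h h'
  · exact absurd h h'

/-- A restart in round q would move the start of the current block beyond q. -/
theorem not_restarts {t q : ℕ} (h1 : (𝒮 t).start ≤ q) (h2 : q ≤ t) : ¬ 𝒳 q := by
  intro h
  have h3 := one_le_start alg ρ ρhat ξ R t
  have h4 := (start_eq_of_restarts alg ρ ρhat ξ R (by omega) h).1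
  have h5 := (masterState_eq_of_le alg ρ ρhat ξ R (by omega : (𝒮 t).start ≤ q + 1) h2).1
  omega

theorem minEst_le_iff (g y : ℝ) (l : List (Round Pol)) :
    minEst g l ≤ y ↔ g ≤ y ∨ ∃ x ∈ l, x.est ≤ y := by
  induction l with
  | nil => simp [minEst]
  | cons x l ih =>
    have : minEst g (x :: l) = min x.est (minEst g l) := rfl
    rw [this, min_le_iff, ih]
    simp only [List.mem_cons, exists_eq_or_imp]
    tauto

theorem minEst_round_le_iff {t : ℕ} (ht : 1 ≤ t) (y : ℝ) :
    minEst (𝓇 t).est (𝒮 (t - 1)).log ≤ y ↔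
      ∃ q ∈ Finset.Icc (𝒮 (t - 1)).start t, (𝓇 q).est ≤ y := by
  rw [minEst_le_iff]
  have hs := start_le alg ρ ρhat ξ R ht
  simp only [mem_log, Nat.sub_add_cancel ht]
  constructor
  · rintro (h | ⟨x, ⟨q, hq, rfl⟩, h⟩)
    · exact ⟨t, Finset.mem_Icc.2 ⟨hs, le_rfl⟩, h⟩
    · exact ⟨q, Finset.mem_Icc.2 (by rw [Finset.mem_Ico] at hq; omega), h⟩
  · rintro ⟨q, hq, h⟩
    rw [Finset.mem_Icc] at hq
    rcases eq_or_lt_of_le hq.2 with rfl | h'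
    · exact Or.inl h
    · exact Or.inr ⟨_, ⟨q, Finset.mem_Ico.2 ⟨hq.1, h'⟩, rfl⟩, h⟩

theorem sum_round_cons {t : ℕ} (ht : 1 ≤ t) :
    ((𝓇 t :: (𝒮 (t - 1)).log).map fun x => x.est - x.rew).sum
      = ∑ q ∈ Finset.Icc (𝒮 (t - 1)).start t, ((𝓇 q).est - R q) := by
  rw [List.map_cons, List.sum_cons, sum_map_log, Nat.sub_add_cancel ht, add_comm,
    ← Finset.sum_Ico_succ_top (f := fun q => (𝓇 q).est - (𝓇 q).rew)
      (start_le alg ρ ρhat ξ R ht)]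
  rfl

/-- Both tests become inequalities between the records of individual rounds; the threshold with the
running minimum U turns into an existential over the rounds of the block. This form serves the
measurability proof as well as the regret analysis. -/
theorem masterRestarts_iff {t : ℕ} (ht : 1 ≤ t) :
    𝒳 t ↔ (∃ m ≤ (𝒮 (t - 1)).order, t = cellStart (𝒮 (t - 1)).start m t + 2 ^ m - 1 ∧
        Scheduled ρ ξ (𝒮 (t - 1)).order (cellStart (𝒮 (t - 1)).start m t) m ∧
        ∃ q ∈ Finset.Icc (𝒮 (t - 1)).start t, (𝓇 q).est + 9 * ρhat (2 ^ m) ≤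
          (1 / (2 : ℝ) ^ m) * ∑ τ ∈ Finset.Icc (cellStart (𝒮 (t - 1)).start m t) t, R τ) ∨
      3 * ρhat (t - (𝒮 (t - 1)).start + 1) ≤ (1 / ((t - (𝒮 (t - 1)).start + 1 : ℕ) : ℝ)) *
        ∑ q ∈ Finset.Icc (𝒮 (t - 1)).start t, ((𝓇 q).est - R q) := by
  rw [MasterRestarts, Test2Fails, sum_round_cons _ _ _ _ _ ht, Test1Fails]
  refine or_congr ?_ Iff.rfl
  have key : ∀ y z : ℝ, minEst (𝓇 t).est (𝒮 (t - 1)).log + y ≤ z ↔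
      ∃ q ∈ Finset.Icc (𝒮 (t - 1)).start t, (𝓇 q).est + y ≤ z := by
    intro y z
    simp only [← le_sub_iff_add_le]
    exact minEst_round_le_iff alg ρ ρhat ξ R ht _
  simp only [key]
  constructor
  · rintro ⟨m, s, h1, rfl, h3, h4, h5⟩
    exact ⟨m, h1, h3, h4, h5⟩
  · rintro ⟨m, h1, h3, h4, h5⟩
    exact ⟨m, _, h1, rfl, h3, h4, h5⟩

/-- The probability is 1 at the order of the block itself, so some instance always covers the
current round and `activeOrder` is never an infimum over the empty set. -/
theorem scheduled_self {n s : ℕ} (h : ρ (2 ^ n) ≠ 0) : Scheduled ρ ξ n s n := by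
  rw [Scheduled, div_self h]
  exact (ξ s n).2.2

theorem activeOrder_spec {tn n t : ℕ} (h : ρ (2 ^ n) ≠ 0) : activeOrder ρ ξ tn n t ≤ n ∧
    Scheduled ρ ξ n (cellStart tn (activeOrder ρ ξ tn n t) t) (activeOrder ρ ξ tn n t) :=
  Nat.sInf_mem (s := {m | m ≤ n ∧ Scheduled ρ ξ n (cellStart tn m t) m})
    ⟨n, le_rfl, scheduled_self ρ ξ h⟩

theorem activeOrder_le {tn n t m : ℕ} (hm : m ≤ n) (h : Scheduled ρ ξ n (cellStart tn m t) m) :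
    activeOrder ρ ξ tn n t ≤ m :=
  Nat.sInf_le (show m ∈ {m | m ≤ n ∧ Scheduled ρ ξ n (cellStart tn m t) m} from ⟨hm, h⟩)

theorem inst_le {t : ℕ} (ht : 1 ≤ t) : (𝒮 (t - 1)).start ≤ (𝓇 t).inst.1 ∧ (𝓇 t).inst.1 ≤ t :=
  ⟨le_cellStart _ _ _, cellStart_le _ (start_le alg ρ ρhat ξ R ht)⟩

end Run

/-! ### Indices of the instances as sums over rounds -/

section RunUCB

variable {A : ℕ} (alg : BaseAlg (Fin A)) (ρ ρhat : ℕ → ℝ) (ξ : ℕ → ℕ → unitInterval) (R : ℕ → ℝ)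

local notation "𝒮" => masterState alg ρ ρhat ξ R
local notation "𝓇" => masterRound alg ρ ρhat ξ R

theorem length_filter_eq_sum {α : Type*} (p : α → Prop) [DecidablePred p] (l : List α) :
    (l.filter p).length = (l.map fun x => if p x then 1 else 0).sum := by
  induction l with
  | nil => simp
  | cons x l ih => by_cases h : p x <;> simp [h, ih, add_comm]

theorem sum_map_filter_eq_sum {α : Type*} (p : α → Prop) [DecidablePred p] (g : α → ℝ)
    (l : List α) : ((l.filter p).map g).sum = (l.map fun x => if p x then g x else 0).sum := by
  induction l with
  | nil => simp
  | cons x l ih => by_cases h : p x <;> simp [h, ih]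

theorem instHist_count (log : List (Round (Fin A))) (i : ℕ × ℕ) (a : Fin A) :
    ((instHist log i).filter (fun x => x.1 = a)).length
      = (log.map fun x => if x.inst = i ∧ x.pol = a then 1 else 0).sum := by
  classical
  rw [← length_filter_eq_sum, instHist, List.filter_map, List.length_map, List.filter_filter]
  congr 2
  ext x
  simp [and_comm]

theorem instHist_sum (log : List (Round (Fin A))) (i : ℕ × ℕ) (a : Fin A) :
    (((instHist log i).filter (fun x => x.1 = a)).map Prod.snd).sum
      = (log.map fun x => if x.inst = i ∧ x.pol = a then x.rew else 0).sum := by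
  classical
  rw [← sum_map_filter_eq_sum, instHist, List.filter_map, List.map_map, List.filter_filter]
  congr 2
  congr 1
  ext x
  simp [and_comm]

/-- An instance cannot be active before its own start, which lies in the current block. So its
history may be read off from all rounds since round 1, without reference to the random start of the
block. -/
theorem filter_inst_eq {t u : ℕ} (htu : t ≤ u) (i : ℕ × ℕ)
    (hi : (𝒮 (t - 1)).start ≤ i.1) (a : Fin A) :
    (Finset.Ico (𝒮 (t - 1)).start t).filter (fun q => (𝓇 q).inst = i ∧ (𝓇 q).pol = a)
      = (Finset.Icc 1 u).filter (fun q => q < t ∧ ((𝓇 q).inst = i ∧ (𝓇 q).pol = a)) := by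
  ext q
  simp only [Finset.mem_filter, Finset.mem_Ico, Finset.mem_Icc]
  have h0 := one_le_start alg ρ ρhat ξ R (t - 1)
  constructor
  · rintro ⟨⟨h1, h2⟩, h3⟩
    exact ⟨by omega, h2, h3⟩
  · rintro ⟨⟨h1, h2⟩, h3, h4, h5⟩
    have := (inst_le alg ρ ρhat ξ R h1).2
    rw [h4] at this
    exact ⟨by omega, h4, h5⟩

theorem ucbIndex_instHist (c : ℝ) (T : ℕ) (δ : ℝ) {t u : ℕ} (ht : 1 ≤ t) (htu : t ≤ u)
    (i : ℕ × ℕ) (hi : (𝒮 (t - 1)).start ≤ i.1) (a : Fin A) :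
    ucbIndex c T δ (instHist (𝒮 (t - 1)).log i) a = indexOf c (Real.log (T / δ))
      ((Finset.Icc 1 u).filter fun q => q < t ∧ ((𝓇 q).inst = i ∧ (𝓇 q).pol = a)).card
      (∑ q ∈ (Finset.Icc 1 u).filter (fun q => q < t ∧ ((𝓇 q).inst = i ∧ (𝓇 q).pol = a)),
        R q) := by
  rw [ucbIndex_eq, instHist_count, instHist_sum, sum_map_log, sum_map_log, Nat.sub_add_cancel ht,
    ← filter_inst_eq alg ρ ρhat ξ R htu i hi a, Finset.card_filter, Finset.sum_filter]
  rfl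

end RunUCB

end Bandit

namespace Bandit

/-! ## Measurability of a run of MASTER with UCB1 -/

section MasterMeasurable

/-- Measurability of `g` is required only at attained values of the index. This allows a random
block start to be fixed while its bounds remain available. -/
theorem measurable_of_countable_cases {Ω β ι : Type*} {m : MeasurableSpace Ω} [MeasurableSpace β]
    [Countable ι] [MeasurableSpace ι] [MeasurableSingletonClass ι] {i : Ω → ι} (hi : Measurable i)
    {f : Ω → β} (g : ι → Ω → β) (hg : ∀ ω, Measurable (g (i ω))) (h : ∀ ω, f ω = g (i ω) ω) :
    Measurable f := by
  intro s hs
  have : f ⁻¹' s = ⋃ y ∈ Set.range i, i ⁻¹' {y} ∩ g y ⁻¹' s := by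
    ext ω
    simp only [Set.mem_preimage, h ω, Set.mem_iUnion, Set.mem_inter_iff, Set.mem_singleton_iff,
      exists_prop]
    exact ⟨fun hω => ⟨_, ⟨ω, rfl⟩, rfl, hω⟩, fun ⟨y, _, hy, hω⟩ => hy ▸ hω⟩
  rw [this]
  refine MeasurableSet.biUnion (Set.to_countable _) ?_
  rintro y ⟨ω, rfl⟩
  exact (hi (measurableSet_singleton _)).inter (hg ω hs)

theorem measurable_mem_and {Ω : Type*} {m : MeasurableSpace Ω} {p : Prop} {q : Ω → Prop}
    (h : p → Measurable q) : Measurable fun ω => p ∧ q ω := by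
  by_cases hp : p
  · simpa [hp] using h hp
  · simp [hp]

variable {A : ℕ} {c δ : ℝ} {T : ℕ} {tie : Finset (Fin A) → Fin A} {ρ ρhat : ℕ → ℝ}
  {Ω : Type*} {ξ : ℕ → Ω → ℕ → unitInterval} {R : ℕ → Ω → ℝ}

local notation "𝒮[" ω "]" =>
  masterState (ucb1 A c T δ tie) ρ ρhat (fun s m => ξ s ω m) (fun s => R s ω)
local notation "𝓇[" ω "]" =>
  masterRound (ucb1 A c T δ tie) ρ ρhat (fun s m => ξ s ω m) (fun s => R s ω)
local notation "𝒳[" ω "]" =>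
  MasterRestarts (ucb1 A c T δ tie) ρ ρhat (fun s m => ξ s ω m) (fun s => R s ω)

theorem coinInfo_mono (ξ : ℕ → Ω → ℕ → unitInterval) : Monotone (coinInfo ξ) := fun _ _ h =>
  biSup_mono fun _ hs => Finset.Icc_subset_Icc_right h hs

theorem measurable_coinInfo (ξ : ℕ → Ω → ℕ → unitInterval) {s t : ℕ} (h1 : 1 ≤ s) (h2 : s ≤ t) :
    Measurable[coinInfo ξ t] (ξ s) :=
  (comap_measurable (ξ s)).mono
    (le_iSup₂ (f := fun s _ => MeasurableSpace.comap (ξ s) inferInstance) s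
      (Finset.mem_Icc.2 ⟨h1, h2⟩)) le_rfl

theorem measurable_scheduled {m : MeasurableSpace Ω} {s : ℕ} (h : Measurable (ξ s)) (n k : ℕ) :
    Measurable fun ω => Scheduled ρ (fun s m => ξ s ω m) n s k := by
  have h1 : Measurable fun ω => ((ξ s ω k : unitInterval) : ℝ) :=
    measurable_subtype_coe.comp ((measurable_pi_apply k).comp h)
  exact measurableSet_setOfPred.1 (measurableSet_le h1 measurable_const)

/-- Only the finitely many orders up to n matter, and any function of a finite table of scheduling
decisions is measurable. -/
theorem measurable_activeOrder {m : MeasurableSpace Ω} {tn n t : ℕ}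
    (h : ∀ k, Measurable (ξ (cellStart tn k t))) :
    Measurable fun ω => activeOrder ρ (fun s m => ξ s ω m) tn n t := by
  have h1 : Measurable fun (ω : Ω) (k : Fin (n + 1)) =>
      Scheduled ρ (fun s m => ξ s ω m) n (cellStart tn k t) k :=
    measurable_pi_lambda _ fun k => measurable_scheduled (h k) n k
  have h2 : Measurable fun p : Fin (n + 1) → Prop => sInf {k | ∃ h : k < n + 1, p ⟨k, h⟩} :=
    measurable_of_finite _
  convert h2.comp h1 using 1
  ext ω
  simp only [activeOrder, Function.comp, exists_prop, Nat.lt_succ_iff]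

/-- The information available when the policy of round `t` is executed. -/
abbrev masterInfo (ξ : ℕ → Ω → ℕ → unitInterval) (R : ℕ → Ω → ℝ) (t : ℕ) : MeasurableSpace Ω :=
  pastRewards R t ⊔ coinInfo ξ t

/-- The information available after round `t`. -/
abbrev masterPast (ξ : ℕ → Ω → ℕ → unitInterval) (R : ℕ → Ω → ℝ) (t : ℕ) : MeasurableSpace Ω :=
  pastRewards R (t + 1) ⊔ coinInfo ξ t

theorem masterInfo_mono : Monotone (masterInfo ξ R) := fun _ _ h =>
  sup_le_sup (pastRewards_mono R h) (coinInfo_mono ξ h)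

theorem masterPast_mono : Monotone (masterPast ξ R) := fun _ _ h =>
  sup_le_sup (pastRewards_mono R (by omega)) (coinInfo_mono ξ h)

theorem masterInfo_le_past (t : ℕ) : masterInfo ξ R t ≤ masterPast ξ R t :=
  sup_le_sup (pastRewards_mono R (by omega)) le_rfl

theorem masterPast_le_info {t : ℕ} (ht : 1 ≤ t) : masterPast ξ R (t - 1) ≤ masterInfo ξ R t :=
  sup_le_sup (pastRewards_mono R (by omega)) (coinInfo_mono ξ (by omega))

theorem measurable_round {t : ℕ} (ht : 1 ≤ t)
    (hstate : Measurable[masterInfo ξ R t] fun ω => (𝒮[ω] (t - 1)).start)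
    (horder : Measurable[masterInfo ξ R t] fun ω => (𝒮[ω] (t - 1)).order)
    (hinst : ∀ q, 1 ≤ q → q < t → Measurable[masterInfo ξ R t] fun ω => (𝓇[ω] q).inst)
    (hpol : ∀ q, 1 ≤ q → q < t → Measurable[masterInfo ξ R t] fun ω => (𝓇[ω] q).pol) :
    Measurable[masterInfo ξ R t] (fun ω => (𝓇[ω] t).inst) ∧
    Measurable[masterInfo ξ R t] (fun ω => (𝓇[ω] t).pol) ∧
    Measurable[masterInfo ξ R t] (fun ω => (𝓇[ω] t).est) := by
  have hao : Measurable[masterInfo ξ R t] fun ω => activeOrder ρ (fun s m => ξ s ω m)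
      (𝒮[ω] (t - 1)).start (𝒮[ω] (t - 1)).order t := by
    refine @measurable_of_countable_cases Ω ℕ (ℕ × ℕ) (masterInfo ξ R t) _ _ _ _ _
      (hstate.prodMk horder) _ (fun y ω => activeOrder ρ (fun s m => ξ s ω m) y.1 y.2 t)
      (fun ω => ?_) (fun ω => rfl)
    refine @measurable_activeOrder ρ Ω ξ (masterInfo ξ R t) _ _ t fun k => ?_
    refine (measurable_coinInfo ξ (t := t) ?_ ?_).mono le_sup_right le_rfl
    · exact (one_le_start _ _ _ _ _ (t - 1)).trans (le_cellStart _ _ _)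
    · exact cellStart_le k (start_le _ _ _ _ _ ht)
  have hin : Measurable[masterInfo ξ R t] (fun ω => (𝓇[ω] t).inst) := by
    have h1 : Measurable fun y : ℕ × ℕ => (cellStart y.1 y.2 t, y.2) := Measurable.of_discrete
    exact h1.comp (hstate.prodMk hao)
  have hset : ∀ a, ∀ q ∈ Finset.Icc 1 t, MeasurableSet[masterInfo ξ R t]
      {ω | q < t ∧ ((𝓇[ω] q).inst = (𝓇[ω] t).inst ∧ (𝓇[ω] q).pol = a)} := by
    intro a q hq
    by_cases hqt : q < t
    · have hq1 := (Finset.mem_Icc.1 hq).1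
      have h1 : MeasurableSet {y : (ℕ × ℕ) × (ℕ × ℕ) | y.1 = y.2} := MeasurableSet.of_discrete
      have h2 := ((hinst q hq1 hqt).prodMk hin) h1
      have h3 := (hpol q hq1 hqt) (measurableSet_singleton a)
      simp only [hqt, true_and]
      exact @MeasurableSet.inter Ω (masterInfo ξ R t) _ _ h2 h3
    · simp [hqt]
  have hidx : ∀ a, Measurable[masterInfo ξ R t] fun ω => ucbIndex c T δ
      (instHist (𝒮[ω] (t - 1)).log (𝓇[ω] t).inst) a := by
    intro a
    have h := fun ω => ucbIndex_instHist (ucb1 A c T δ tie) ρ ρhat (fun s m => ξ s ω m)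
      (fun s => R s ω) c T δ ht le_rfl (𝓇[ω] t).inst (inst_le _ _ _ _ _ ht).1 a
    simp_rw [h]
    refine @measurable_indexOf Ω (masterInfo ξ R t) _ _ _ _ ?_ ?_
    · simp_rw [Finset.card_filter]
      refine Finset.measurable_sum _ fun q hq => ?_
      exact Measurable.ite (hset a q hq) measurable_const measurable_const
    · simp_rw [Finset.sum_filter]
      refine Finset.measurable_sum _ fun q hq => ?_
      by_cases hqt : q < t
      · refine Measurable.ite (hset a q hq) ?_ measurable_const
        exact (measurable_pastRewards R (Finset.mem_Icc.1 hq).1 hqt).mono le_sup_left le_rfl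
      · simp [hqt]
  exact ⟨hin, @measurable_ucb1_act A c δ T tie Ω (masterInfo ξ R t) _ hidx,
    @measurable_ucb1_est A c δ T tie Ω (masterInfo ξ R t) _ hidx⟩

theorem measurable_restarts {t : ℕ} (ht : 1 ≤ t)
    (hstate : Measurable[masterPast ξ R t] fun ω => (𝒮[ω] (t - 1)).start)
    (horder : Measurable[masterPast ξ R t] fun ω => (𝒮[ω] (t - 1)).order)
    (hest : ∀ q, 1 ≤ q → q ≤ t → Measurable[masterPast ξ R t] fun ω => (𝓇[ω] q).est) :
    Measurable[masterPast ξ R t] fun ω => 𝒳[ω] t := by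
  have hR : ∀ q, 1 ≤ q → q ≤ t → Measurable[masterPast ξ R t] (R q) := fun q h1 h2 =>
    (measurable_pastRewards R h1 (by omega)).mono le_sup_left le_rfl
  have hiff := fun ω => propext (masterRestarts_iff (ucb1 A c T δ tie) ρ ρhat
    (fun s m => ξ s ω m) (fun s => R s ω) ht)
  simp_rw [hiff]
  refine @measurable_of_countable_cases Ω Prop (ℕ × ℕ) (masterPast ξ R t) _ _ _ _ _
    (hstate.prodMk horder) _ (fun y ω => (∃ m ≤ y.2, t = cellStart y.1 m t + 2 ^ m - 1 ∧
        Scheduled ρ (fun s m => ξ s ω m) y.2 (cellStart y.1 m t) m ∧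
        ∃ q ∈ Finset.Icc y.1 t, (𝓇[ω] q).est + 9 * ρhat (2 ^ m) ≤
          (1 / (2 : ℝ) ^ m) * ∑ τ ∈ Finset.Icc (cellStart y.1 m t) t, R τ ω) ∨
      3 * ρhat (t - y.1 + 1) ≤ (1 / ((t - y.1 + 1 : ℕ) : ℝ)) *
        ∑ q ∈ Finset.Icc y.1 t, ((𝓇[ω] q).est - R q ω))
      (fun ω => ?_) (fun ω => rfl)
  simp only
  have hs1 := one_le_start (ucb1 A c T δ tie) ρ ρhat (fun s m => ξ s ω m) (fun s => R s ω) (t - 1)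
  have hs2 := start_le (ucb1 A c T δ tie) ρ ρhat (fun s m => ξ s ω m) (fun s => R s ω) ht
  generalize (𝒮[ω] (t - 1)).start = tn at hs1 hs2 ⊢
  generalize (𝒮[ω] (t - 1)).order = n
  let _ : MeasurableSpace Ω := masterPast ξ R t
  refine Measurable.or (Measurable.exists fun m => measurable_const.and (measurable_const.and
    (Measurable.and ?_ (Measurable.exists fun q => ?_)))) ?_
  · refine measurable_scheduled ?_ _ _
    exact (measurable_coinInfo ξ (hs1.trans (le_cellStart _ _ _)) (cellStart_le m hs2)).mono
      le_sup_right le_rfl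
  · refine measurable_mem_and fun hq => ?_
    rw [Finset.mem_Icc] at hq
    refine measurableSet_setOfPred.1 (measurableSet_le ((hest q (by omega) hq.2).add
      measurable_const) (measurable_const.mul (Finset.measurable_sum _ fun τ hτ => ?_)))
    rw [Finset.mem_Icc] at hτ
    have := le_cellStart tn m t
    exact hR τ (by omega) hτ.2
  · refine measurableSet_setOfPred.1 (measurableSet_le measurable_const
      (measurable_const.mul (Finset.measurable_sum _ fun q hq => ?_)))
    rw [Finset.mem_Icc] at hq
    exact (hest q (by omega) hq.2).sub (hR q (by omega) hq.2)

theorem measurable_state_succ {t : ℕ}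
    (hstate : Measurable[masterPast ξ R (t + 1)] fun ω => (𝒮[ω] t).start)
    (horder : Measurable[masterPast ξ R (t + 1)] fun ω => (𝒮[ω] t).order)
    (hrest : Measurable[masterPast ξ R (t + 1)] fun ω => 𝒳[ω] (t + 1)) :
    Measurable[masterPast ξ R (t + 1)] (fun ω => (𝒮[ω] (t + 1)).start) ∧
    Measurable[masterPast ξ R (t + 1)] (fun ω => (𝒮[ω] (t + 1)).order) := by
  classical
  have h : ∀ ω, ((𝒮[ω] (t + 1)).start, (𝒮[ω] (t + 1)).order) =
      (fun y : Prop × ℕ × ℕ => if y.1 then (t + 2, 0) else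
        if t + 2 = y.2.1 + 2 ^ y.2.2 then (t + 2, y.2.2 + 1) else y.2)
      (𝒳[ω] (t + 1), (𝒮[ω] t).start, (𝒮[ω] t).order) := by
    intro ω
    rcases masterState_cases (ucb1 A c T δ tie) ρ ρhat (fun s m => ξ s ω m) (fun s => R s ω) t with
      ⟨h1, h⟩ | ⟨h1, h2, h⟩ | ⟨h1, h2, h⟩
    · rw [h]; simp [h1]
    · rw [h]
      simp only [h1, if_false, if_pos h2]
    · rw [h]
      simp only [h1, if_false, if_neg h2]
  have h2 : Measurable[masterPast ξ R (t + 1)] fun ω =>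
      ((𝒮[ω] (t + 1)).start, (𝒮[ω] (t + 1)).order) := by
    simp_rw [h]
    have h3 : Measurable fun y : Prop × ℕ × ℕ => if y.1 then (t + 2, 0) else
        if t + 2 = y.2.1 + 2 ^ y.2.2 then (t + 2, y.2.2 + 1) else y.2 := Measurable.of_discrete
    exact h3.comp (hrest.prodMk (hstate.prodMk horder))
  exact ⟨measurable_fst.comp h2, measurable_snd.comp h2⟩

/-- The state after round t - 1 and the coins of round t determine the decision of round t; its
reward then determines the tests, and these the next state. -/
theorem measurable_run (t : ℕ) :
    (Measurable[masterPast ξ R t] (fun ω => (𝒮[ω] t).start) ∧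
      Measurable[masterPast ξ R t] (fun ω => (𝒮[ω] t).order)) ∧
    (1 ≤ t → Measurable[masterInfo ξ R t] (fun ω => (𝓇[ω] t).inst) ∧
      Measurable[masterInfo ξ R t] (fun ω => (𝓇[ω] t).pol) ∧
      Measurable[masterInfo ξ R t] (fun ω => (𝓇[ω] t).est)) := by
  induction t using Nat.strong_induction_on with
  | _ t ih =>
    rcases Nat.eq_zero_or_pos t with rfl | ht
    · exact ⟨⟨measurable_const, measurable_const⟩, fun h => absurd h (by norm_num)⟩
    obtain ⟨h1, h2⟩ := (ih (t - 1) (by omega)).1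
    have h1' := h1.mono (masterPast_le_info ht) le_rfl
    have h2' := h2.mono (masterPast_le_info ht) le_rfl
    have hround := measurable_round ht h1' h2'
      (fun q hq hqt => ((ih q hqt).2 hq).1.mono (masterInfo_mono hqt.le) le_rfl)
      (fun q hq hqt => ((ih q hqt).2 hq).2.1.mono (masterInfo_mono hqt.le) le_rfl)
    refine ⟨?_, fun _ => hround⟩
    obtain ⟨t, rfl⟩ := Nat.exists_eq_add_of_le' ht
    have h1'' := h1'.mono (masterInfo_le_past _) le_rfl
    have h2'' := h2'.mono (masterInfo_le_past _) le_rfl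
    refine measurable_state_succ h1'' h2'' (measurable_restarts ht h1'' h2'' fun q hq hqt => ?_)
    rcases Nat.lt_or_eq_of_le hqt with h | rfl
    · exact ((ih q h).2 hq).2.2.mono ((masterInfo_mono h.le).trans (masterInfo_le_past _)) le_rfl
    · exact hround.2.2.mono (masterInfo_le_past _) le_rfl

end MasterMeasurable

end Bandit

namespace Bandit

/-! ## The good event of a run of MASTER with UCB1 -/

section GoodEvent

variable {A : ℕ}

/-- In round `s` of a block of order `n` that starts in round `tn`, a new cell of order `m` begins,
the mean rewards hardly vary in this cell, and some output of the block has been too small, so that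
an instance scheduled for this cell would cause a restart. -/
def BadStart (alg : BaseAlg (Fin A)) (ρ ρhat : ℕ → ℝ) (f : ℕ → Fin A → ℝ)
    (ξ : ℕ → ℕ → unitInterval) (R : ℕ → ℝ) (tn n m s : ℕ) : Prop :=
  ((2 ^ m ∣ s - tn ∧ totalVar (supVar f) s (s + 2 ^ m - 1) ≤ ρ (2 ^ m)) ∧
    (masterState alg ρ ρhat ξ R (s - 1)).start = tn) ∧
    (masterState alg ρ ρhat ξ R (s - 1)).order = n ∧
    ∃ q ∈ Finset.Ico tn s,
      (masterRound alg ρ ρhat ξ R q).est + 13 * ρhat (2 ^ m) ≤ optValue f s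

open Classical in
/-- The properties of a run that hold with high probability. -/
structure GoodRun (alg : BaseAlg (Fin A)) (T : ℕ) (ι : ℝ) (ρ ρhat : ℕ → ℝ) (f : ℕ → Fin A → ℝ)
    (ξ : ℕ → ℕ → unitInterval) (R : ℕ → ℝ) : Prop where
  arm : ∀ i : ℕ × ℕ, i.1 ≤ T → i.2 ≤ T → ∀ a, ∀ t ≤ T, ∀ r,
    |∑ q ∈ (Finset.Icc 1 t).filter (fun q => q < r ∧ ((masterRound alg ρ ρhat ξ R q).inst = i ∧
      (masterRound alg ρ ρhat ξ R q).pol = a)), (R q - f q a)| ≤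
    17 * √(ι * ((Finset.Icc 1 t).filter fun q => q < r ∧
      ((masterRound alg ρ ρhat ξ R q).inst = i ∧ (masterRound alg ρ ρhat ξ R q).pol = a)).card)
  rew : ∀ s, 1 ≤ s → s ≤ T → ∀ t ≤ T,
    |∑ q ∈ Finset.Icc s t, (R q - f q (masterRound alg ρ ρhat ξ R q).pol)| ≤
      17 * √(ι * (Finset.Icc s t).card)
  coins : ∀ tn ≤ T, ∀ n ≤ T, ∀ m ≤ n, ∀ u, 1 ≤ u → u ≤ T → ∀ v ≤ T,
    (((Finset.Icc u v).filter fun s => (tn ≤ s ∧ 2 ^ m ∣ s - tn) ∧ Scheduled ρ ξ n s m).card : ℝ) ≤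
      2 * (ρ (2 ^ n) / ρ (2 ^ m)) *
        ((Finset.Icc u v).filter fun s => tn ≤ s ∧ 2 ^ m ∣ s - tn).card + 16 * ι
  bad : ∀ tn ≤ T, ∀ n ≤ T, ∀ m ≤ n, ∀ t ≤ T,
    (∀ s ∈ Finset.Icc 1 t, BadStart alg ρ ρhat f ξ R tn n m s → ¬ Scheduled ρ ξ n s m) →
    ρ (2 ^ n) / ρ (2 ^ m) *
      ((Finset.Icc 1 t).filter fun s => BadStart alg ρ ρhat f ξ R tn n m s).card ≤ 32 * ι

end GoodEvent

/-! ### Probability of the good event -/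

section Probability

variable {A T : ℕ} {c δ : ℝ} {tie : Finset (Fin A) → Fin A} {ρ : ℕ → ℝ} {f : ℕ → Fin A → ℝ}
  {Ω : Type*} {ξ : ℕ → Ω → ℕ → unitInterval} {R : ℕ → Ω → ℝ}

local notation "𝒮[" ω "]" =>
  masterState (ucb1 A c T δ tie) ρ (rhoHat T δ ρ) (fun s m => ξ s ω m) (fun s => R s ω)
local notation "𝓇[" ω "]" =>
  masterRound (ucb1 A c T δ tie) ρ (rhoHat T δ ρ) (fun s m => ξ s ω m) (fun s => R s ω)

/-- Whether round t is a bad start is settled by rounds before t, so the coins `ξ t` that decide the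
scheduling at t are still independent of it. -/
theorem measurableSet_badStart {t : ℕ} (ht : 1 ≤ t) (tn n m : ℕ) :
    MeasurableSet[masterPast ξ R (t - 1)] {ω | BadStart (ucb1 A c T δ tie) ρ (rhoHat T δ ρ) f
      (fun s m => ξ s ω m) (fun s => R s ω) tn n m t} := by
  have h1 := (measurable_run (c := c) (δ := δ) (T := T) (tie := tie) (ρ := ρ)
    (ρhat := rhoHat T δ ρ) (ξ := ξ) (R := R) (t - 1)).1
  have h2 : ∀ q, 1 ≤ q → q < t → Measurable[masterPast ξ R (t - 1)] fun ω => (𝓇[ω] q).est :=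
    fun q hq hqt => ((measurable_run q).2 hq).2.2.mono
      ((masterInfo_mono (by omega : q ≤ t - 1)).trans (masterInfo_le_past _)) le_rfl
  let _ : MeasurableSpace Ω := masterPast ξ R (t - 1)
  have e1 : MeasurableSet {ω | (𝒮[ω] (t - 1)).start = tn} := h1.1 (measurableSet_singleton tn)
  have e2 : MeasurableSet {ω | (𝒮[ω] (t - 1)).order = n} := h1.2 (measurableSet_singleton n)
  -- No block starts in round 0. Excluding this case ensures that only records of rounds q ≥ 1
  -- occur.
  rcases Nat.eq_zero_or_pos tn with rfl | htn
  · convert MeasurableSet.empty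
    ext ω
    simp only [Set.mem_ofPred_eq, Set.mem_empty_iff_false, iff_false]
    rintro ⟨⟨_, h⟩, _⟩
    have := one_le_start (ucb1 A c T δ tie) ρ (rhoHat T δ ρ) (fun s m => ξ s ω m)
      (fun s => R s ω) (t - 1)
    omega
  · refine measurableSet_setOfPred.2 (Measurable.and (measurable_const.and ?_)
      (Measurable.and ?_ (Measurable.exists fun q => measurable_mem_and fun hq => ?_)))
    · exact measurableSet_setOfPred.1 e1
    · exact measurableSet_setOfPred.1 e2
    · rw [Finset.mem_Ico] at hq
      exact measurableSet_setOfPred.1 (measurableSet_le ((h2 q (by omega) hq.2).add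
        measurable_const) measurable_const)

variable [m0 : MeasurableSpace Ω] {P : Measure Ω}

theorem masterPast_le (hrun : IsMasterRun P (ucb1 A c T δ tie) T δ ρ f ξ R) {t : ℕ} (ht : t ≤ T) :
    masterPast ξ R t ≤ m0 := by
  refine sup_le (iSup₂_le fun s hs => ?_) (iSup₂_le fun s hs => ?_)
  · refine (hrun.reward.measurable s ?_).comap_le
    rw [Finset.mem_Ico] at hs; rw [Finset.mem_Icc]; omega
  · refine (hrun.coin_measurable s ?_).comap_le
    rw [Finset.mem_Icc] at hs ⊢; omega

theorem measureReal_coin (hrun : IsMasterRun P (ucb1 A c T δ tie) T δ ρ f ξ R) {t : ℕ}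
    (ht : t ∈ Finset.Icc 1 T) (m : ℕ) {p : ℝ} (hp0 : 0 ≤ p) (hp1 : p ≤ 1) :
    P.real (ξ t ⁻¹' {x | (x m : ℝ) ≤ p}) = p := by
  have hB : MeasurableSet {x : unitInterval | (x : ℝ) ≤ p} :=
    measurableSet_le measurable_subtype_coe measurable_const
  have h1 : {x : ℕ → unitInterval | (x m : ℝ) ≤ p}
      = (fun x => x m) ⁻¹' {x : unitInterval | (x : ℝ) ≤ p} := rfl
  have h2 : {x : unitInterval | (x : ℝ) ≤ p} = Set.Iic (⟨p, hp0, hp1⟩ : unitInterval) := rfl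
  rw [measureReal_def, ← Measure.map_apply (hrun.coin_measurable t ht)
    (h1 ▸ measurable_pi_apply m hB), hrun.coin_law t ht, h1,
    ← Measure.map_apply (measurable_pi_apply m) hB, Measure.infinitePi_map_eval, h2,
    unitInterval.volume_Iic]
  exact ENNReal.toReal_ofReal hp0

variable [IsProbabilityMeasure P]

theorem master_concentration (hrun : IsMasterRun P (ucb1 A c T δ tie) T δ ρ f ξ R)
    (hf : IsEnvironment T f) (hι : 0 < Real.log (T / δ)) (D : ℕ → Ω → Prop)
    [∀ q ω, Decidable (D q ω)]
    (hD : ∀ t ∈ Finset.Icc 1 T, MeasurableSet[masterInfo ξ R t] {ω | D t ω}) :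
    P.real {ω | ¬ ∀ t ≤ T, ∀ r, |∑ q ∈ (Finset.Icc 1 t).filter (fun q => q < r ∧ D q ω),
        (R q ω - f q (𝓇[ω] q).pol)| ≤ 17 * √(Real.log (T / δ) *
          ((Finset.Icc 1 t).filter fun q => q < r ∧ D q ω).card)}
      ≤ 2 * (T + 1) ^ 2 * Real.exp (-(16 * Real.log (T / δ))) := by
  have hpolm : ∀ t ∈ Finset.Icc 1 T, Measurable[masterInfo ξ R t] fun ω => (𝓇[ω] t).pol :=
    fun t ht => ((measurable_run t).2 (Finset.mem_Icc.1 ht).1).2.1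
  have h := reward_concentration (P := P) (T := T) (F := masterPast ξ R)
    (info := masterInfo ξ R) (X := R) (μ := fun t ω => f t (𝓇[ω] t).pol)
    (Z := fun t ω => if D t ω then 1 else 0) (ι := Real.log (T / δ)) (p := 16)
    masterPast_mono (fun t ht => masterPast_le hrun ht)
    (fun t ht => ⟨masterPast_le_info (Finset.mem_Icc.1 ht).1, masterInfo_le_past t⟩)
    (fun t ht => (measurable_pastRewards R (Finset.mem_Icc.1 ht).1 (Nat.lt_succ_self t)).mono
      le_sup_left le_rfl)
    hrun.reward.mem_Icc
    (fun t ht => (measurable_of_finite (f t)).comp (hpolm t ht))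
    (fun t ht ω => hf t ht _)
    (fun t ht => Measurable.ite (hD t ht) measurable_const measurable_const)
    (fun t ω => by by_cases h : D t ω <;> simp [h])
    hrun.reward.mean hι (by norm_num)
  refine (measureReal_mono ?_ (measure_ne_top _ _)).trans h
  intro ω hω hcon
  refine hω fun t ht r => ?_
  have h2 := abs_sum_filter_lt_le (D := fun q => D q ω)
    (Y := fun q => R q ω - f q (𝓇[ω] q).pol) hcon ht r
  rw [show (1 + 16 : ℝ) = 17 by norm_num] at h2
  exact h2

open Classical in
theorem master_coin_concentration (hrun : IsMasterRun P (ucb1 A c T δ tie) T δ ρ f ξ R)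
    (n m : ℕ) (hp0 : 0 ≤ ρ (2 ^ n) / ρ (2 ^ m)) (hp1 : ρ (2 ^ n) / ρ (2 ^ m) ≤ 1)
    (D : ℕ → Ω → Prop) [∀ q ω, Decidable (D q ω)]
    (hD : ∀ t ∈ Finset.Icc 1 T, MeasurableSet[masterPast ξ R (t - 1)] {ω | D t ω}) (l a : ℝ) :
    P.real {ω | ∃ t ≤ T, a ≤
      l * ((Finset.Icc 1 t).filter fun s => D s ω ∧
        Scheduled ρ (fun s m => ξ s ω m) n s m).card -
      (Real.exp l - 1) * (ρ (2 ^ n) / ρ (2 ^ m)) * ((Finset.Icc 1 t).filter fun s => D s ω).card}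
      ≤ (T + 1) * Real.exp (-a) := by
  have hB : MeasurableSet {x : ℕ → unitInterval | (x m : ℝ) ≤ ρ (2 ^ n) / ρ (2 ^ m)} :=
    measurableSet_le (measurable_subtype_coe.comp (measurable_pi_apply m)) measurable_const
  have h := coin_concentration (P := P) (T := T) (F := masterPast ξ R) (ξ := ξ)
    (B := {x | (x m : ℝ) ≤ ρ (2 ^ n) / ρ (2 ^ m)}) (p := ρ (2 ^ n) / ρ (2 ^ m))
    (Z := fun s ω => if D s ω then 1 else 0) masterPast_mono
    (fun t ht => masterPast_le hrun ht)
    (fun t ht => (measurable_coinInfo ξ (Finset.mem_Icc.1 ht).1 le_rfl).mono le_sup_right le_rfl)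
    (fun t ht => by
      have := hrun.coin_indep t ht
      rwa [show masterPast ξ R (t - 1) = pastRewards R t ⊔ coinInfo ξ (t - 1) by
        rw [masterPast, Nat.sub_add_cancel (Finset.mem_Icc.1 ht).1]])
    hB (fun t ht => measureReal_coin hrun ht m hp0 hp1)
    (fun t ht => Measurable.ite (hD t ht) measurable_const measurable_const)
    (fun t ω => by by_cases h : D t ω <;> simp [h]) l a
  refine (measureReal_mono ?_ (measure_ne_top _ _)).trans h
  rintro ω ⟨t, ht, hω⟩
  refine ⟨t, ht, hω.trans (le_of_eq ?_)⟩
  rw [Finset.card_filter, Finset.card_filter]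
  push_cast
  rw [Finset.mul_sum, Finset.mul_sum, ← Finset.sum_sub_distrib]
  refine Finset.sum_congr rfl fun s _ => ?_
  by_cases h1 : D s ω
  · by_cases h2 : Scheduled ρ (fun s m => ξ s ω m) n s m
    · have h3 : ξ s ω ∈ {x : ℕ → unitInterval | (x m : ℝ) ≤ ρ (2 ^ n) / ρ (2 ^ m)} := h2
      rw [Set.indicator_of_mem h3]
      simp [h1, h2]
    · have h3 : ξ s ω ∉ {x : ℕ → unitInterval | (x m : ℝ) ≤ ρ (2 ^ n) / ρ (2 ^ m)} := h2
      rw [Set.indicator_of_notMem h3]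
      simp [h1, h2]
  · simp [h1]

/-- The tilts 1 and -1 are used for the coins. The first gives the factor 2 in `GoodRun.coins`; with
the second, the absence of successes gives the constant 32 = 2 · 16 in `GoodRun.bad`. -/
theorem exp_sub_bounds : Real.exp 1 - 1 ≤ 2 ∧ Real.exp (-1) - 1 ≤ -(1 / 2) := by
  have h1 := Real.exp_one_lt_d9
  have h2 := Real.exp_one_gt_d9
  refine ⟨by linarith, ?_⟩
  rw [Real.exp_neg]
  have : (Real.exp 1)⁻¹ ≤ 2⁻¹ := inv_anti₀ (by norm_num) (by linarith)
  linarith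

theorem card_union_le {ι : Type*} (s : Finset ι) {E : ι → Set Ω} {b : ℝ} {k : ℕ}
    (hs : s.card ≤ (T + 1) ^ k) (hb : 0 ≤ b) (h : ∀ i ∈ s, P.real (E i) ≤ b) :
    P.real (⋃ i ∈ s, E i) ≤ ((T : ℝ) + 1) ^ k * b := by
  refine (measureReal_biUnion_le_mul s h).trans ?_
  gcongr
  exact_mod_cast hs

theorem card_range_product (T : ℕ) :
    (Finset.range (T + 1) ×ˢ Finset.range (T + 1)).card ≤ (T + 1) ^ 2 := by
  rw [Finset.card_product, Finset.card_range, sq]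

/-- Each property is a union over deterministic indices (instances, arms, starts, orders, interval
ends), of which there are polynomially many in T because A ≤ T. The exponent 16 in the tails pays
for all of them. -/
theorem goodRun_probability (hrun : IsMasterRun P (ucb1 A c T δ tie) T δ ρ f ξ R)
    (hf : IsEnvironment T f) (hT : 1 ≤ T) (hAT : A ≤ T) (hδ : 0 < δ) (hδ1 : δ < 1)
    (h2 : 2 * δ ≤ T) (hpos : ∀ t, 1 ≤ t → 0 < ρ t) (hanti : AntitoneOn ρ (Set.Ici 1)) :
    1 - δ ≤ P.real {ω | GoodRun (ucb1 A c T δ tie) T (Real.log (T / δ)) ρ (rhoHat T δ ρ) f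
      (fun s m => ξ s ω m) (fun s => R s ω)} := by
  classical
  set ι := Real.log (T / δ) with hι
  have hι0 : 0 < ι := by linarith [half_lt_log_two, log_two_le_log hδ h2]
  have hx : (2 : ℝ) ≤ T / δ := by rwa [le_div_iff₀ hδ]
  have hTx : (T : ℝ) ≤ T / δ := by
    rw [le_div_iff₀ hδ]
    exact mul_le_of_le_one_right (Nat.cast_nonneg T) hδ1.le
  set b := Real.exp (-(16 * ι)) with hb
  have hb0 : 0 ≤ b := (Real.exp_pos _).le
  have hp : ∀ n m, m ≤ n → 0 ≤ ρ (2 ^ n) / ρ (2 ^ m) ∧ ρ (2 ^ n) / ρ (2 ^ m) ≤ 1 := by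
    intro n m hmn
    have h3 := hpos (2 ^ m) Nat.one_le_two_pow
    have h4 := hpos (2 ^ n) Nat.one_le_two_pow
    refine ⟨by positivity, div_le_one_of_le₀ (hanti ?_ ?_ ?_) h3.le⟩
    · exact Nat.one_le_two_pow
    · exact Nat.one_le_two_pow
    · exact Nat.pow_le_pow_right (by norm_num) hmn
  set rg := Finset.range (T + 1) with hrg
  set E1 : Set Ω := ⋃ y ∈ (rg ×ˢ rg) ×ˢ (Finset.univ : Finset (Fin A)),
    {ω | ¬ ∀ t ≤ T, ∀ r, |∑ q ∈ (Finset.Icc 1 t).filter (fun q => q < r ∧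
      ((𝓇[ω] q).inst = y.1 ∧ (𝓇[ω] q).pol = y.2)), (R q ω - f q (𝓇[ω] q).pol)| ≤
      17 * √(ι * ((Finset.Icc 1 t).filter fun q => q < r ∧
        ((𝓇[ω] q).inst = y.1 ∧ (𝓇[ω] q).pol = y.2)).card)} with hE1
  set E2 : Set Ω := ⋃ s ∈ rg,
    {ω | ¬ ∀ t ≤ T, ∀ r, |∑ q ∈ (Finset.Icc 1 t).filter (fun q => q < r ∧ s ≤ q),
      (R q ω - f q (𝓇[ω] q).pol)| ≤
      17 * √(ι * ((Finset.Icc 1 t).filter fun q => q < r ∧ s ≤ q).card)} with hE2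
  set E3 : Set Ω := ⋃ y ∈ ((rg ×ˢ rg) ×ˢ (rg ×ˢ rg)) ×ˢ rg,
    {ω | y.2 ≤ y.1.1.2 ∧ ∃ t ≤ T, 16 * ι ≤
      1 * (((Finset.Icc 1 t).filter fun s => (s ∈ Finset.Icc y.1.2.1 y.1.2.2 ∧ y.1.1.1 ≤ s ∧
        2 ^ y.2 ∣ s - y.1.1.1) ∧ Scheduled ρ (fun s m => ξ s ω m) y.1.1.2 s y.2).card : ℝ) -
      (Real.exp 1 - 1) * (ρ (2 ^ y.1.1.2) / ρ (2 ^ y.2)) * ((Finset.Icc 1 t).filter fun s =>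
        s ∈ Finset.Icc y.1.2.1 y.1.2.2 ∧ y.1.1.1 ≤ s ∧ 2 ^ y.2 ∣ s - y.1.1.1).card} with hE3
  set E4 : Set Ω := ⋃ y ∈ (rg ×ˢ rg) ×ˢ rg,
    {ω | y.2 ≤ y.1.2 ∧ ∃ t ≤ T, 16 * ι ≤
      -1 * (((Finset.Icc 1 t).filter fun s => BadStart (ucb1 A c T δ tie) ρ (rhoHat T δ ρ) f
        (fun s m => ξ s ω m) (fun s => R s ω) y.1.1 y.1.2 y.2 s ∧
        Scheduled ρ (fun s m => ξ s ω m) y.1.2 s y.2).card : ℝ) -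
      (Real.exp (-1) - 1) * (ρ (2 ^ y.1.2) / ρ (2 ^ y.2)) * ((Finset.Icc 1 t).filter fun s =>
        BadStart (ucb1 A c T δ tie) ρ (rhoHat T δ ρ) f
        (fun s m => ξ s ω m) (fun s => R s ω) y.1.1 y.1.2 y.2 s).card} with hE4
  have hb1 : P.real E1 ≤ ((T : ℝ) + 1) ^ 3 * (2 * (T + 1) ^ 2 * b) := by
    refine card_union_le _ ?_ (by positivity) fun y _ => ?_
    · rw [Finset.card_product, Finset.card_univ, Fintype.card_fin, pow_succ]
      exact Nat.mul_le_mul (card_range_product T) (by omega)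
    · refine master_concentration hrun hf hι0
        (fun q ω => (𝓇[ω] q).inst = y.1 ∧ (𝓇[ω] q).pol = y.2) fun t ht => ?_
      have h3 := (measurable_run (c := c) (δ := δ) (T := T) (tie := tie) (ρ := ρ)
        (ρhat := rhoHat T δ ρ) (ξ := ξ) (R := R) t).2 (Finset.mem_Icc.1 ht).1
      exact @MeasurableSet.inter Ω (masterInfo ξ R t) _ _ (h3.1 (measurableSet_singleton _))
        (h3.2.1 (measurableSet_singleton _))
  have hb2 : P.real E2 ≤ ((T : ℝ) + 1) ^ 1 * (2 * (T + 1) ^ 2 * b) := by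
    refine card_union_le _ (by simp [hrg]) (by positivity) fun s _ => ?_
    exact master_concentration hrun hf hι0 (fun q _ => s ≤ q) fun t _ => by simp
  have hb3 : P.real E3 ≤ ((T : ℝ) + 1) ^ 5 * ((T + 1) * b) := by
    refine card_union_le _ ?_ (by positivity) fun y _ => ?_
    · rw [Finset.card_product, Finset.card_product, pow_succ, show 4 = 2 + 2 from rfl, pow_add]
      exact Nat.mul_le_mul (Nat.mul_le_mul (card_range_product T) (card_range_product T))
        (by simp [hrg])
    · by_cases hy : y.2 ≤ y.1.1.2
      · refine (measureReal_mono ?_ (measure_ne_top _ _)).trans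
          (master_coin_concentration hrun y.1.1.2 y.2 (hp _ _ hy).1 (hp _ _ hy).2
            (fun s _ => s ∈ Finset.Icc y.1.2.1 y.1.2.2 ∧ y.1.1.1 ≤ s ∧ 2 ^ y.2 ∣ s - y.1.1.1)
            (fun t _ => by simp) 1 (16 * ι))
        exact fun ω hω => hω.2
      · simp only [hy, false_and]
        simpa using by positivity
  have hb4 : P.real E4 ≤ ((T : ℝ) + 1) ^ 3 * ((T + 1) * b) := by
    refine card_union_le _ ?_ (by positivity) fun y _ => ?_
    · rw [Finset.card_product, pow_succ]
      exact Nat.mul_le_mul (card_range_product T) (by simp [hrg])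
    · by_cases hy : y.2 ≤ y.1.2
      · refine (measureReal_mono ?_ (measure_ne_top _ _)).trans
          (master_coin_concentration hrun y.1.2 y.2 (hp _ _ hy).1 (hp _ _ hy).2
            (fun s ω => BadStart (ucb1 A c T δ tie) ρ (rhoHat T δ ρ) f
              (fun s m => ξ s ω m) (fun s => R s ω) y.1.1 y.1.2 y.2 s)
            (fun t ht => measurableSet_badStart (Finset.mem_Icc.1 ht).1 _ _ _) (-1) (16 * ι))
        exact fun ω hω => hω.2
      · simp only [hy, false_and]
        simpa using by positivity
  have hsum : P.real (E1 ∪ E2 ∪ (E3 ∪ E4)) ≤ δ := by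
    -- The four events contribute 2(T+1)^5, 2(T+1)^3, (T+1)^6 and (T+1)^4 times the tail. This
    -- leaves 6/x⁴ ≤ 1/x = δ/T for x = T/δ ≥ 2.
    have hu : P.real (E1 ∪ E2 ∪ (E3 ∪ E4)) ≤ 6 * (((T : ℝ) + 1) ^ 6 * b) := by
      have hu1 := measureReal_union_le (μ := P) (E1 ∪ E2) (E3 ∪ E4)
      have hu2 := measureReal_union_le (μ := P) E1 E2
      have hu3 := measureReal_union_le (μ := P) E3 E4
      have hT1 : (1 : ℝ) ≤ T + 1 := by linarith [(Nat.cast_nonneg T : (0 : ℝ) ≤ T)]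
      have hk : ∀ k ≤ 6, ((T : ℝ) + 1) ^ k * b ≤ ((T : ℝ) + 1) ^ 6 * b := fun k hk => by
        gcongr
      have := hk 5 (by norm_num)
      have := hk 4 (by norm_num)
      have := hk 3 (by norm_num)
      nlinarith
    refine hu.trans ?_
    have h3 : ((T : ℝ) + 1) ^ 6 * b ≤ (T / δ) ^ (2 * 6) / (T / δ) ^ 16 :=
      pow_mul_exp_le hT hx hTx 6
    have hTδ : T / δ * δ = T := by field_simp
    have hT1 : (1 : ℝ) ≤ T := by exact_mod_cast hT
    generalize (T / δ : ℝ) = x at *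
    have hx0 : 0 < x := by linarith
    calc _ ≤ 6 * (x ^ (2 * 6) / x ^ 16) := by gcongr
      _ = 6 / x ^ 4 := by field_simp
      _ ≤ 1 / x := by
          rw [div_le_div_iff₀ (by positivity) hx0]
          have : (2 : ℝ) ^ 3 ≤ x ^ 3 := by gcongr
          nlinarith
      _ ≤ δ := by
          rw [div_le_iff₀ hx0]
          linarith
  refine one_sub_le_measureReal hsum ?_
  intro ω hω
  simp only [Set.mem_compl_iff, Set.mem_union, not_or] at hω
  obtain ⟨⟨g1, g2⟩, g3, g4⟩ := hω
  have hmem : ∀ {k : ℕ}, k ≤ T → k ∈ rg := fun hk => Finset.mem_range.2 (by omega)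
  refine ⟨?_, ?_, ?_, ?_⟩
  · intro i hi1 hi2 a t ht r
    by_contra hcon
    refine g1 (Set.mem_biUnion (x := (i, a)) ?_ fun hall => hcon ?_)
    · exact Finset.mem_coe.2 (Finset.mem_product.2 ⟨Finset.mem_product.2 ⟨hmem hi1, hmem hi2⟩,
        Finset.mem_univ _⟩)
    · have := hall t ht r
      rwa [Finset.sum_congr rfl fun q hq => by
        rw [show (𝓇[ω] q).pol = a from (Finset.mem_filter.1 hq).2.2.2]] at this
  · intro s hs1 hs t ht
    by_contra hcon
    refine g2 (Set.mem_biUnion (x := s) (Finset.mem_coe.2 (hmem hs)) fun hall => hcon ?_)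
    have := hall t ht (t + 1)
    rwa [show (Finset.Icc 1 t).filter (fun q => q < t + 1 ∧ s ≤ q) = Finset.Icc s t by
      ext q
      simp only [Finset.mem_filter, Finset.mem_Icc]
      omega] at this
  · intro tn htn n hn m hm u hu1 hu v hv
    by_contra! hcon
    refine g3 (Set.mem_biUnion (x := (((tn, n), (u, v)), m)) ?_ ⟨hm, v, hv, ?_⟩)
    · simp only [Finset.coe_product, Set.mem_prod, Finset.mem_coe]
      exact ⟨⟨⟨hmem htn, hmem hn⟩, hmem hu, hmem hv⟩, hmem (hm.trans hn)⟩
    · have e1 : (Finset.Icc 1 v).filter (fun s => s ∈ Finset.Icc u v ∧ tn ≤ s ∧ 2 ^ m ∣ s - tn)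
          = (Finset.Icc u v).filter fun s => tn ≤ s ∧ 2 ^ m ∣ s - tn := by
        ext s
        simp only [Finset.mem_filter, Finset.mem_Icc]
        constructor
        · rintro ⟨h1, h2, h3⟩; exact ⟨h2, h3⟩
        · rintro ⟨h2, h3⟩; exact ⟨⟨by omega, h2.2⟩, h2, h3⟩
      have e2 : (Finset.Icc 1 v).filter (fun s => (s ∈ Finset.Icc u v ∧ tn ≤ s ∧ 2 ^ m ∣ s - tn) ∧
            Scheduled ρ (fun s m => ξ s ω m) n s m)
          = (Finset.Icc u v).filter fun s => (tn ≤ s ∧ 2 ^ m ∣ s - tn) ∧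
            Scheduled ρ (fun s m => ξ s ω m) n s m := by
        rw [← Finset.filter_filter, e1, Finset.filter_filter]
      simp only [e1, e2]
      have h3 := mul_nonneg (mul_nonneg (sub_nonneg.2 exp_sub_bounds.1) (hp n m hm).1)
        (Nat.cast_nonneg (α := ℝ) ((Finset.Icc u v).filter fun s => tn ≤ s ∧ 2 ^ m ∣ s - tn).card)
      nlinarith
  · intro tn htn n hn m hm t ht hall
    by_contra! hcon
    refine g4 (Set.mem_biUnion (x := ((tn, n), m)) ?_ ⟨hm, t, ht, ?_⟩)
    · simp only [Finset.coe_product, Set.mem_prod, Finset.mem_coe]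
      exact ⟨⟨hmem htn, hmem hn⟩, hmem (hm.trans hn)⟩
    · have e1 : (Finset.Icc 1 t).filter (fun s => BadStart (ucb1 A c T δ tie) ρ (rhoHat T δ ρ) f
          (fun s m => ξ s ω m) (fun s => R s ω) tn n m s ∧
          Scheduled ρ (fun s m => ξ s ω m) n s m) = ∅ := by
        refine Finset.filter_eq_empty_iff.2 fun s hs => ?_
        rintro ⟨h3, h4⟩
        exact hall s hs h3 h4
      simp only [e1]
      have h3 := mul_nonneg (mul_nonneg (neg_nonneg.2 (sub_nonpos.2 exp_sub_bounds.2))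
        (hp n m hm).1) (Nat.cast_nonneg (α := ℝ) ((Finset.Icc 1 t).filter fun s =>
          BadStart (ucb1 A c T δ tie) ρ (rhoHat T δ ρ) f
          (fun s m => ξ s ω m) (fun s => R s ω) tn n m s).card)
      simp only [Finset.card_empty, Nat.cast_zero, mul_zero]
      nlinarith

end Probability

end Bandit

namespace Bandit

/-! ## Deterministic analysis of a good run -/

section Rho

variable {A T : ℕ} {K δ : ℝ}

/-- The input `ρ` of MASTER. -/
noncomputable def masterRho (K : ℝ) (A T : ℕ) (δ : ℝ) (t : ℕ) : ℝ := min (ucbRho K A T δ t) 1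

theorem masterRho_le_one (t : ℕ) : masterRho K A T δ t ≤ 1 := min_le_right _ _

theorem masterRho_antitoneOn (hK : 0 ≤ K) (hι : 0 ≤ Real.log (T / δ)) :
    AntitoneOn (masterRho K A T δ) (Set.Ici 1) := fun _ hs _ ht hst =>
  min_le_min_right 1 (ucbRho_antitoneOn hK hι hs ht hst)

theorem mul_masterRho (t : ℕ) : t * masterRho K A T δ t = min (t * ucbRho K A T δ t) t := by
  rw [masterRho, mul_min_of_nonneg _ _ (Nat.cast_nonneg t), mul_one]

theorem mul_masterRho_mono (hK : 0 ≤ K) (hι : 0 ≤ Real.log (T / δ)) {s t : ℕ} (hs : 1 ≤ s)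
    (hst : s ≤ t) : s * masterRho K A T δ s ≤ t * masterRho K A T δ t := by
  rw [mul_masterRho, mul_masterRho]
  exact min_le_min (mul_ucbRho_monotoneOn hK hι hs (hs.trans hst) hst) (by exact_mod_cast hst)

theorem masterRho_pos (hA : 1 ≤ A) (hK : 0 < K) (hι : 0 < Real.log (T / δ)) {t : ℕ} (ht : 1 ≤ t) :
    0 < masterRho K A T δ t := by
  have ht' : (0 : ℝ) < t := by exact_mod_cast ht
  have hA' : (0 : ℝ) < A := by exact_mod_cast hA
  refine lt_min ?_ one_pos
  rw [ucbRho]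
  positivity

/-- The cap absorbs the additive term a = Aι: for a ≤ t it is at most √(at), and for t ≤ a the
capped value t is at most √(at). -/
theorem mul_masterRho_le (hK : 1 ≤ K) (hι : 0 ≤ Real.log (T / δ)) {t : ℕ} (ht : 1 ≤ t) :
    t * masterRho K A T δ t ≤ 2 * K * √(A * Real.log (T / δ) * t) := by
  rw [mul_masterRho, mul_ucbRho hι ht]
  have ha : 0 ≤ A * Real.log (T / δ) := by positivity
  set a := A * Real.log (T / δ)
  have ht' : (1 : ℝ) ≤ t := by exact_mod_cast ht
  rcases le_total a t with h | h
  · refine (min_le_left _ _).trans ?_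
    have : a ≤ √(a * t) := Real.le_sqrt_of_sq_le (by nlinarith)
    nlinarith
  · refine (min_le_right _ _).trans ?_
    have : (t : ℝ) ≤ √(a * t) := Real.le_sqrt_of_sq_le (by nlinarith)
    nlinarith

theorem le_mul_masterRho (hK : 0 ≤ K) (hι : 0 ≤ Real.log (T / δ)) {t : ℕ} (ht : 1 ≤ t)
    (h : masterRho K A T δ t < 1) : K * √(A * Real.log (T / δ) * t) ≤ t * masterRho K A T δ t := by
  have h1 : ucbRho K A T δ t < 1 := (min_lt_iff.1 h).resolve_right (lt_irrefl 1)
  rw [masterRho, min_eq_left h1.le, mul_ucbRho hι ht]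
  have : 0 ≤ A * Real.log (T / δ) := by positivity
  gcongr
  linarith

theorem min_le_mul_masterRho (hK : 119 ≤ K) (hι : 0 ≤ Real.log (T / δ)) {t : ℕ} (ht : 1 ≤ t) :
    min (t : ℝ) (119 * √(A * Real.log (T / δ) * t)) ≤ t * masterRho K A T δ t := by
  rw [mul_masterRho, min_comm, mul_ucbRho hι ht]
  have : 0 ≤ A * Real.log (T / δ) := by positivity
  refine min_le_min_right _ ?_
  gcongr
  linarith

end Rho

/-- A good run of MASTER with UCB1. -/
structure UCBRun (A T : ℕ) (δ K : ℝ) (tie : Finset (Fin A) → Fin A) (f : ℕ → Fin A → ℝ)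
    (ξ : ℕ → ℕ → unitInterval) (R : ℕ → ℝ) : Prop where
  one_le_A : 1 ≤ A
  one_le_T : 1 ≤ T
  delta_pos : 0 < δ
  delta_lt : δ < 1
  two_mul_le : 2 * δ ≤ T
  tie_mem : ∀ s : Finset (Fin A), s.Nonempty → tie s ∈ s
  le_K : 5000 ≤ K
  env : IsEnvironment T f
  rew_mem : ∀ t ∈ Finset.Icc 1 T, R t ∈ Set.Icc (0 : ℝ) 1
  good : GoodRun (ucb1 A 17 T δ tie) T (Real.log (T / δ)) (masterRho K A T δ)
    (rhoHat T δ (masterRho K A T δ)) f ξ R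

/-- Points of one residue class have distinct quotients (x - s)/d. -/
theorem card_filter_dvd_le {b d s t : ℕ} (hd : 0 < d) :
    ((Finset.Icc s t).filter fun x => b ≤ x ∧ d ∣ x - b).card ≤ (t - s) / d + 1 := by
  rw [← Finset.card_range ((t - s) / d + 1)]
  refine Finset.card_le_card_of_injOn (fun x => (x - s) / d) ?_ ?_
  · intro x hx
    simp only [Finset.coe_filter, Finset.mem_Icc, Set.mem_ofPred_eq] at hx
    simp only [Finset.coe_range, Set.mem_Iio, Nat.lt_succ_iff]
    exact Nat.div_le_div_right (by omega)
  · have key : ∀ x y, s ≤ x → b ≤ x → d ∣ x - b → d ∣ y - b → x < y →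
        (x - s) / d < (y - s) / d := by
      intro x y hsx hbx hx hy hxy
      have h1 : d ∣ y - x := by
        have := Nat.dvd_sub hy hx
        rwa [show y - b - (x - b) = y - x by omega] at this
      have h2 : d ≤ y - x := Nat.le_of_dvd (by omega) h1
      have h3 : (x - s + d) / d ≤ (y - s) / d := Nat.div_le_div_right (by omega)
      rw [Nat.add_div_right _ hd] at h3
      omega
    intro x hx y hy hxy
    simp only [Finset.coe_filter, Finset.mem_Icc, Set.mem_ofPred_eq] at hx hy
    simp only at hxy
    rcases lt_trichotomy x y with h | h | h
    · have := key x y hx.1.1 hx.2.1 hx.2.2 hy.2.2 h; omega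
    · exact h
    · have := key y x hy.1.1 hy.2.1 hy.2.2 hx.2.2 h; omega

/-! ### Optimism and regret inside a scheduled cell -/

namespace UCBRun

variable {A T : ℕ} {δ K : ℝ} {tie : Finset (Fin A) → Fin A} {f : ℕ → Fin A → ℝ}
  {ξ : ℕ → ℕ → unitInterval} {R : ℕ → ℝ} (G : UCBRun A T δ K tie f ξ R)

local notation "ρ" => masterRho K A T δ
local notation "ρh" => rhoHat T δ (masterRho K A T δ)
local notation "ι" => Real.log (T / δ)
local notation "𝒮" => masterState (ucb1 A 17 T δ tie) (masterRho K A T δ)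
  (rhoHat T δ (masterRho K A T δ)) ξ R
local notation "𝓇" => masterRound (ucb1 A 17 T δ tie) (masterRho K A T δ)
  (rhoHat T δ (masterRho K A T δ)) ξ R
local notation "𝒳" => MasterRestarts (ucb1 A 17 T δ tie) (masterRho K A T δ)
  (rhoHat T δ (masterRho K A T δ)) ξ R
local notation "Δ" => totalVar (supVar f)

include G

theorem log_ge : Real.log 2 ≤ ι := log_two_le_log G.delta_pos G.two_mul_le

theorem log_gt : 0.69 < ι := by
  have := Real.log_two_gt_d9
  have := G.log_ge
  linarith

theorem log_pos : 0 < ι := by linarith [G.log_gt]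

theorem rho_pos {t : ℕ} (ht : 1 ≤ t) : 0 < ρ t :=
  masterRho_pos G.one_le_A (by linarith [G.le_K]) G.log_pos ht

theorem rho_anti {s t : ℕ} (hs : 1 ≤ s) (hst : s ≤ t) : ρ t ≤ ρ s :=
  masterRho_antitoneOn (by linarith [G.le_K]) G.log_pos.le hs (hs.trans hst) hst

theorem logb_nonneg : 0 ≤ Real.logb 2 T :=
  Real.logb_nonneg (by norm_num) (by exact_mod_cast G.one_le_T)

/-- Here 6ι ≥ 6 · 0.69 > 4. Consequently a variation of at most ρ is negligible against ρ̂, and ρ̂ ≥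
4 wherever ρ is capped at 1. -/
theorem four_mul_rho_le {t : ℕ} (ht : 1 ≤ t) : 4 * ρ t ≤ ρh t := by
  rw [rhoHat]
  have h1 := G.log_gt
  have h2 := G.logb_nonneg
  have := G.rho_pos ht
  gcongr
  nlinarith

theorem rhoHat_pos {t : ℕ} (ht : 1 ≤ t) : 0 < ρh t := by
  linarith [G.four_mul_rho_le ht, G.rho_pos ht]

theorem order_bound {t : ℕ} (ht1 : 1 ≤ t) (ht : t ≤ T) : 2 ^ (𝒮 (t - 1)).order ≤ T ∧
    (𝒮 (t - 1)).order ≤ T := by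
  have h1 := (masterState_bounds (ucb1 A 17 T δ tie) ρ ρh ξ R (t - 1)).2.2
  have h2 := start_le (ucb1 A 17 T δ tie) ρ ρh ξ R ht1
  refine ⟨by omega, ?_⟩
  have := Nat.lt_two_pow_self (n := (𝒮 (t - 1)).order)
  omega

theorem order_add_one_le {t : ℕ} (ht1 : 1 ≤ t) (ht : t ≤ T) :
    ((𝒮 (t - 1)).order : ℝ) + 1 ≤ Real.logb 2 T + 1 := by
  have h := (G.order_bound ht1 ht).1
  have hT : (0 : ℝ) < T := by exact_mod_cast G.one_le_T
  have h1 : ((2 : ℝ) ^ (𝒮 (t - 1)).order) ≤ T := by exact_mod_cast h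
  have : ((𝒮 (t - 1)).order : ℝ) ≤ Real.logb 2 T := by
    rw [Real.le_logb_iff_rpow_le (by norm_num) hT, Real.rpow_natCast]
    exact h1
  linarith

theorem inst_spec {t : ℕ} (ht : 1 ≤ t) : (𝓇 t).inst.2 ≤ (𝒮 (t - 1)).order ∧
    (𝓇 t).inst.1 = cellStart (𝒮 (t - 1)).start (𝓇 t).inst.2 t ∧
    Scheduled ρ ξ (𝒮 (t - 1)).order (𝓇 t).inst.1 (𝓇 t).inst.2 ∧
    (𝒮 (t - 1)).start ≤ (𝓇 t).inst.1 ∧ (𝓇 t).inst.1 ≤ t ∧ t < (𝓇 t).inst.1 + 2 ^ (𝓇 t).inst.2 := by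
  have h := activeOrder_spec ρ ξ (tn := (𝒮 (t - 1)).start) (n := (𝒮 (t - 1)).order) (t := t)
    (G.rho_pos Nat.one_le_two_pow).ne'
  exact ⟨h.1, rfl, h.2, le_cellStart _ _ _, cellStart_le _ (start_le _ _ _ _ _ ht),
    lt_cellStart_add _ (start_le _ _ _ _ _ ht)⟩

theorem inst_le_T {t : ℕ} (ht1 : 1 ≤ t) (ht : t ≤ T) : (𝓇 t).inst.1 ≤ T ∧ (𝓇 t).inst.2 ≤ T := by
  obtain ⟨h1, _, _, _, h2, _⟩ := G.inst_spec ht1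
  exact ⟨h2.trans ht, h1.trans (G.order_bound ht1 ht).2⟩

theorem est_le_one (t : ℕ) : (𝓇 t).est ≤ 1 := ucb1_est_le_one (tie := tie) _

theorem est_nonneg {t : ℕ} (ht1 : 1 ≤ t) (ht : t ≤ T) : 0 ≤ (𝓇 t).est := by
  refine (ucb1_est_mem (tie := tie) (by norm_num) fun x hx => ?_).1
  obtain ⟨y, hy, rfl⟩ := List.mem_map.1 hx
  obtain ⟨q, hq, rfl⟩ := (mem_log _ _ _ _ _).1 (List.mem_filter.1 hy).1
  refine G.rew_mem q ?_
  have := one_le_start (ucb1 A 17 T δ tie) ρ ρh ξ R (t - 1)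
  rw [Finset.mem_Ico] at hq
  rw [Finset.mem_Icc]
  omega

theorem est_sub_rew_le_one {t : ℕ} (ht1 : 1 ≤ t) (ht : t ≤ T) : (𝓇 t).est - R t ≤ 1 := by
  have := (G.rew_mem t (Finset.mem_Icc.2 ⟨ht1, ht⟩)).1
  linarith [G.est_le_one t]

theorem optValue_mem {t : ℕ} (ht1 : 1 ≤ t) (ht : t ≤ T) : optValue f t ∈ Set.Icc (0 : ℝ) 1 := by
  obtain ⟨a, ha⟩ := exists_eq_optValue G.one_le_A f t
  rw [← ha]
  exact G.env t (Finset.mem_Icc.2 ⟨ht1, ht⟩) a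

/-- The estimates are optimistic. -/
theorem le_est {t s : ℕ} (ht1 : 1 ≤ t) (ht : t ≤ T) (hs : s ≤ (𝓇 t).inst.1) :
    optValue f t - Δ s t ≤ (𝓇 t).est := by
  obtain ⟨a, ha⟩ := exists_eq_optValue G.one_le_A f t
  have hV0 : 0 ≤ Δ (𝓇 t).inst.1 t := totalVar_nonneg (supVar_nonneg f) _ _
  have hmono : Δ (𝓇 t).inst.1 t ≤ Δ s t := totalVar_mono (supVar_nonneg f) hs le_rfl
  have h1 := (G.env t (Finset.mem_Icc.2 ⟨ht1, ht⟩) a).2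
  obtain ⟨_, _, _, h4, h5, _⟩ := G.inst_spec ht1
  refine le_trans (b := f t a - Δ (𝓇 t).inst.1 t) (by linarith) (le_ucb1_est (tie := tie) _
    (a := a) (by linarith) ?_)
  change _ ≤ ucbIndex 17 T δ (instHist (𝒮 (t - 1)).log (𝓇 t).inst) a
  rw [ucbIndex_instHist _ _ _ _ _ _ _ _ ht1 le_rfl _ h4]
  refine le_indexOf G.log_pos.le (one_le_seventeen_mul_sqrt G.log_ge) h1 hV0
    (G.good.arm _ (G.inst_le_T ht1 ht).1 (G.inst_le_T ht1 ht).2 a t ht t) fun q hq => ?_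
  obtain ⟨hq1, hq2, hq3, -⟩ := Finset.mem_filter.1 hq
  have h6 := (inst_le (ucb1 A 17 T δ tie) ρ ρh ξ R (Finset.mem_Icc.1 hq1).1).2
  rw [hq3] at h6
  exact abs_sub_le_totalVar f a (Finset.mem_Icc.2 ⟨h6, hq2.le⟩) (Finset.mem_Icc.2 ⟨h5, le_rfl⟩)

/-- The regret of a single instance against its own estimates. -/
theorem sum_inst_le {u : ℕ} (hu : u ≤ T) (i : ℕ × ℕ) (hi1 : i.1 ≤ T) (hi2 : i.2 ≤ T) :
    ∑ q ∈ (Finset.Icc 1 u).filter (fun q => (𝓇 q).inst = i), ((𝓇 q).est - R q) ≤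
      ((Finset.Icc 1 u).filter fun q => (𝓇 q).inst = i).card * Δ i.1 u +
      119 * √(A * ι * ((Finset.Icc 1 u).filter fun q => (𝓇 q).inst = i).card) := by
  have hfil : ∀ r a, ((Finset.Icc 1 u).filter fun q => (𝓇 q).inst = i).filter
      (fun q => q < r ∧ (𝓇 q).pol = a)
      = (Finset.Icc 1 u).filter fun q => q < r ∧ ((𝓇 q).inst = i ∧ (𝓇 q).pol = a) := by
    intro r a
    rw [Finset.filter_filter]
    refine Finset.filter_congr fun q _ => ?_
    tauto
  have hmem : ∀ q ∈ (Finset.Icc 1 u).filter (fun q => (𝓇 q).inst = i),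
      1 ≤ q ∧ q ≤ T ∧ q ∈ Finset.Icc i.1 u ∧ (𝓇 q).inst = i := by
    intro q hq
    obtain ⟨hq1, hq2⟩ := Finset.mem_filter.1 hq
    rw [Finset.mem_Icc] at hq1
    have h6 := (inst_le (ucb1 A 17 T δ tie) ρ ρh ξ R hq1.1).2
    rw [hq2] at h6
    exact ⟨hq1.1, hq1.2.trans hu, Finset.mem_Icc.2 ⟨h6, hq1.2⟩, hq2⟩
  have h := sum_ucb_est_sub_le (c := 17) (V := Δ i.1 u)
    (S := (Finset.Icc 1 u).filter fun q => (𝓇 q).inst = i) (pol := fun q => (𝓇 q).pol)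
    (R := R) (est := fun q => (𝓇 q).est) (f := f) G.log_pos.le (by norm_num)
    (totalVar_nonneg (supVar_nonneg f) _ _)
    (fun q hq a => (G.env q (Finset.mem_Icc.2 ⟨(hmem q hq).1, (hmem q hq).2.1⟩) a).1)
    (fun q hq r hr a => abs_sub_le_totalVar f a (hmem q hq).2.2.1 (hmem r hr).2.2.1)
    (fun a r => by
      rw [hfil]
      exact G.good.arm i hi1 hi2 a u hu r)
    (fun r hr => by
      obtain ⟨h1, h2, h3, h4⟩ := hmem r hr
      rw [hfil, ← h4, ← ucbIndex_instHist _ _ _ _ _ _ _ _ h1 (Finset.mem_Icc.1 h3).2 _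
        (inst_le _ _ _ _ _ h1).1]
      exact (ucb1_est_eq G.one_le_A G.tie_mem _).trans_le (min_le_left _ _))
  refine h.trans (le_of_eq ?_)
  norm_num

theorem state_eq {t q : ℕ} (h1 : (𝒮 (t - 1)).start ≤ q) (h2 : q ≤ t) :
    (𝒮 (q - 1)).start = (𝒮 (t - 1)).start ∧ (𝒮 (q - 1)).order = (𝒮 (t - 1)).order :=
  masterState_eq_of_le _ _ _ _ _ (by omega) (by omega)

/-- Within the cell of a scheduled instance, the active instances start in this cell. -/
theorem inst_in_cell {t m q : ℕ} (ht1 : 1 ≤ t) (hm : m ≤ (𝒮 (t - 1)).order)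
    (hsch : Scheduled ρ ξ (𝒮 (t - 1)).order (cellStart (𝒮 (t - 1)).start m t) m)
    (hq : q ∈ Finset.Icc (cellStart (𝒮 (t - 1)).start m t) t) :
    (𝓇 q).inst.2 ≤ m ∧ cellStart (𝒮 (t - 1)).start m t ≤ (𝓇 q).inst.1 := by
  rw [Finset.mem_Icc] at hq
  have hbs := le_cellStart (𝒮 (t - 1)).start m t
  have h1 := one_le_start (ucb1 A 17 T δ tie) ρ ρh ξ R (t - 1)
  obtain ⟨e1, e2⟩ := G.state_eq (hbs.trans hq.1) hq.2
  have hlt := lt_cellStart_add m (start_le (ucb1 A 17 T δ tie) ρ ρh ξ R ht1)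
  have hc := cellStart_eq_of_mem hq.1 (hq.2.trans_lt hlt)
  have h2 : (𝓇 q).inst.2 ≤ m := by
    change activeOrder ρ ξ (𝒮 (q - 1)).start (𝒮 (q - 1)).order q ≤ m
    rw [e1, e2]
    exact activeOrder_le ρ ξ hm (by rwa [hc])
  refine ⟨h2, ?_⟩
  rw [(G.inst_spec (by omega : 1 ≤ q)).2.1, e1, ← hc]
  exact cellStart_le_cellStart _ h2 _

/-- The regret of MASTER against its own estimates, in an initial segment of the cell of a
scheduled instance. -/
theorem sum_cell_le {t m : ℕ} (ht1 : 1 ≤ t) (ht : t ≤ T) (hm : m ≤ (𝒮 (t - 1)).order)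
    (hsch : Scheduled ρ ξ (𝒮 (t - 1)).order (cellStart (𝒮 (t - 1)).start m t) m) :
    ∑ q ∈ Finset.Icc (cellStart (𝒮 (t - 1)).start m t) t, ((𝓇 q).est - R q) ≤
      ((t - cellStart (𝒮 (t - 1)).start m t + 1 : ℕ) : ℝ) *
        (Δ (cellStart (𝒮 (t - 1)).start m t) t +
          ρh (t - cellStart (𝒮 (t - 1)).start m t + 1)) := by
  classical
  have hcell := fun q => G.inst_in_cell (q := q) ht1 hm hsch
  have hst := start_le (ucb1 A 17 T δ tie) ρ ρh ξ R ht1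
  have hsb := one_le_start (ucb1 A 17 T δ tie) ρ ρh ξ R (t - 1)
  have hn := G.order_add_one_le ht1 ht
  have hnT := (G.order_bound ht1 ht).2
  have hE := (masterState_bounds (ucb1 A 17 T δ tie) ρ ρh ξ R (t - 1)).2.1
  have hstate := fun q => G.state_eq (t := t) (q := q)
  generalize hb : (𝒮 (t - 1)).start = b at *
  generalize hno : (𝒮 (t - 1)).order = n at *
  have hbs := le_cellStart b m t
  have hs := cellStart_le m hst
  generalize cellStart b m t = s at *
  set V := Δ s t with hV
  have hV0 : 0 ≤ V := totalVar_nonneg (supVar_nonneg f) _ _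
  set t' := t - s + 1 with ht'
  have ht'1 : 1 ≤ t' := by omega
  have ht'0 : (0 : ℝ) < t' := by exact_mod_cast ht'1
  have hcard : (Finset.Icc s t).card = t' := by rw [Nat.card_Icc]; omega
  have hin : ∀ q ∈ Finset.Icc s t, 1 ≤ q ∧ q ≤ T := fun q hq => by
    rw [Finset.mem_Icc] at hq; omega
  by_cases hρ : 1 ≤ ρ t'
  · have h1 : ∑ q ∈ Finset.Icc s t, ((𝓇 q).est - R q) ≤ t' := by
      rw [← hcard]
      simpa using Finset.sum_le_card_nsmul (Finset.Icc s t) _ (1 : ℝ) fun q hq =>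
        G.est_sub_rew_le_one (hin q hq).1 (hin q hq).2
    have h2 := G.four_mul_rho_le ht'1
    nlinarith
  push Not at hρ
  set a := A * ι with ha
  have ha0 : 0 ≤ a := mul_nonneg (Nat.cast_nonneg A) G.log_pos.le
  have hK0 : 0 ≤ K := by linarith [G.le_K]
  -- Bounds for the regret of one order-k instance beyond the variation: the cell length, the UCB1
  -- bound for 2^k pulls, and the UCB1 bound for the t' rounds seen so far. The first two give β k ≤
  -- 2^k ρ(2^k); the third keeps a few exceptional instances cheap compared with t' ρ(t').
  set β : ℕ → ℝ := fun k => min ((2 : ℝ) ^ k) (min (119 * √(a * 2 ^ k)) (119 * √(a * t')))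
    with hβ
  have hβ0 : ∀ k, 0 ≤ β k := fun k => by positivity
  set I : ℕ → Finset ℕ := fun k => (Finset.Icc s t).filter fun x =>
    (b ≤ x ∧ 2 ^ k ∣ x - b) ∧ Scheduled ρ ξ n x k with hI
  set J : Finset (ℕ × ℕ) := (Finset.Icc s t).image fun q => (𝓇 q).inst with hJ
  have hJI : ∀ i ∈ J, i.2 ∈ Finset.range (m + 1) ∧ i.1 ∈ I i.2 := by
    intro i hi
    obtain ⟨q, hq, rfl⟩ := Finset.mem_image.1 hi
    obtain ⟨h1, h2⟩ := hcell q hq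
    obtain ⟨_, h3, h4, h5, h6, _⟩ := G.inst_spec (hin q hq).1
    have hq' := Finset.mem_Icc.1 hq
    obtain ⟨e1, e2⟩ := hstate q (hbs.trans hq'.1) hq'.2
    rw [e2] at h4
    rw [e1] at h3 h5
    refine ⟨Finset.mem_range.2 (by omega),
      Finset.mem_filter.2 ⟨Finset.mem_Icc.2 ⟨h2, h6.trans hq'.2⟩, ⟨h5, ?_⟩, h4⟩⟩
    rw [h3]
    exact dvd_cellStart_sub _ _ _
  have hfib : ∀ i ∈ J, ∑ q ∈ (Finset.Icc s t).filter (fun q => (𝓇 q).inst = i),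
      ((𝓇 q).est - R q) ≤
      ((Finset.Icc s t).filter fun q => (𝓇 q).inst = i).card * V + β i.2 := by
    intro i hi
    obtain ⟨q, hq, rfl⟩ := Finset.mem_image.1 hi
    have hsi := (hcell q hq).2
    have hT := G.inst_le_T (hin q hq).1 (hin q hq).2
    generalize (𝓇 q).inst = i at *
    have hmem : ∀ r ∈ Finset.Icc 1 t, (𝓇 r).inst = i → i.1 ≤ r ∧ r < i.1 + 2 ^ i.2 := by
      intro r hr hri
      have := G.inst_spec (Finset.mem_Icc.1 hr).1
      rw [hri] at this
      exact ⟨this.2.2.2.2.1, this.2.2.2.2.2⟩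
    -- The instance starts at or after s, so no round before s belongs to it.
    have heq : (Finset.Icc s t).filter (fun q => (𝓇 q).inst = i)
        = (Finset.Icc 1 t).filter fun q => (𝓇 q).inst = i := by
      ext r
      simp only [Finset.mem_filter, Finset.mem_Icc]
      constructor
      · rintro ⟨h1, h2⟩; exact ⟨by omega, h2⟩
      · rintro ⟨h1, h2⟩
        have := (hmem r (Finset.mem_Icc.2 h1) h2).1
        exact ⟨by omega, h2⟩
    have hc1 : ((Finset.Icc s t).filter fun q => (𝓇 q).inst = i).card ≤ t' :=
      hcard ▸ Finset.card_filter_le _ _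
    have hc2 : ((Finset.Icc s t).filter fun q => (𝓇 q).inst = i).card ≤ 2 ^ i.2 := by
      rw [heq]
      calc _ ≤ (Finset.Ico i.1 (i.1 + 2 ^ i.2)).card := by
            refine Finset.card_le_card fun r hr => ?_
            obtain ⟨h1, h2⟩ := Finset.mem_filter.1 hr
            exact Finset.mem_Ico.2 (hmem r h1 h2)
        _ = _ := by simp
    have hreg := G.sum_inst_le ht i hT.1 hT.2
    rw [← heq] at hreg
    have htriv : ∑ q ∈ (Finset.Icc s t).filter (fun q => (𝓇 q).inst = i), ((𝓇 q).est - R q) ≤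
        ((Finset.Icc s t).filter fun q => (𝓇 q).inst = i).card := by
      simpa using Finset.sum_le_card_nsmul _ _ (1 : ℝ) fun r hr =>
        G.est_sub_rew_le_one (hin r (Finset.mem_filter.1 hr).1).1
          (hin r (Finset.mem_filter.1 hr).1).2
    set N := ((Finset.Icc s t).filter fun q => (𝓇 q).inst = i).card
    have hc1' : (N : ℝ) ≤ t' := by exact_mod_cast hc1
    have hc2' : (N : ℝ) ≤ 2 ^ i.2 := by exact_mod_cast hc2
    have hVi : Δ i.1 t ≤ V := totalVar_mono (supVar_nonneg f) hsi le_rfl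
    have hNV : (N : ℝ) * Δ i.1 t ≤ N * V := by gcongr
    have hNV0 : 0 ≤ (N : ℝ) * V := by positivity
    rw [← sub_le_iff_le_add']
    refine le_min ?_ (le_min ?_ ?_)
    · linarith
    · have : 119 * √(a * N) ≤ 119 * √(a * 2 ^ i.2) := by gcongr
      linarith
    · have : 119 * √(a * N) ≤ 119 * √(a * t') := by gcongr
      linarith
  -- The expected number 2p t'/2^k of instances, p = ρ(2^n)/ρ(2^k), contributes at most 2 t' ρ(2^n)
  -- ≤ 2 t' ρ(t'). The remaining 2p + 16ι instances cost 119/5000 of t' ρ(t') each; this is where K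
  -- has to be large compared with 16 · 119.
  have hI_le : ∀ k ∈ Finset.range (m + 1), ((I k).card : ℝ) * β k ≤ 6 * ι * (t' * ρ t') := by
    intro k hk
    have hkm : k ≤ m := by rw [Finset.mem_range] at hk; omega
    have hcoin := G.good.coins b (by omega) n hnT k (hkm.trans hm) s (by omega) (by omega) t ht
    have hN : (((Finset.Icc s t).filter fun x => b ≤ x ∧ 2 ^ k ∣ x - b).card : ℝ)
        ≤ t' / 2 ^ k + 1 := by
      have h1 := card_filter_dvd_le (b := b) (s := s) (t := t) (Nat.two_pow_pos k)
      have h2 : (((t - s) / 2 ^ k : ℕ) : ℝ) ≤ ((t - s : ℕ) : ℝ) / ((2 ^ k : ℕ) : ℝ) :=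
        Nat.cast_div_le
      have h3 : ((t - s : ℕ) : ℝ) ≤ t' := by exact_mod_cast (by omega)
      have h4 : ((t - s : ℕ) : ℝ) / ((2 ^ k : ℕ) : ℝ) ≤ t' / 2 ^ k := by
        push_cast; gcongr
      have h5 : (((Finset.Icc s t).filter fun x => b ≤ x ∧ 2 ^ k ∣ x - b).card : ℝ)
        ≤ (((t - s) / 2 ^ k : ℕ) : ℝ) + 1 := by exact_mod_cast h1
      linarith
    have hρk := G.rho_pos (Nat.one_le_two_pow (n := k))
    have hρn := G.rho_pos (Nat.one_le_two_pow (n := n))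
    set p := ρ (2 ^ n) / ρ (2 ^ k) with hp
    have hp0 : 0 ≤ p := by positivity
    have hp1 : p ≤ 1 := div_le_one_of_le₀ (G.rho_anti Nat.one_le_two_pow
      (Nat.pow_le_pow_right (by norm_num) (hkm.trans hm))) hρk.le
    have hβ1 : β k ≤ 2 ^ k * ρ (2 ^ k) := by
      have h1 := min_le_mul_masterRho (A := A) (T := T) (δ := δ) (by linarith [G.le_K] : 119 ≤ K)
        G.log_pos.le (Nat.one_le_two_pow (n := k))
      push_cast at h1
      exact (le_min (min_le_left _ _) ((min_le_right _ _).trans (min_le_left _ _))).trans h1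
    have hβ2 : 5000 * β k ≤ 119 * (t' * ρ t') := by
      have h1 := le_mul_masterRho hK0 G.log_pos.le ht'1 hρ
      have h2 : β k ≤ 119 * √(a * t') := (min_le_right _ _).trans (min_le_right _ _)
      have h3 := Real.sqrt_nonneg (a * t')
      nlinarith [G.le_K]
    have hρt : ρ (2 ^ n) ≤ ρ t' := G.rho_anti ht'1 (by omega)
    have h1 : p * (t' / 2 ^ k) * β k ≤ t' * ρ t' := by
      calc _ ≤ p * (t' / 2 ^ k) * (2 ^ k * ρ (2 ^ k)) := by gcongr
        _ = t' * ρ (2 ^ n) := by rw [hp]; field_simp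
        _ ≤ _ := by gcongr
    have h2 : p * β k ≤ β k := mul_le_of_le_one_left (hβ0 k) hp1
    have h3 : ((I k).card : ℝ) ≤ 2 * p * (t' / 2 ^ k + 1) + 16 * ι := by
      refine hcoin.trans ?_
      gcongr
    have h4 : ((I k).card : ℝ) * β k ≤ (2 * p * (t' / 2 ^ k + 1) + 16 * ι) * β k := by
      gcongr
    have h5 := G.log_gt
    have h6 : 0 ≤ t' * ρ t' := mul_nonneg ht'0.le (G.rho_pos ht'1).le
    have h7 : (2 * p * (t' / 2 ^ k + 1) + 16 * ι) * β k
        = 2 * (p * (t' / 2 ^ k) * β k) + 2 * (p * β k) + 16 * ι * β k := by ring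
    have h8 : ι * (5000 * β k) ≤ ι * (119 * (t' * ρ t')) :=
      mul_le_mul_of_nonneg_left hβ2 (by linarith)
    have h9 : 0.69 * (t' * ρ t') ≤ ι * (t' * ρ t') := mul_le_mul_of_nonneg_right h5.le h6
    nlinarith
  calc _ = ∑ i ∈ J, ∑ q ∈ (Finset.Icc s t).filter (fun q => (𝓇 q).inst = i),
        ((𝓇 q).est - R q) := by
        rw [Finset.sum_fiberwise_of_maps_to]
        exact fun q hq => Finset.mem_image_of_mem _ hq
    _ ≤ ∑ i ∈ J, (((Finset.Icc s t).filter fun q => (𝓇 q).inst = i).card * V + β i.2) :=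
        Finset.sum_le_sum hfib
    _ = t' * V + ∑ i ∈ J, β i.2 := by
        rw [Finset.sum_add_distrib, ← Finset.sum_mul, ← Nat.cast_sum,
          ← Finset.card_eq_sum_card_fiberwise (s := Finset.Icc s t) (t := J)
            (f := fun q => (𝓇 q).inst) fun q hq => Finset.mem_image_of_mem _ hq, hcard]
    _ ≤ t' * V + ∑ k ∈ Finset.range (m + 1), (I k).card * β k := by
        rw [add_le_add_iff_left, ← Finset.sum_fiberwise_of_maps_to fun i hi => (hJI i hi).1]
        refine Finset.sum_le_sum fun k _ => ?_
        rw [Finset.sum_congr rfl fun i hi => by rw [(Finset.mem_filter.1 hi).2], Finset.sum_const,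
          nsmul_eq_mul]
        refine mul_le_mul_of_nonneg_right (Nat.cast_le.2 ?_) (hβ0 k)
        refine Finset.card_le_card_of_injOn Prod.fst (fun i hi => ?_) fun i hi j hj hij => ?_
        · obtain ⟨h1, rfl⟩ := Finset.mem_filter.1 hi
          exact (hJI i h1).2
        · exact Prod.ext hij ((Finset.mem_filter.1 hi).2.trans (Finset.mem_filter.1 hj).2.symm)
    _ ≤ t' * V + ∑ k ∈ Finset.range (m + 1), 6 * ι * (t' * ρ t') := by
        rw [add_le_add_iff_left]
        exact Finset.sum_le_sum hI_le
    -- At most log₂ T + 1 orders contribute 6ι t' ρ(t') each, which is exactly the factor in ρ̂.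
    _ ≤ t' * (V + ρh t') := by
        rw [Finset.sum_const, Finset.card_range, nsmul_eq_mul, rhoHat, mul_add]
        have h1 : ((m + 1 : ℕ) : ℝ) ≤ Real.logb 2 T + 1 := by
          have : (m : ℝ) ≤ n := by exact_mod_cast hm
          push_cast
          linarith
        have h2 : 0 ≤ 6 * ι * (t' * ρ t') :=
          mul_nonneg (by linarith [G.log_pos]) (mul_nonneg ht'0.le (G.rho_pos ht'1).le)
        nlinarith [mul_le_mul_of_nonneg_right h1 h2]

end UCBRun

end Bandit

namespace Bandit

/-! ### When the tests fail, and when they must fail -/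

namespace UCBRun

variable {A T : ℕ} {δ K : ℝ} {tie : Finset (Fin A) → Fin A} {f : ℕ → Fin A → ℝ}
  {ξ : ℕ → ℕ → unitInterval} {R : ℕ → ℝ} (G : UCBRun A T δ K tie f ξ R)

local notation "ρ" => masterRho K A T δ
local notation "ρh" => rhoHat T δ (masterRho K A T δ)
local notation "ι" => Real.log (T / δ)
local notation "𝒮" => masterState (ucb1 A 17 T δ tie) (masterRho K A T δ)
  (rhoHat T δ (masterRho K A T δ)) ξ R
local notation "𝓇" => masterRound (ucb1 A 17 T δ tie) (masterRho K A T δ)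
  (rhoHat T δ (masterRho K A T δ)) ξ R
local notation "𝒳" => MasterRestarts (ucb1 A 17 T δ tie) (masterRho K A T δ)
  (rhoHat T δ (masterRho K A T δ)) ξ R
local notation "Δ" => totalVar (supVar f)

include G

theorem cellStart_order {t : ℕ} (ht1 : 1 ≤ t) :
    cellStart (𝒮 (t - 1)).start (𝒮 (t - 1)).order t = (𝒮 (t - 1)).start := by
  have h1 := (masterState_bounds (ucb1 A 17 T δ tie) ρ ρh ξ R (t - 1)).2.1
  have h2 := start_le (ucb1 A 17 T δ tie) ρ ρh ξ R ht1
  rw [cellStart, Nat.div_eq_of_lt (by omega)]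
  simp

theorem scheduled_order (t : ℕ) : Scheduled ρ ξ (𝒮 (t - 1)).order
    (cellStart (𝒮 (t - 1)).start (𝒮 (t - 1)).order t) (𝒮 (t - 1)).order :=
  scheduled_self ρ ξ (G.rho_pos Nat.one_le_two_pow).ne'

/-- Within a block, the estimates are optimistic up to the variation in the block. -/
theorem le_est_of_start_le {t q : ℕ} (ht1 : 1 ≤ t) (ht : t ≤ T)
    (hq : q ∈ Finset.Icc (𝒮 (t - 1)).start t) :
    optValue f q - Δ (𝒮 (t - 1)).start q ≤ (𝓇 q).est := by
  have h := G.inst_in_cell (q := q) ht1 le_rfl (G.scheduled_order t)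
    (by rwa [G.cellStart_order ht1])
  rw [G.cellStart_order ht1] at h
  have := one_le_start (ucb1 A 17 T δ tie) ρ ρh ξ R (t - 1)
  rw [Finset.mem_Icc] at hq
  exact G.le_est (by omega) (by omega) h.2

/-- A restart reveals some variation in the block. -/
theorem lt_totalVar_of_restarts {t : ℕ} (ht1 : 1 ≤ t) (ht : t ≤ T) (h : 𝒳 t) :
    ρ (t - (𝒮 (t - 1)).start + 1) < Δ (𝒮 (t - 1)).start t := by
  by_contra! hV
  have hst := start_le (ucb1 A 17 T δ tie) ρ ρh ξ R ht1
  have hsb := one_le_start (ucb1 A 17 T δ tie) ρ ρh ξ R (t - 1)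
  have ht'1 : 1 ≤ t - (𝒮 (t - 1)).start + 1 := by omega
  rcases (masterRestarts_iff _ _ _ _ _ ht1).1 h with ⟨m, hm, hte, hsch, q, hq, h1⟩ | h1
  · have hopt := G.le_est_of_start_le ht1 ht hq
    have hE := lt_cellStart_add m hst
    have hbs := le_cellStart (𝒮 (t - 1)).start m t
    have hs := cellStart_le m hst
    generalize (𝒮 (t - 1)).start = b at *
    generalize cellStart b m t = s at *
    have hq' := Finset.mem_Icc.1 hq
    have h2m : 2 ^ m = t - s + 1 := by omega
    have hcard : ((Finset.Icc s t).card : ℝ) = 2 ^ m := by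
      rw [Nat.card_Icc, show t + 1 - s = 2 ^ m by omega]; push_cast; rfl
    have hVq : Δ b q ≤ Δ b t := totalVar_mono (supVar_nonneg f) le_rfl hq'.2
    have hρ : ρ (t - b + 1) ≤ ρ (2 ^ m) := G.rho_anti Nat.one_le_two_pow (by omega)
    have h4 := G.four_mul_rho_le (Nat.one_le_two_pow (n := m))
    have hp : (0 : ℝ) < 2 ^ m := by positivity
    have hρ1 : ρ (2 ^ m) ≤ 1 := masterRho_le_one _
    have hρ0 := G.rho_pos (Nat.one_le_two_pow (n := m))
    rw [one_div, ← div_eq_inv_mul, le_div_iff₀ hp] at h1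
    -- Uncapped, the average reward over the cell exceeds the optimal value of round q by at most
    -- the variation plus ρ(2^m), far less than Test 1 asks for. Capped, 9 ρ̂ ≥ 36 is out of reach
    -- for rewards in [0, 1].
    rcases lt_or_ge (ρ (2 ^ m)) 1 with hlt | hge
    · have h5 := (abs_le.1 (G.good.rew s (by omega) (by omega) t ht)).2
      rw [hcard, Finset.sum_sub_distrib] at h5
      have h6 : ∑ τ ∈ Finset.Icc s t, f τ (𝓇 τ).pol ≤ 2 ^ m * (optValue f q + Δ b t) := by
        rw [← hcard, ← nsmul_eq_mul]
        refine Finset.sum_le_card_nsmul _ _ _ fun τ hτ => (le_optValue f τ _).trans ?_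
        have := optValue_sub_le_totalVar G.one_le_A f (q := τ) (s := b) (e := t)
          (Finset.mem_Icc.2 (by rw [Finset.mem_Icc] at hτ; omega)) hq
        linarith
      have h7 : 17 * √(ι * 2 ^ m) ≤ 2 ^ m * ρ (2 ^ m) := by
        have h8 := le_mul_masterRho (by linarith [G.le_K]) G.log_pos.le
          (Nat.one_le_two_pow (n := m)) hlt
        push_cast at h8
        refine le_trans ?_ h8
        have hA : (1 : ℝ) ≤ A := by exact_mod_cast G.one_le_A
        have h9 : ι ≤ A * ι := le_mul_of_one_le_left G.log_pos.le hA
        have h10 : (17 : ℝ) ≤ K := by linarith [G.le_K]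
        gcongr
      nlinarith
    · have h5 := (G.optValue_mem (t := q) (by omega) (by omega)).1
      have h6 : ∑ τ ∈ Finset.Icc s t, R τ ≤ 2 ^ m := by
        rw [← hcard]
        have := Finset.sum_le_card_nsmul (Finset.Icc s t) R (1 : ℝ) fun τ hτ =>
          (G.rew_mem τ (Finset.mem_Icc.2 (by rw [Finset.mem_Icc] at hτ; omega))).2
        simpa using this
      nlinarith
  -- The whole block is the cell of its always scheduled order-n instance, so the average in Test 2
  -- is at most ρ + ρ̂ < 3 ρ̂.
  · have h2 := G.sum_cell_le ht1 ht le_rfl (G.scheduled_order t)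
    rw [G.cellStart_order ht1] at h2
    have h3 := G.four_mul_rho_le ht'1
    have h4 := G.rho_pos ht'1
    have hp : (0 : ℝ) < ((t - (𝒮 (t - 1)).start + 1 : ℕ) : ℝ) := by exact_mod_cast ht'1
    rw [one_div, ← div_eq_inv_mul, le_div_iff₀ hp] at h1
    nlinarith

/-- An instance that is scheduled at a bad start causes a restart. -/
theorem restarts_of_badStart {b n m s : ℕ} (hs1 : 1 ≤ s)
    (hbad : BadStart (ucb1 A 17 T δ tie) ρ ρh f ξ R b n m s) (hm : m ≤ n)
    (hsch : Scheduled ρ ξ n s m) (he : s + 2 ^ m - 1 ≤ T)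
    (hstart : (𝒮 (s + 2 ^ m - 1 - 1)).start = b) (horder : (𝒮 (s + 2 ^ m - 1 - 1)).order = n) :
    𝒳 (s + 2 ^ m - 1) := by
  obtain ⟨⟨⟨hd, hV⟩, hsb⟩, -, q, hq, hest⟩ := hbad
  have h2 := Nat.one_le_two_pow (n := m)
  have he1 : 1 ≤ s + 2 ^ m - 1 := by omega
  have hbs : b ≤ s := by
    have := start_le (ucb1 A 17 T δ tie) ρ ρh ξ R hs1
    omega
  have hcell : cellStart b m (s + 2 ^ m - 1) = s := by
    have h := cellStart_eq_self hbs hd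
    exact (cellStart_eq_of_mem (tn := b) (m := m) (t := s) (by omega) (by omega)).trans h
  have h3 := fun q => G.inst_in_cell (t := s + 2 ^ m - 1) (m := m) (q := q) he1 (by omega)
    (by rw [hstart, horder, hcell]; exact hsch)
  have h4 := G.sum_cell_le (t := s + 2 ^ m - 1) (m := m) he1 he (by omega)
    (by rw [hstart, horder, hcell]; exact hsch)
  simp only [hstart, hcell] at h3
  rw [hstart, hcell] at h4
  refine (masterRestarts_iff _ _ _ _ _ he1).2 (Or.inl ⟨m, by omega, ?_, ?_, q, ?_, ?_⟩)
  · rw [hstart, hcell]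
  · rw [hstart, hcell, horder]; exact hsch
  · rw [hstart]
    rw [Finset.mem_Ico] at hq
    exact Finset.mem_Icc.2 ⟨hq.1, by omega⟩
  · rw [hstart, hcell]
    rw [show s + 2 ^ m - 1 - s + 1 = 2 ^ m by omega] at h4
    have hcard : ((Finset.Icc s (s + 2 ^ m - 1)).card : ℝ) = 2 ^ m := by
      rw [Nat.card_Icc, show s + 2 ^ m - 1 + 1 - s = 2 ^ m by omega]; push_cast; rfl
    -- One Δ is the loss of optimism, the other the drift of the optimal value since round s. With
    -- `h4` the average reward is at least f⋆(s) - 3Δ - ρ̂. As f⋆(s) exceeds the bad estimate by 13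
    -- ρ̂ and Δ ≤ ρ ≤ ρ̂/4, the 9 ρ̂ of Test 1 are surpassed.
    have h5 : 2 ^ m * (optValue f s - 2 * Δ s (s + 2 ^ m - 1))
        ≤ ∑ τ ∈ Finset.Icc s (s + 2 ^ m - 1), (𝓇 τ).est := by
      rw [← hcard, ← nsmul_eq_mul]
      refine Finset.card_nsmul_le_sum _ _ _ fun τ hτ => ?_
      have hτ' := Finset.mem_Icc.1 hτ
      have h6 := G.le_est (by omega) (by omega) (h3 τ hτ).2
      have h7 : Δ s τ ≤ Δ s (s + 2 ^ m - 1) := totalVar_mono (supVar_nonneg f) le_rfl hτ'.2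
      have h8 := optValue_sub_le_totalVar G.one_le_A f (q := s) (q' := τ)
        (Finset.mem_Icc.2 ⟨le_rfl, hτ'.1.trans hτ'.2⟩) hτ
      linarith
    rw [Finset.sum_sub_distrib] at h4
    push_cast at h4
    have h9 := G.four_mul_rho_le (Nat.one_le_two_pow (n := m))
    have h10 := G.rho_pos (Nat.one_le_two_pow (n := m))
    have hp : (0 : ℝ) < 2 ^ m := by positivity
    rw [one_div, ← div_eq_inv_mul, le_div_iff₀ hp]
    nlinarith

end UCBRun

/-! ## Counting cells with a large variation -/

section CellSums

theorem sum_range_sum_Ico (w : ℕ → ℝ) (b M J : ℕ) :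
    ∑ j ∈ Finset.range J, ∑ τ ∈ Finset.Ico (b + j * M) (b + (j + 1) * M), w τ
      = ∑ τ ∈ Finset.Ico b (b + J * M), w τ := by
  induction J with
  | zero => simp
  | succ J ih =>
    rw [Finset.sum_range_succ, ih, Finset.sum_Ico_consecutive]
    · exact Nat.le_add_right _ _
    · gcongr; omega

/-- Each pair splits into its first and its second cell. The first cells are disjoint, and so are
the second ones, hence the factor 2. -/
theorem card_mul_le_of_pair_sum {w : ℕ → ℝ} (hw : ∀ τ, 0 ≤ w τ) {b E M : ℕ} (hM : 0 < M)
    (hbE : b ≤ E) {θ : ℝ} {V : Finset ℕ} (hV : ∀ j ∈ V, (j + 2) * M ≤ E - b ∧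
      θ ≤ ∑ τ ∈ Finset.Ico (b + j * M) (b + (j + 2) * M), w τ) :
    V.card * θ ≤ 2 * ∑ τ ∈ Finset.Ico b E, w τ := by
  have h1 : ∀ c : ℕ, ∀ J : ℕ, b ≤ c → c + J * M ≤ E →
      ∑ j ∈ Finset.range J, ∑ τ ∈ Finset.Ico (c + j * M) (c + (j + 1) * M), w τ
        ≤ ∑ τ ∈ Finset.Ico b E, w τ := by
    intro c J hc hJ
    rw [sum_range_sum_Ico]
    exact Finset.sum_le_sum_of_subset_of_nonneg (Finset.Ico_subset_Ico hc hJ) fun _ _ _ => hw _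
  rcases Nat.lt_or_ge (E - b) (2 * M) with hlt | hge
  · have hVe : V = ∅ := by
      refine Finset.eq_empty_of_forall_notMem fun j hj => ?_
      have := (hV j hj).1
      nlinarith
    rw [hVe]
    simpa using Finset.sum_nonneg fun τ _ => hw τ
  set J := (E - b) / M - 1 with hJ
  have hJ1 : (J + 1) * M ≤ E - b := by
    have h2 : 2 ≤ (E - b) / M := (Nat.le_div_iff_mul_le hM).2 hge
    have h3 : J + 1 = (E - b) / M := by omega
    rw [h3]
    exact Nat.div_mul_le_self _ _
  have hVJ : V ⊆ Finset.range J := by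
    intro j hj
    have h2 := (Nat.le_div_iff_mul_le hM).2 (hV j hj).1
    rw [Finset.mem_range]
    omega
  have h2 := h1 b J le_rfl (by rw [add_mul] at hJ1; omega)
  have h3 := h1 (b + M) J (by omega) (by rw [add_mul] at hJ1; omega)
  calc V.card * θ ≤ ∑ j ∈ V, ∑ τ ∈ Finset.Ico (b + j * M) (b + (j + 2) * M), w τ := by
        rw [← nsmul_eq_mul]
        exact Finset.card_nsmul_le_sum _ _ _ fun j hj => (hV j hj).2
    _ ≤ ∑ j ∈ Finset.range J, ∑ τ ∈ Finset.Ico (b + j * M) (b + (j + 2) * M), w τ :=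
        Finset.sum_le_sum_of_subset_of_nonneg hVJ fun _ _ _ => Finset.sum_nonneg fun _ _ => hw _
    _ = ∑ j ∈ Finset.range J, (∑ τ ∈ Finset.Ico (b + j * M) (b + (j + 1) * M), w τ +
          ∑ τ ∈ Finset.Ico (b + M + j * M) (b + M + (j + 1) * M), w τ) := by
        refine Finset.sum_congr rfl fun j _ => ?_
        rw [← Finset.sum_Ico_consecutive w (m := b + j * M) (n := b + (j + 1) * M)
          (k := b + (j + 2) * M) (by gcongr; omega) (by gcongr; omega)]
        congr 2
        congr 1 <;> ring
    _ ≤ _ := by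
        rw [Finset.sum_add_distrib]
        linarith

theorem card_mul_le_of_pair {b E M : ℕ} (hM : 0 < M) {V : Finset ℕ}
    (hV : ∀ j ∈ V, (j + 2) * M ≤ E - b) : V.card * M ≤ E - b := by
  have h1 : V ⊆ Finset.range ((E - b) / M) := by
    intro j hj
    have := (Nat.le_div_iff_mul_le hM).2 (hV j hj)
    rw [Finset.mem_range]
    omega
  have h2 := Finset.card_le_card h1
  rw [Finset.card_range] at h2
  exact (Nat.mul_le_mul_right M h2).trans (Nat.div_mul_le_self _ _)

/-- In the induction either y < g(n+1), or the indicator at n is 1 and the old remainder g(n)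
becomes a summand. This splits the gap of a round into scales. -/
theorem le_dyadic_sum (g : ℕ → ℝ) (hg : ∀ m, 0 ≤ g m) {y : ℝ} (hy : y < g 0) (n : ℕ) :
    y ≤ g n + ∑ m ∈ Finset.range n, g m * (if g (m + 1) ≤ y then 1 else 0) := by
  induction n with
  | zero => simpa using hy.le
  | succ n ih =>
    rw [Finset.sum_range_succ]
    by_cases h : g (n + 1) ≤ y
    · rw [if_pos h]
      linarith [hg (n + 1)]
    · have : 0 ≤ ∑ m ∈ Finset.range n, g m * (if g (m + 1) ≤ y then 1 else 0) :=
        Finset.sum_nonneg fun m _ => mul_nonneg (hg m) (by split_ifs <;> norm_num)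
      rw [if_neg h]
      linarith

end CellSums

end Bandit

namespace Bandit

/-! ## Regret of a block -/

open Classical in
/-- The pairs of consecutive order-`m` cells of the rounds `b, …, E` whose variation exceeds `ρ(2^m)`. -/
noncomputable def varPairs (ρ D : ℕ → ℝ) (b E m : ℕ) : Finset ℕ :=
  (Finset.range (E - b)).filter fun j => (j + 2) * 2 ^ m ≤ E - b ∧
    ρ (2 ^ m) < totalVar D (b + j * 2 ^ m) (b + (j + 2) * 2 ^ m)

open Classical in
/-- The number of pairs of cells with a large variation, in the orders where `ρ(2^m) < 1`. -/
noncomputable def varCount (ρ D : ℕ → ℝ) (b E m : ℕ) : ℕ :=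
  if ρ (2 ^ m) < 1 then (varPairs ρ D b E m).card else 0

namespace UCBRun

variable {A T : ℕ} {δ K : ℝ} {tie : Finset (Fin A) → Fin A} {f : ℕ → Fin A → ℝ}
  {ξ : ℕ → ℕ → unitInterval} {R : ℕ → ℝ} (G : UCBRun A T δ K tie f ξ R)

local notation "ρ" => masterRho K A T δ
local notation "ρh" => rhoHat T δ (masterRho K A T δ)
local notation "ι" => Real.log (T / δ)
local notation "𝒮" => masterState (ucb1 A 17 T δ tie) (masterRho K A T δ)
  (rhoHat T δ (masterRho K A T δ)) ξ R
local notation "𝓇" => masterRound (ucb1 A 17 T δ tie) (masterRho K A T δ)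
  (rhoHat T δ (masterRho K A T δ)) ξ R
local notation "𝒳" => MasterRestarts (ucb1 A 17 T δ tie) (masterRho K A T δ)
  (rhoHat T δ (masterRho K A T δ)) ξ R
local notation "Δ" => totalVar (supVar f)

include G

open Classical in
-- By `restarts_of_badStart`, a scheduled bad start would have ended the block before round E. The
-- cutoff E - 2^m keeps precisely the cells that end by round E - 1, so that their Test 1 was
-- evaluated and passed.
theorem card_badStart_le {E b n m : ℕ} (hE1 : 1 ≤ E) (hE : E ≤ T)
    (hb : (𝒮 (E - 1)).start = b) (hn : (𝒮 (E - 1)).order = n) (hm : m ≤ n) :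
    ρ (2 ^ n) / ρ (2 ^ m) * ((Finset.Icc 1 (E - 2 ^ m)).filter fun s =>
      BadStart (ucb1 A 17 T δ tie) ρ ρh f ξ R b n m s).card ≤ 32 * ι := by
  have hbE := start_le (ucb1 A 17 T δ tie) ρ ρh ξ R hE1
  refine G.good.bad b (by omega) n ?_ m hm (E - 2 ^ m)
    ((Nat.sub_le _ _).trans hE) fun s hs hbad hsch => ?_
  · rw [← hn]; exact (G.order_bound hE1 hE).2
  have hp := Nat.one_le_two_pow (n := m)
  rw [Finset.mem_Icc] at hs
  have hbs : b ≤ s := by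
    have := start_le (ucb1 A 17 T δ tie) ρ ρh ξ R hs.1
    rwa [hbad.1.2] at this
  have hst := G.state_eq (t := E) (q := s + 2 ^ m - 1) (by omega) (by omega)
  have h := G.restarts_of_badStart hs.1 hbad hm hsch (by omega) (by rw [hst.1, hb])
    (by rw [hst.2, hn])
  exact not_restarts _ _ _ _ _ (t := E - 1) (by omega) (by omega) h

open Classical in
/-- The number of rounds of a block with a large gap between the optimal value and its estimate. -/
theorem card_gap_le {E b n m : ℕ} (hE1 : 1 ≤ E)
    (hb : (𝒮 (E - 1)).start = b) (hn : (𝒮 (E - 1)).order = n) :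
    ((Finset.Icc b E).filter fun τ => 14 * ρh (2 ^ m) ≤ optValue f τ - (𝓇 τ).est).card ≤
      2 ^ m * (2 + (varPairs ρ (supVar f) b E m).card +
        ((Finset.Icc 1 (E - 2 ^ m)).filter fun s =>
          BadStart (ucb1 A 17 T δ tie) ρ ρh f ξ R b n m s).card) := by
  have hbE := start_le (ucb1 A 17 T δ tie) ρ ρh ξ R hE1
  have hb1 := one_le_start (ucb1 A 17 T δ tie) ρ ρh ξ R (E - 1)
  rw [hb] at hbE hb1
  have hp := Nat.one_le_two_pow (n := m)
  set S := (Finset.Icc b E).filter fun τ => 14 * ρh (2 ^ m) ≤ optValue f τ - (𝓇 τ).est with hS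
  set B := (Finset.Icc 1 (E - 2 ^ m)).filter fun s =>
          BadStart (ucb1 A 17 T δ tie) ρ ρh f ξ R b n m s with hB
  have hcell : ∀ τ ∈ S, b + (τ - b) / 2 ^ m * 2 ^ m ≤ τ ∧ τ < b + ((τ - b) / 2 ^ m + 1) * 2 ^ m := by
    intro τ hτ
    have h1 := Finset.mem_Icc.1 (Finset.mem_filter.1 hτ).1
    have h2 := Nat.div_mul_le_self (τ - b) (2 ^ m)
    have h3 := Nat.lt_div_mul_add (a := τ - b) (b := 2 ^ m) (by omega)
    rw [add_mul, one_mul]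
    omega
  have h1 : S.card ≤ 2 ^ m * (S.image fun τ => (τ - b) / 2 ^ m).card := by
    refine Finset.card_le_mul_card_image _ _ fun j _ => ?_
    calc _ ≤ (Finset.Ico (b + j * 2 ^ m) (b + (j + 1) * 2 ^ m)).card := by
          refine Finset.card_le_card fun τ hτ => ?_
          obtain ⟨h2, rfl⟩ := Finset.mem_filter.1 hτ
          exact Finset.mem_Ico.2 (hcell τ h2)
      _ = 2 ^ m := by rw [Nat.card_Ico, add_mul]; omega
  refine h1.trans (Nat.mul_le_mul_left _ ?_)
  have h2 : S.image (fun τ => (τ - b) / 2 ^ m) ⊆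
      -- The cell of a round with a large gap is one of the last two, or forms a varying pair with
      -- its successor, or is followed by a cell that begins at a bad start.
      Finset.Icc ((E - b) / 2 ^ m - 1) ((E - b) / 2 ^ m) ∪ varPairs ρ (supVar f) b E m ∪
        B.image fun s => (s - b) / 2 ^ m - 1 := by
    intro j hj
    obtain ⟨τ, hτ, rfl⟩ := Finset.mem_image.1 hj
    have hτ' := hcell τ hτ
    obtain ⟨h3, h4⟩ := Finset.mem_filter.1 hτ
    rw [Finset.mem_Icc] at h3
    have hle : (τ - b) / 2 ^ m ≤ (E - b) / 2 ^ m := Nat.div_le_div_right (by omega)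
    generalize (τ - b) / 2 ^ m = j at *
    by_cases h5 : (j + 2) * 2 ^ m ≤ E - b
    swap
    · have : (E - b) / 2 ^ m < j + 2 := (Nat.div_lt_iff_lt_mul (by omega)).2 (by omega)
      exact Finset.mem_union_left _ (Finset.mem_union_left _ (Finset.mem_Icc.2 ⟨by omega, hle⟩))
    have h6 : (j + 2) * 2 ^ m = j * 2 ^ m + 2 ^ m + 2 ^ m := by ring
    have h6' : (j + 1) * 2 ^ m = j * 2 ^ m + 2 ^ m := by ring
    by_cases h7 : ρ (2 ^ m) < Δ (b + j * 2 ^ m) (b + (j + 2) * 2 ^ m)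
    · refine Finset.mem_union_left _ (Finset.mem_union_right _ (Finset.mem_filter.2 ⟨?_, h5, h7⟩))
      rw [Finset.mem_range]
      nlinarith
    push Not at h7
    refine Finset.mem_union_right _ (Finset.mem_image.2 ⟨b + (j + 1) * 2 ^ m, ?_, ?_⟩)
    · have hst := G.state_eq (t := E) (q := b + (j + 1) * 2 ^ m) (by omega) (by omega)
      refine Finset.mem_filter.2 ⟨Finset.mem_Icc.2 ⟨by omega, by omega⟩, ⟨⟨?_, ?_⟩, ?_⟩, ?_, τ,
        Finset.mem_Ico.2 ⟨h3.1, hτ'.2⟩, ?_⟩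
      · rw [Nat.add_sub_cancel_left]; exact Nat.dvd_mul_left _ _
      · exact (totalVar_mono (supVar_nonneg f) (by omega) (by omega)).trans h7
      · rw [hst.1, hb]
      · rw [hst.2, hn]
      -- The round τ itself witnesses the too small estimate. Passing from f⋆(τ) to f⋆ at the start
      -- of the next cell costs at most ρ(2^m), covered by the difference between 14 ρ̂ and 13 ρ̂.
      · have h8 := optValue_sub_le_totalVar G.one_le_A f (q := τ) (q' := b + (j + 1) * 2 ^ m)
          (s := b + j * 2 ^ m) (e := b + (j + 2) * 2 ^ m) (Finset.mem_Icc.2 (by omega))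
          (Finset.mem_Icc.2 (by omega))
        have h9 := G.four_mul_rho_le (Nat.one_le_two_pow (n := m))
        have h10 := G.rho_pos (Nat.one_le_two_pow (n := m))
        linarith
    · rw [Nat.add_sub_cancel_left, Nat.mul_div_cancel _ (by omega), Nat.add_sub_cancel]
  refine (Finset.card_le_card h2).trans ((Finset.card_union_le _ _).trans ?_)
  refine Nat.add_le_add ((Finset.card_union_le _ _).trans (Nat.add_le_add_right ?_ _))
    Finset.card_image_le
  rw [Nat.card_Icc]
  omega

/-- The regret against the estimates within a block. -/
theorem sum_est_sub_le {E b n : ℕ} (hE1 : 1 ≤ E) (hE : E ≤ T)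
    (hb : (𝒮 (E - 1)).start = b) (hn : (𝒮 (E - 1)).order = n) :
    ∑ τ ∈ Finset.Icc b E, ((𝓇 τ).est - R τ) ≤ 1 + 3 * (2 ^ n * ρh (2 ^ n)) := by
  have hbE := start_le (ucb1 A 17 T δ tie) ρ ρh ξ R hE1
  have hend := (masterState_bounds (ucb1 A 17 T δ tie) ρ ρh ξ R (E - 1)).2.1
  have hb1 := one_le_start (ucb1 A 17 T δ tie) ρ ρh ξ R (E - 1)
  have hn0 := G.rhoHat_pos (Nat.one_le_two_pow (n := n))
  rw [hb] at hbE hend hb1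
  rw [hn] at hend
  have h1 := G.est_sub_rew_le_one hE1 hE
  -- Test 2 may fail in the last round E itself. It is therefore used in round E - 1, and round E is
  -- charged with 1.
  rcases hbE.eq_or_lt with rfl | hlt
  · have : 0 ≤ 2 ^ n * ρh (2 ^ n) := by positivity
    simp only [Finset.Icc_self, Finset.sum_singleton]
    linarith
  obtain ⟨E, rfl⟩ : ∃ E', E = E' + 1 := ⟨E - 1, by omega⟩
  rw [Nat.add_sub_cancel] at hb hn hend
  have hst := G.state_eq (t := E + 1) (q := E) (by rw [Nat.add_sub_cancel]; omega) (by omega)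
  rw [Nat.add_sub_cancel, hb] at hst
  have h2 : ¬ 𝒳 E := not_restarts _ _ _ _ _ (t := E) (by omega) le_rfl
  rw [masterRestarts_iff _ _ _ _ _ (by omega), not_or] at h2
  have h3 := h2.2
  have hlen : 1 ≤ E - b + 1 := by omega
  have hp : (0 : ℝ) < ((E - b + 1 : ℕ) : ℝ) := by exact_mod_cast hlen
  rw [hst.1, not_le, one_div, ← div_eq_inv_mul, div_lt_iff₀ hp] at h3
  rw [← Finset.insert_Icc_right_eq_Icc_add_one (by omega), Finset.sum_insert (by simp)]
  have h4 := mul_masterRho_mono (A := A) (K := K) (by linarith [G.le_K]) G.log_pos.le hlen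
    (by omega : E - b + 1 ≤ 2 ^ n)
  have h5 : ρh (E - b + 1) * ((E - b + 1 : ℕ) : ℝ) ≤ 2 ^ n * ρh (2 ^ n) := by
    push_cast at h4 ⊢
    rw [rhoHat, rhoHat]
    have h6 : 0 ≤ 6 * (Real.logb 2 T + 1) * ι :=
      mul_nonneg (by linarith [G.logb_nonneg]) G.log_pos.le
    nlinarith [mul_le_mul_of_nonneg_left h4 h6]
  linarith

theorem one_le_const : 1 ≤ Real.logb 2 T + 1 := by linarith [G.logb_nonneg]

theorem sqrt_ge (n : ℕ) : 0.8 ≤ √(A * ι * 2 ^ n) := by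
  refine Real.le_sqrt_of_sq_le ?_
  have h1 : (1 : ℝ) ≤ A := by exact_mod_cast G.one_le_A
  have h2 : (1 : ℝ) ≤ 2 ^ n := one_le_pow₀ (by norm_num)
  have h3 := G.log_gt
  have h4 : ι * 1 ≤ ι * (A * 2 ^ n) :=
    mul_le_mul_of_nonneg_left (by nlinarith) G.log_pos.le
  nlinarith

theorem pow_mul_rho_le (m : ℕ) : 2 ^ m * ρ (2 ^ m) ≤ 2 * K * √(A * ι * 2 ^ m) := by
  have := mul_masterRho_le (A := A) (K := K) (by linarith [G.le_K]) G.log_pos.le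
    (Nat.one_le_two_pow (n := m))
  exact_mod_cast this

theorem sqrt_mono {m n : ℕ} (h : m ≤ n) : √(A * ι * 2 ^ m) ≤ √(A * ι * 2 ^ n) := by
  have := G.log_pos
  gcongr
  norm_num

/-- In `card_gap_le` at order m + 1, the bad starts cost about ι ρ(2^(m+1))/ρ(2^n) cells of length
2^(m+1), with a gap of about ρ̂(2^m) in each round. The powers of 2^m cancel, so every scale
contributes the same multiple of √(Aι2^n). -/
theorem sum_gap_le {E b n m : ℕ} (hE1 : 1 ≤ E) (hE : E ≤ T)
    (hb : (𝒮 (E - 1)).start = b) (hn : (𝒮 (E - 1)).order = n) (hm : m < n)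
    (hρ : ρ (2 ^ n) < 1) :
    ∑ τ ∈ Finset.Icc b E, 14 * ρh (2 ^ m) *
        (if 14 * ρh (2 ^ (m + 1)) ≤ optValue f τ - (𝓇 τ).est then 1 else 0) ≤
      6 * (Real.logb 2 T + 1) * ι * K * (3750 * ι * √(A * ι * 2 ^ n) +
        56 * (√(A * ι * 2 ^ (m + 1)) * varCount ρ (supVar f) b E (m + 1))) := by
  classical
  have hι := G.log_gt
  have hN := G.one_le_const
  have hK := G.le_K
  have hb1 := one_le_start (ucb1 A 17 T δ tie) ρ ρh ξ R (E - 1)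
  rw [hb] at hb1
  set N := Real.logb 2 T + 1 with hNdef
  set H := 6 * N * ι with hH
  have hH0 : 0 < H := by positivity
  have hρh : ∀ t, ρh t = H * ρ t := fun t => rfl
  rw [← Finset.mul_sum, Finset.sum_boole]
  set sn := √(A * ι * 2 ^ n) with hsn
  set sm := √(A * ι * 2 ^ (m + 1)) with hsm
  have hsn0 : 0.8 ≤ sn := G.sqrt_ge n
  have hsm0 : 0.8 ≤ sm := G.sqrt_ge (m + 1)
  have hsmn : sm ≤ sn := G.sqrt_mono hm
  rcases le_or_gt 1 (ρ (2 ^ (m + 1))) with h1 | h1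
  -- With a capped rate the threshold is at least 56, larger than any gap.
  · have : (Finset.Icc b E).filter
        (fun τ => 14 * ρh (2 ^ (m + 1)) ≤ optValue f τ - (𝓇 τ).est) = ∅ := by
      refine Finset.filter_eq_empty_iff.2 fun τ hτ => ?_
      rw [Finset.mem_Icc] at hτ
      have h2 := (G.optValue_mem (t := τ) (by omega) (by omega)).2
      have h3 := G.est_nonneg (t := τ) (by omega) (by omega)
      have h4 := G.four_mul_rho_le (Nat.one_le_two_pow (n := m + 1))
      linarith
    rw [this]
    simp only [Finset.card_empty, Nat.cast_zero, mul_zero]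
    positivity
  rw [varCount, if_pos h1]
  have h2 := G.card_gap_le (m := m + 1) hE1 hb hn
  have h3 := G.card_badStart_le hE1 hE hb hn hm
  set B := ((Finset.Icc 1 (E - 2 ^ (m + 1))).filter fun s =>
      BadStart (ucb1 A 17 T δ tie) ρ ρh f ξ R b n (m + 1) s).card with hB
  set V := (varPairs ρ (supVar f) b E (m + 1)).card with hV
  have h2' : (((Finset.Icc b E).filter
      fun τ => 14 * ρh (2 ^ (m + 1)) ≤ optValue f τ - (𝓇 τ).est).card : ℝ) ≤
      2 ^ (m + 1) * (2 + V + B) := by exact_mod_cast h2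
  have hρm := G.rho_pos (Nat.one_le_two_pow (n := m))
  have hρm1 := G.rho_pos (Nat.one_le_two_pow (n := m + 1))
  have hρn := G.rho_pos (Nat.one_le_two_pow (n := n))
  set C := 2 ^ (m + 1) * ρ (2 ^ (m + 1)) with hC
  have hC0 : 0 < C := by positivity
  have hCle : C ≤ 2 * K * sm := G.pow_mul_rho_le (m + 1)
  have hCm : 2 ^ m * ρ (2 ^ m) ≤ C := by
    have := mul_masterRho_mono (A := A) (K := K) (δ := δ) (T := T) (by linarith [G.le_K])
      G.log_pos.le (Nat.one_le_two_pow (n := m))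
      (Nat.pow_le_pow_right (by norm_num) (Nat.le_succ m))
    push_cast at this
    exact this
  have hsmsq : sm ^ 2 = A * ι * 2 ^ (m + 1) := Real.sq_sqrt (by positivity)
  have hsnsq : sn ^ 2 = A * ι * 2 ^ n := Real.sq_sqrt (by positivity)
  have hCn : K * sn ≤ 2 ^ n * ρ (2 ^ n) := by
    have := le_mul_masterRho (by linarith [G.le_K]) G.log_pos.le
      (Nat.one_le_two_pow (n := n)) hρ
    push_cast at this
    exact this
  -- C² is at most 4K² Aι 2^(m+1), while 2^n ρ(2^n) is at least K √(Aι2^n); the factor 2^(m+1) drops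
  -- out.
  have hbad : C * B ≤ 128 * ι * K * sn := by
    have h4 : ρ (2 ^ n) * B ≤ 32 * ι * ρ (2 ^ (m + 1)) := by
      rwa [div_mul_eq_mul_div, div_le_iff₀ hρm1] at h3
    have h5 : C ^ 2 ≤ (2 * K * sm) ^ 2 := by gcongr
    have h6 : (K * sn) * (2 ^ (m + 1) * (C * B)) ≤ (K * sn) * (2 ^ (m + 1) * (128 * ι * K * sn)) :=
      calc (K * sn) * (2 ^ (m + 1) * (C * B))
          ≤ (2 ^ n * ρ (2 ^ n)) * (2 ^ (m + 1) * (C * B)) := by gcongr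
        _ = 2 ^ n * (2 ^ (m + 1) * C) * (ρ (2 ^ n) * B) := by ring
        _ ≤ 2 ^ n * (2 ^ (m + 1) * C) * (32 * ι * ρ (2 ^ (m + 1))) := by gcongr
        _ = 32 * ι * 2 ^ n * C ^ 2 := by rw [hC]; ring
        _ ≤ 32 * ι * 2 ^ n * (2 * K * sm) ^ 2 := by gcongr
        _ = 128 * ι * K ^ 2 * 2 ^ (m + 1) * (A * ι * 2 ^ n) := by rw [mul_pow, hsmsq]; ring
        _ = _ := by rw [← hsnsq]; ring
    have h7 : 0 < K * sn := by positivity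
    exact le_of_mul_le_mul_left (le_of_mul_le_mul_left h6 h7) (by positivity)
  calc 14 * ρh (2 ^ m) * _ ≤ 14 * ρh (2 ^ m) * (2 ^ (m + 1) * (2 + V + B)) := by
        have := (G.rhoHat_pos (Nat.one_le_two_pow (n := m))).le
        gcongr
    _ = 28 * H * (2 ^ m * ρ (2 ^ m)) * (2 + V + B) := by rw [hρh]; ring
    _ ≤ 28 * H * C * (2 + V + B) := by gcongr
    _ = 28 * H * (C * (2 + V) + C * B) := by ring
    _ ≤ 28 * H * (2 * K * sm * (2 + V) + 128 * ι * K * sn) := by gcongr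
    _ = H * K * (112 * sm + 3584 * ι * sn + 56 * (sm * V)) := by ring
    _ ≤ _ := by
        gcongr
        nlinarith

set_option maxHeartbeats 800000 in
/-- The regret of a block. -/
theorem block_regret {E b n : ℕ} (hE1 : 1 ≤ E) (hE : E ≤ T)
    (hb : (𝒮 (E - 1)).start = b) (hn : (𝒮 (E - 1)).order = n) :
    ∑ τ ∈ Finset.Icc b E, (optValue f τ - R τ) ≤
      6 * (Real.logb 2 T + 1) * ι * K * (3850 * (Real.logb 2 T + 1) * ι * √(A * ι * 2 ^ n) +
        56 * ∑ m ∈ Finset.range n,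
          √(A * ι * 2 ^ (m + 1)) * varCount ρ (supVar f) b E (m + 1)) := by
  have hι := G.log_gt
  have hN := G.one_le_const
  have hK := G.le_K
  have hb1 := one_le_start (ucb1 A 17 T δ tie) ρ ρh ξ R (E - 1)
  have hbE := start_le (ucb1 A 17 T δ tie) ρ ρh ξ R hE1
  have hend := (masterState_bounds (ucb1 A 17 T δ tie) ρ ρh ξ R (E - 1)).2.1
  have hnN := G.order_add_one_le hE1 hE
  rw [hb] at hb1 hbE hend
  rw [hn] at hnN hend
  have hlen : ((Finset.Icc b E).card : ℝ) ≤ 2 ^ n := by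
    rw [Nat.card_Icc]
    exact_mod_cast (by omega : E + 1 - b ≤ 2 ^ n)
  set N := Real.logb 2 T + 1 with hNdef
  set H := 6 * N * ι with hH
  have hH0 : 4 ≤ H := by nlinarith
  set sn := √(A * ι * 2 ^ n) with hsn
  have hsn0 : 0.8 ≤ sn := G.sqrt_ge n
  have hρn := G.rho_pos (Nat.one_le_two_pow (n := n))
  have hρle := G.pow_mul_rho_le n
  have hNι : 0.69 ≤ N * ι := by nlinarith
  set W := ∑ m ∈ Finset.range n,
          √(A * ι * 2 ^ (m + 1)) * (varCount ρ (supVar f) b E (m + 1) : ℝ) with hW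
  have hW0 : 0 ≤ W := Finset.sum_nonneg fun _ _ => by positivity
  have hin : ∀ q ∈ Finset.Icc b E, 1 ≤ q ∧ q ≤ T := fun q hq => by
    rw [Finset.mem_Icc] at hq; omega
  -- If the rate is capped even at the block length, the trivial regret 2^n = 2^n ρ(2^n) is already
  -- of order K √(Aι2^n).
  rcases le_or_gt 1 (ρ (2 ^ n)) with h1 | hρ
  · calc ∑ τ ∈ Finset.Icc b E, (optValue f τ - R τ) ≤ (Finset.Icc b E).card * 1 := by
          rw [← nsmul_eq_mul]
          refine Finset.sum_le_card_nsmul _ _ _ fun τ hτ => ?_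
          have h2 := (G.optValue_mem (hin τ hτ).1 (hin τ hτ).2).2
          have h3 := (G.rew_mem τ (Finset.mem_Icc.2 (hin τ hτ))).1
          linarith
      _ ≤ 2 ^ n * ρ (2 ^ n) := by gcongr
      _ ≤ 2 * K * sn := hρle
      _ = 1 * K * (2 * sn + 56 * 0) := by ring
      _ ≤ _ := by
          gcongr
          · linarith
          · nlinarith
  have h2 := G.sum_est_sub_le hE1 hE hb hn
  have hρh : ∀ t, ρh t = H * ρ t := fun t => rfl
  -- At order 0 the threshold 14 ρ̂ is at least 56, above every gap, so the dyadic decomposition can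
  -- start there.
  have hρ0 : ρ (2 ^ 0) = 1 := by
    rw [pow_zero]
    refine le_antisymm (masterRho_le_one _) (not_lt.1 fun h => ?_)
    have h3 := le_mul_masterRho (by linarith [G.le_K]) G.log_pos.le le_rfl h
    have h4 := G.sqrt_ge 0
    rw [pow_zero] at h4
    push_cast at h3
    nlinarith
  have h3 : ∀ τ ∈ Finset.Icc b E, optValue f τ - (𝓇 τ).est ≤ 14 * ρh (2 ^ n) +
      ∑ m ∈ Finset.range n, 14 * ρh (2 ^ m) *
        (if 14 * ρh (2 ^ (m + 1)) ≤ optValue f τ - (𝓇 τ).est then 1 else 0) := by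
    intro τ hτ
    refine le_dyadic_sum (fun m => 14 * ρh (2 ^ m)) (fun m => ?_) ?_ n
    · have := G.rhoHat_pos (Nat.one_le_two_pow (n := m)); linarith
    · have h2 := (G.optValue_mem (hin τ hτ).1 (hin τ hτ).2).2
      have h3 := G.est_nonneg (hin τ hτ).1 (hin τ hτ).2
      simp only [hρh, hρ0]
      linarith
  have h4 : ∑ τ ∈ Finset.Icc b E, (optValue f τ - (𝓇 τ).est) ≤ 2 ^ n * (14 * ρh (2 ^ n)) +
      ∑ m ∈ Finset.range n, H * K * (3750 * ι * sn +
        56 * (√(A * ι * 2 ^ (m + 1)) * varCount ρ (supVar f) b E (m + 1))) := by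
    refine (Finset.sum_le_sum h3).trans ?_
    rw [Finset.sum_add_distrib, Finset.sum_const, nsmul_eq_mul, Finset.sum_comm]
    refine add_le_add ?_ (Finset.sum_le_sum fun m hm =>
      G.sum_gap_le hE1 hE hb hn (Finset.mem_range.1 hm) hρ)
    have := (G.rhoHat_pos (Nat.one_le_two_pow (n := n))).le
    gcongr
  rw [← Finset.mul_sum, Finset.sum_add_distrib, Finset.sum_const, Finset.card_range,
    nsmul_eq_mul, ← Finset.mul_sum, ← hW] at h4
  have h5 : ∑ τ ∈ Finset.Icc b E, (optValue f τ - R τ) =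
      ∑ τ ∈ Finset.Icc b E, (optValue f τ - (𝓇 τ).est) +
        ∑ τ ∈ Finset.Icc b E, ((𝓇 τ).est - R τ) := by
    rw [← Finset.sum_add_distrib]
    exact Finset.sum_congr rfl fun _ _ => by ring
  have h6 : 2 ^ n * ρh (2 ^ n) ≤ H * (2 * K * sn) := by
    rw [hρh, mul_left_comm]
    gcongr
  have h7 : 1 ≤ H * K * sn := by
    have : 1 ≤ K * sn := by nlinarith
    nlinarith
  have h8 : H * K * (n * (3750 * ι * sn)) ≤ H * K * (3750 * N * ι * sn - 3750 * ι * sn) := by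
    have : (n : ℝ) * (3750 * ι * sn) ≤ (N - 1) * (3750 * ι * sn) := by
      gcongr
      linarith
    have h9 : 0 ≤ H * K := by positivity
    refine (mul_le_mul_of_nonneg_left this h9).trans (le_of_eq ?_)
    ring
  -- 35 = 28 + 6 + 1: the smallest scale, the bound from Test 2, and the last round.
  have h9 : H * K * sn * 35 ≤ H * K * sn * (100 * (N * ι)) := by
    gcongr
    nlinarith
  have h10 : 0 ≤ H * K * (3750 * ι * sn) := by positivity
  rw [h5]
  calc _ ≤ H * K * sn * 35 + H * K * (n * (3750 * ι * sn)) + H * K * (56 * W) := by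
        linarith
    _ ≤ _ := by linarith

end UCBRun

end Bandit

namespace Bandit

/-! ## The number and the lengths of the blocks -/

section Blocks

variable {Pol : Type*} (alg : BaseAlg Pol) (ρ ρhat : ℕ → ℝ) (ξ : ℕ → ℕ → unitInterval) (R : ℕ → ℝ)

local notation "𝒮" => masterState alg ρ ρhat ξ R
local notation "𝒳" => MasterRestarts alg ρ ρhat ξ R

/-- The first rounds of the blocks. -/
noncomputable def blockStarts (T : ℕ) : Finset ℕ :=
  (Finset.Icc 1 T).filter fun b => (masterState alg ρ ρhat ξ R (b - 1)).start = b

open Classical in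
/-- The rounds before `T` after which MASTER restarts. -/
noncomputable def restartRounds (T : ℕ) : Finset ℕ :=
  (Finset.Ico 1 T).filter fun t => MasterRestarts alg ρ ρhat ξ R t

/-- The length of a new block is charged to the progress of the start: twice the completed length
after a doubling, and 1 after a restart. So even a block cut off by the horizon is paid for by its
predecessor. -/
theorem sum_blockStarts_le (t : ℕ) :
    ∑ b ∈ blockStarts alg ρ ρhat ξ R (t + 1), 2 ^ (𝒮 (b - 1)).order + 1 ≤ 2 * (𝒮 t).start := by
  induction t with
  | zero => simp [blockStarts, masterState, Finset.filter_singleton]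
  | succ t ih =>
    rw [blockStarts, Finset.sum_filter] at ih ⊢
    rw [Finset.sum_Icc_succ_top (by omega), Nat.add_sub_cancel]
    have hb := (masterState_bounds alg ρ ρhat ξ R t).1
    rcases masterState_cases alg ρ ρhat ξ R t with ⟨_, h⟩ | ⟨_, h4, h⟩ | ⟨_, h4, h⟩ <;> rw [h]
    · simp only [if_true, pow_zero]
      omega
    · simp only [if_true, pow_succ]
      omega
    · rw [if_neg (by simp only; omega)]
      simp only
      omega

/-- Between restarts the orders run through 0, 1, 2, …, so the current order plus 1 counts the
blocks since the last restart. -/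
theorem card_blockStarts_le {N : ℝ} (t : ℕ) (hN : ∀ q < t, ((𝒮 q).order : ℝ) + 1 ≤ N) :
    ((blockStarts alg ρ ρhat ξ R (t + 1)).card : ℝ) ≤
      N * (restartRounds alg ρ ρhat ξ R (t + 1)).card + (𝒮 t).order + 1 := by
  classical
  induction t with
  | zero => simp [blockStarts, restartRounds, masterState, Finset.filter_singleton]
  | succ t ih =>
    have ih := ih fun q hq => hN q (by omega)
    have hNt := hN t (by omega)
    have hb := (masterState_bounds alg ρ ρhat ξ R t).1
    rw [blockStarts, restartRounds, Finset.card_filter, Finset.card_filter] at ih ⊢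
    rw [Finset.sum_Icc_succ_top (by omega), Finset.sum_Ico_succ_top (by omega),
      Nat.add_sub_cancel]
    push_cast at ih ⊢
    rcases masterState_cases alg ρ ρhat ξ R t with ⟨h3, h⟩ | ⟨h3, h4, h⟩ | ⟨h3, h4, h⟩ <;> rw [h]
    · rw [if_pos h3]
      simp only [if_true, Nat.cast_zero]
      linarith
    · rw [if_neg h3]
      simp only [if_true, Nat.cast_add, Nat.cast_one]
      linarith
    · rw [if_neg h3, if_neg (by simp only; omega)]
      simp only
      linarith

theorem start_mem_blockStarts {t T : ℕ} (ht1 : 1 ≤ t) (ht : t ≤ T) :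
    (𝒮 (t - 1)).start ∈ blockStarts alg ρ ρhat ξ R T := by
  have h1 := start_le alg ρ ρhat ξ R ht1
  have h2 := one_le_start alg ρ ρhat ξ R (t - 1)
  refine Finset.mem_filter.2 ⟨Finset.mem_Icc.2 ⟨h2, h1.trans ht⟩, ?_⟩
  exact (masterState_eq_of_le alg ρ ρhat ξ R (by omega) (by omega)).1

/-- The rounds up to `T` of the block that starts in round `b` form an interval. -/
theorem exists_block_eq {T b : ℕ} (hb : b ∈ blockStarts alg ρ ρhat ξ R T) :
    ∃ E, b ≤ E ∧ E ≤ T ∧ (𝒮 (E - 1)).start = b ∧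
      ((Finset.Icc 1 T).filter fun t => (𝒮 (t - 1)).start = b) = Finset.Icc b E := by
  obtain ⟨hb1, hb2⟩ := Finset.mem_filter.1 hb
  have hne : ((Finset.Icc 1 T).filter fun t => (𝒮 (t - 1)).start = b).Nonempty :=
    ⟨b, Finset.mem_filter.2 ⟨hb1, hb2⟩⟩
  obtain ⟨h1, h2⟩ := Finset.mem_filter.1 (Finset.max'_mem _ hne)
  have h3 : ∀ t ∈ (Finset.Icc 1 T).filter (fun t => (𝒮 (t - 1)).start = b), t ≤ Finset.max' _ hne :=
    fun t ht => Finset.le_max' _ t ht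
  generalize Finset.max' _ hne = E at *
  rw [Finset.mem_Icc] at h1 hb1
  refine ⟨E, h3 b (Finset.mem_filter.2 ⟨Finset.mem_Icc.2 hb1, hb2⟩), h1.2, h2, ?_⟩
  ext t
  rw [Finset.mem_Icc]
  refine ⟨fun ht => ⟨?_, h3 t ht⟩, fun ht => Finset.mem_filter.2 ⟨Finset.mem_Icc.2 (by omega), ?_⟩⟩
  · obtain ⟨h4, h5⟩ := Finset.mem_filter.1 ht
    have := start_le alg ρ ρhat ξ R (Finset.mem_Icc.1 h4).1
    omega
  · rw [← h2]
    exact (masterState_eq_of_le alg ρ ρhat ξ R (by omega) (by omega)).1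

/-- A restart ends its block, so each block has at most one. -/
theorem start_injOn_restartRounds (T : ℕ) :
    Set.InjOn (fun t => (𝒮 (t - 1)).start) (restartRounds alg ρ ρhat ξ R T : Set ℕ) := by
  classical
  have key : ∀ x ∈ restartRounds alg ρ ρhat ξ R T, ∀ y ∈ restartRounds alg ρ ρhat ξ R T,
      (𝒮 (x - 1)).start = (𝒮 (y - 1)).start → ¬ x < y := by
    intro x hx y hy hxy hlt
    obtain ⟨h1, h2⟩ := Finset.mem_filter.1 hx
    have h3 := start_le alg ρ ρhat ξ R (Finset.mem_Ico.1 h1).1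
    exact not_restarts alg ρ ρhat ξ R (t := y - 1) (by omega) (by omega) h2
  intro x hx y hy hxy
  rcases lt_trichotomy x y with h | h | h
  · exact absurd h (key x hx y hy hxy)
  · exact h
  · exact absurd h (key y hy x hx hxy.symm)

end Blocks

/-! ### Hölder and Cauchy–Schwarz for sums over blocks -/

section Inequalities

theorem sum_rpow_third_le {ι : Type*} (s : Finset ι) {x y : ι → ℝ} (hx : ∀ i ∈ s, 0 ≤ x i)
    (hy : ∀ i ∈ s, 0 ≤ y i) : ∑ i ∈ s, x i ^ (1 / 3 : ℝ) * y i ^ (2 / 3 : ℝ) ≤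
      (∑ i ∈ s, x i) ^ (1 / 3 : ℝ) * (∑ i ∈ s, y i) ^ (2 / 3 : ℝ) := by
  have hpq : (3 : ℝ).HolderConjugate (3 / 2) := by
    rw [Real.holderConjugate_iff]; norm_num
  have h := Real.inner_le_Lp_mul_Lq_of_nonneg s hpq (f := fun i => x i ^ (1 / 3 : ℝ))
    (g := fun i => y i ^ (2 / 3 : ℝ)) (fun i hi => Real.rpow_nonneg (hx i hi) _)
    (fun i hi => Real.rpow_nonneg (hy i hi) _)
  refine h.trans (le_of_eq ?_)
  congr 2
  · refine Finset.sum_congr rfl fun i hi => ?_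
    rw [← Real.rpow_mul (hx i hi)]; norm_num
  · refine Finset.sum_congr rfl fun i hi => ?_
    rw [← Real.rpow_mul (hy i hi)]; norm_num
  · norm_num

theorem sum_sqrt_mul_le {ι : Type*} (s : Finset ι) {x y : ι → ℝ} (hx : ∀ i ∈ s, 0 ≤ x i)
    (hy : ∀ i ∈ s, 0 ≤ y i) :
    ∑ i ∈ s, √(x i * y i) ≤ √((∑ i ∈ s, x i) * ∑ i ∈ s, y i) := by
  refine Real.le_sqrt_of_sq_le ?_
  have h := Finset.sum_mul_sq_le_sq_mul_sq s (fun i => √(x i)) (fun i => √(y i))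
  rw [Finset.sum_congr rfl fun i hi => Real.sqrt_mul (hx i hi) (y i)]
  refine h.trans (le_of_eq ?_)
  congr 1 <;> refine Finset.sum_congr rfl fun i hi => Real.sq_sqrt ?_
  · exact hx i hi
  · exact hy i hi

end Inequalities

end Bandit

namespace Bandit

/-! ### Lengths and variations of the blocks -/

section Blocks

variable {Pol : Type*} (alg : BaseAlg Pol) (ρ ρhat : ℕ → ℝ) (ξ : ℕ → ℕ → unitInterval) (R : ℕ → ℝ)

local notation "𝒮" => masterState alg ρ ρhat ξ R

/-- The sum of `w` over the steps between consecutive rounds up to `T` that originate in the block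
starting in round `b`. -/
noncomputable def blockSum (T : ℕ) (w : ℕ → ℝ) (b : ℕ) : ℝ :=
  ∑ t ∈ (Finset.Ico 1 T).filter (fun t => (masterState alg ρ ρhat ξ R (t - 1)).start = b), w t

/-- The number of rounds up to `T` of the block starting in round `b`. -/
noncomputable def blockLength (T b : ℕ) : ℕ :=
  ((Finset.Icc 1 T).filter fun t => (masterState alg ρ ρhat ξ R (t - 1)).start = b).card

theorem blockSum_nonneg {T : ℕ} {w : ℕ → ℝ} (hw : ∀ t, 0 ≤ w t) (b : ℕ) :
    0 ≤ blockSum alg ρ ρhat ξ R T w b := Finset.sum_nonneg fun _ _ => hw _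

theorem sum_blockSum (T : ℕ) (w : ℕ → ℝ) :
    ∑ b ∈ blockStarts alg ρ ρhat ξ R T, blockSum alg ρ ρhat ξ R T w b
      = ∑ t ∈ Finset.Ico 1 T, w t :=
  Finset.sum_fiberwise_of_maps_to (fun _ ht => start_mem_blockStarts alg ρ ρhat ξ R
    (Finset.mem_Ico.1 ht).1 (Finset.mem_Ico.1 ht).2.le) w

theorem sum_blockLength (T : ℕ) :
    ∑ b ∈ blockStarts alg ρ ρhat ξ R T, blockLength alg ρ ρhat ξ R T b = T := by
  have h := Finset.card_eq_sum_card_fiberwise (s := Finset.Icc 1 T)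
    (t := blockStarts alg ρ ρhat ξ R T) (f := fun t => (𝒮 (t - 1)).start)
    fun t ht => start_mem_blockStarts alg ρ ρhat ξ R (Finset.mem_Icc.1 ht).1 (Finset.mem_Icc.1 ht).2
  rw [Nat.card_Icc, Nat.add_sub_cancel] at h
  exact h.symm

theorem sum_Ico_le_blockSum {T b E : ℕ} {w : ℕ → ℝ} (hw : ∀ t, 0 ≤ w t) (hE : E ≤ T)
    (hs : (𝒮 (E - 1)).start = b) :
    ∑ t ∈ Finset.Ico b E, w t ≤ blockSum alg ρ ρhat ξ R T w b := by
  have hb := one_le_start alg ρ ρhat ξ R (E - 1)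
  refine Finset.sum_le_sum_of_subset_of_nonneg (fun t ht => ?_) fun _ _ _ => hw _
  rw [Finset.mem_Ico] at ht
  refine Finset.mem_filter.2 ⟨Finset.mem_Ico.2 (by omega), ?_⟩
  rw [← hs]
  exact (masterState_eq_of_le alg ρ ρhat ξ R (by omega) (by omega)).1

theorem le_blockLength {T b E : ℕ} (hE1 : 1 ≤ E) (hE : E ≤ T) (hs : (𝒮 (E - 1)).start = b) :
    E - b + 1 ≤ blockLength alg ρ ρhat ξ R T b := by
  have hb := one_le_start alg ρ ρhat ξ R (E - 1)
  have hbE := start_le alg ρ ρhat ξ R hE1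
  rw [show E - b + 1 = (Finset.Icc b E).card by rw [Nat.card_Icc]; omega]
  refine Finset.card_le_card fun t ht => ?_
  rw [Finset.mem_Icc] at ht
  refine Finset.mem_filter.2 ⟨Finset.mem_Icc.2 (by omega), ?_⟩
  rw [← hs]
  exact (masterState_eq_of_le alg ρ ρhat ξ R (by omega) (by omega)).1

/-- Each restart is charged to its own block. -/
theorem card_restartRounds_mul_le {T : ℕ} {c : ℝ} {g : ℕ → ℝ} (hg : ∀ b, 0 ≤ g b)
    (h : ∀ t ∈ restartRounds alg ρ ρhat ξ R T, c ≤ g (𝒮 (t - 1)).start) :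
    (restartRounds alg ρ ρhat ξ R T).card * c ≤ ∑ b ∈ blockStarts alg ρ ρhat ξ R T, g b := by
  classical
  calc _ ≤ ∑ t ∈ restartRounds alg ρ ρhat ξ R T, g (𝒮 (t - 1)).start := by
        rw [← nsmul_eq_mul]
        exact Finset.card_nsmul_le_sum _ _ _ h
    _ = ∑ b ∈ (restartRounds alg ρ ρhat ξ R T).image fun t => (𝒮 (t - 1)).start, g b :=
        (Finset.sum_image (start_injOn_restartRounds alg ρ ρhat ξ R T)).symm
    _ ≤ _ := by
        refine Finset.sum_le_sum_of_subset_of_nonneg (fun b hb => ?_) fun _ _ _ => hg _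
        obtain ⟨t, ht, rfl⟩ := Finset.mem_image.1 hb
        have := Finset.mem_Ico.1 (Finset.mem_filter.1 ht).1
        exact start_mem_blockStarts alg ρ ρhat ξ R this.1 this.2.le

end Blocks

theorem rpow_third_pow {x : ℝ} (hx : 0 ≤ x) : (x ^ (1 / 3 : ℝ)) ^ 3 = x := by
  rw [← Real.rpow_natCast, ← Real.rpow_mul hx]; norm_num

theorem rpow_two_thirds {x : ℝ} (hx : 0 ≤ x) : x ^ (2 / 3 : ℝ) = (x ^ (1 / 3 : ℝ)) ^ 2 := by
  rw [← Real.rpow_natCast, ← Real.rpow_mul hx]; norm_num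

theorem le_rpow_third_mul {x y z : ℝ} (hy : 0 ≤ y) (hz : 0 ≤ z) (h : x ^ 3 ≤ y * z ^ 2) :
    x ≤ y ^ (1 / 3 : ℝ) * z ^ (2 / 3 : ℝ) := by
  have h0 : 0 ≤ y ^ (1 / 3 : ℝ) * z ^ (2 / 3 : ℝ) := by positivity
  refine le_of_pow_le_pow_left₀ (by norm_num : 3 ≠ 0) h0 (h.trans (le_of_eq ?_))
  rw [mul_pow, rpow_third_pow hy, rpow_two_thirds hz, ← pow_mul, mul_comm 2 3, pow_mul,
    rpow_third_pow hz]

open Classical in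
/-- The indicator of a change. -/
noncomputable def changeInd (D : ℕ → ℝ) (t : ℕ) : ℝ := if D t ≠ 0 then 1 else 0

theorem changeInd_nonneg (D : ℕ → ℝ) (t : ℕ) : 0 ≤ changeInd D t := by
  rw [changeInd]; split_ifs <;> norm_num

theorem numStationary_eq (D : ℕ → ℝ) (s e : ℕ) :
    (numStationary D s e : ℝ) = 1 + ∑ t ∈ Finset.Ico s e, changeInd D t := by
  classical
  simp only [numStationary, changeInd, Finset.sum_boole]
  push_cast
  congr!

theorem one_le_sum_changeInd {D : ℕ → ℝ} {s e : ℕ} (h : 0 < totalVar D s e) :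
    1 ≤ ∑ t ∈ Finset.Ico s e, changeInd D t := by
  obtain ⟨t, ht, h1⟩ := Finset.exists_ne_zero_of_sum_ne_zero h.ne'
  have h2 := Finset.single_le_sum (f := changeInd D) (fun t _ => changeInd_nonneg D t) ht
  rwa [changeInd, if_pos h1] at h2

/-! ### Charging the regret and the restarts to changes and to variation -/

namespace UCBRun

variable {A T : ℕ} {δ K : ℝ} {tie : Finset (Fin A) → Fin A} {f : ℕ → Fin A → ℝ}
  {ξ : ℕ → ℕ → unitInterval} {R : ℕ → ℝ} (G : UCBRun A T δ K tie f ξ R)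

local notation "ρ" => masterRho K A T δ
local notation "ρh" => rhoHat T δ (masterRho K A T δ)
local notation "ι" => Real.log (T / δ)
local notation "𝒮" => masterState (ucb1 A 17 T δ tie) (masterRho K A T δ)
  (rhoHat T δ (masterRho K A T δ)) ξ R
local notation "𝒳" => MasterRestarts (ucb1 A 17 T δ tie) (masterRho K A T δ)
  (rhoHat T δ (masterRho K A T δ)) ξ R
local notation "𝓑" => blockStarts (ucb1 A 17 T δ tie) (masterRho K A T δ)
  (rhoHat T δ (masterRho K A T δ)) ξ R T
local notation "𝓜" => restartRounds (ucb1 A 17 T δ tie) (masterRho K A T δ)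
  (rhoHat T δ (masterRho K A T δ)) ξ R T
local notation "𝓁" => blockLength (ucb1 A 17 T δ tie) (masterRho K A T δ)
  (rhoHat T δ (masterRho K A T δ)) ξ R T
local notation "𝓌" => blockSum (ucb1 A 17 T δ tie) (masterRho K A T δ)
  (rhoHat T δ (masterRho K A T δ)) ξ R T
local notation "Δ" => totalVar (supVar f)

include G

theorem sq_sqrt_pow (m : ℕ) : √(A * ι * 2 ^ m) ^ 2 = A * ι * 2 ^ m :=
  Real.sq_sqrt (mul_nonneg (mul_nonneg (Nat.cast_nonneg A) G.log_pos.le) (by positivity))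

/-- The number V of varying pairs satisfies V 2^m ≤ length and V ≤ 2 · changes; multiplying the two
bounds V² 2^m. -/
theorem sqrt_mul_varCount_le_change {b E : ℕ} (hbE : b ≤ E) (m : ℕ) :
    √(A * ι * 2 ^ m) * varCount ρ (supVar f) b E m ≤
      √((2 * (A * ι) * ∑ t ∈ Finset.Ico b E, changeInd (supVar f) t) * (E - b : ℕ)) := by
  rw [varCount]
  split_ifs
  swap
  · simp only [Nat.cast_zero, mul_zero]; positivity
  have hρ := G.rho_pos (Nat.one_le_two_pow (n := m))
  refine Real.le_sqrt_of_sq_le ?_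
  have h1 := card_mul_le_of_pair (V := varPairs ρ (supVar f) b E m) (Nat.two_pow_pos m)
    fun j hj => (Finset.mem_filter.1 hj).2.1
  have h2 := card_mul_le_of_pair_sum (changeInd_nonneg (supVar f)) (Nat.two_pow_pos m) hbE
    (θ := 1) (V := varPairs ρ (supVar f) b E m) fun j hj =>
      ⟨(Finset.mem_filter.1 hj).2.1, one_le_sum_changeInd (hρ.trans (Finset.mem_filter.1 hj).2.2)⟩
  rw [mul_one] at h2
  have hV : (0 : ℝ) ≤ (varPairs ρ (supVar f) b E m).card := Nat.cast_nonneg _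
  have h1' : ((varPairs ρ (supVar f) b E m).card : ℝ) * 2 ^ m ≤ (E - b : ℕ) := by exact_mod_cast h1
  generalize ((varPairs ρ (supVar f) b E m).card : ℝ) = V at *
  have ha : 0 ≤ A * ι := mul_nonneg (Nat.cast_nonneg A) G.log_pos.le
  have hS : 0 ≤ ∑ t ∈ Finset.Ico b E, changeInd (supVar f) t :=
    Finset.sum_nonneg fun _ _ => changeInd_nonneg _ _
  rw [mul_pow, G.sq_sqrt_pow]
  calc A * ι * 2 ^ m * V ^ 2 = A * ι * V * (V * 2 ^ m) := by ring
    _ ≤ A * ι * (2 * ∑ t ∈ Finset.Ico b E, changeInd (supVar f) t) * (E - b : ℕ) := by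
        gcongr
    _ = _ := by ring

/-- Here V 2^m is at most the length and V ρ(2^m) at most twice the variation. In the cube of
√(a2^m) V, with a = Aι, one root is replaced by 2^m ρ(2^m), which is legitimate because `varCount`
vanishes where ρ is capped. -/
theorem sqrt_mul_varCount_le_var {b E : ℕ} (hbE : b ≤ E) (m : ℕ) :
    √(A * ι * 2 ^ m) * varCount ρ (supVar f) b E m ≤
      (2 * (A * ι) * Δ b E) ^ (1 / 3 : ℝ) * ((E - b : ℕ) : ℝ) ^ (2 / 3 : ℝ) := by
  have ha : 0 ≤ A * ι := mul_nonneg (Nat.cast_nonneg A) G.log_pos.le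
  have hΔ : 0 ≤ Δ b E := totalVar_nonneg (supVar_nonneg f) _ _
  rw [varCount]
  split_ifs with hρ1
  swap
  · simp only [Nat.cast_zero, mul_zero]; positivity
  have hρ := G.rho_pos (Nat.one_le_two_pow (n := m))
  have h1 := card_mul_le_of_pair (V := varPairs ρ (supVar f) b E m) (Nat.two_pow_pos m)
    fun j hj => (Finset.mem_filter.1 hj).2.1
  have h2 := card_mul_le_of_pair_sum (supVar_nonneg f) (Nat.two_pow_pos m) hbE
    (θ := ρ (2 ^ m)) (V := varPairs ρ (supVar f) b E m) fun j hj =>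
      ⟨(Finset.mem_filter.1 hj).2.1, (Finset.mem_filter.1 hj).2.2.le⟩
  change _ ≤ 2 * Δ b E at h2
  have h1' : ((varPairs ρ (supVar f) b E m).card : ℝ) * 2 ^ m ≤ (E - b : ℕ) := by exact_mod_cast h1
  have hV : (0 : ℝ) ≤ (varPairs ρ (supVar f) b E m).card := Nat.cast_nonneg _
  generalize ((varPairs ρ (supVar f) b E m).card : ℝ) = V at *
  have h3 := le_mul_masterRho (by linarith [G.le_K]) G.log_pos.le
    (Nat.one_le_two_pow (n := m)) hρ1
  push_cast at h3
  have h4 : √(A * ι * 2 ^ m) ≤ 2 ^ m * ρ (2 ^ m) := by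
    refine le_trans ?_ h3
    exact le_mul_of_one_le_left (Real.sqrt_nonneg _) (by linarith [G.le_K])
  refine le_rpow_third_mul (by positivity) (by positivity) ?_
  calc (√(A * ι * 2 ^ m) * V) ^ 3 = √(A * ι * 2 ^ m) ^ 2 * V ^ 3 * √(A * ι * 2 ^ m) := by ring
    _ ≤ √(A * ι * 2 ^ m) ^ 2 * V ^ 3 * (2 ^ m * ρ (2 ^ m)) := by gcongr
    _ = A * ι * (V * ρ (2 ^ m)) * (V * 2 ^ m) ^ 2 := by rw [G.sq_sqrt_pow]; ring
    _ ≤ A * ι * (2 * Δ b E) * ((E - b : ℕ) : ℝ) ^ 2 := by gcongr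
    _ = _ := by ring

/-- `X` bounds the cost of varying pairs uniformly over the scales; the at most log₂ T scales of a
block produce the second logarithmic factor. -/
theorem regret_le_blocks {X : ℕ → ℝ} (hX : ∀ b E, b ≤ E → E ≤ T → (𝒮 (E - 1)).start = b →
      ∀ m, √(A * ι * 2 ^ m) * varCount ρ (supVar f) b E m ≤ X b) :
    dynRegret T f R ≤ 6 * (Real.logb 2 T + 1) ^ 2 * ι * K *
      (3850 * ι * ∑ b ∈ 𝓑, √(A * ι * 2 ^ (𝒮 (b - 1)).order) + 56 * ∑ b ∈ 𝓑, X b) := by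
  have hι := G.log_pos
  have hN := G.one_le_const
  have hK := G.le_K
  rw [dynRegret, ← Finset.sum_fiberwise_of_maps_to (t := 𝓑) (g := fun t => (𝒮 (t - 1)).start)
    fun t ht => start_mem_blockStarts _ _ _ _ _ (Finset.mem_Icc.1 ht).1 (Finset.mem_Icc.1 ht).2,
    Finset.mul_sum, Finset.mul_sum, ← Finset.sum_add_distrib, Finset.mul_sum]
  refine Finset.sum_le_sum fun b hb => ?_
  obtain ⟨E, hbE, hE, hs, hfib⟩ := exists_block_eq _ _ _ _ _ hb
  have hb1 := Finset.mem_Icc.1 (Finset.mem_filter.1 hb).1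
  have ho : (𝒮 (E - 1)).order = (𝒮 (b - 1)).order :=
    (G.state_eq (t := E) (q := b) hs.le hbE).2.symm
  rw [hfib]
  refine (G.block_regret (by omega) hE hs ho).trans ?_
  have hn := G.order_add_one_le (by omega) hE
  rw [ho] at hn
  set n := (𝒮 (b - 1)).order
  have hX0 : 0 ≤ X b := le_trans (by positivity) (hX b E hbE hE hs 0)
  have h1 : ∑ m ∈ Finset.range n, √(A * ι * 2 ^ (m + 1)) * varCount ρ (supVar f) b E (m + 1)
      ≤ n * X b := by
    have := Finset.sum_le_card_nsmul (Finset.range n) _ _ fun m _ => hX b E hbE hE hs (m + 1)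
    rwa [Finset.card_range, nsmul_eq_mul] at this
  have h2 : (n : ℝ) * X b ≤ (Real.logb 2 T + 1) * X b := by
    gcongr
    linarith
  calc _ ≤ 6 * (Real.logb 2 T + 1) * ι * K * (3850 * (Real.logb 2 T + 1) * ι *
        √(A * ι * 2 ^ n) + 56 * ((Real.logb 2 T + 1) * X b)) := by
        gcongr
        exact h1.trans h2
    _ = _ := by ring

/-- Cauchy–Schwarz over the blocks: their lengths add up to at most 2T, and there are at most (log₂
T + 1)(1 + restarts) of them. -/
theorem sum_sqrt_order_le : ∑ b ∈ 𝓑, √(A * ι * 2 ^ (𝒮 (b - 1)).order) ≤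
    √(2 * (Real.logb 2 T + 1) * (A * ι) * T * (1 + (𝓜).card)) := by
  have ha : 0 ≤ A * ι := mul_nonneg (Nat.cast_nonneg A) G.log_pos.le
  have hN := G.one_le_const
  refine (sum_sqrt_le 𝓑 fun b _ => by positivity).trans (Real.sqrt_le_sqrt ?_)
  have hT := G.one_le_T
  have h1 := sum_blockStarts_le (ucb1 A 17 T δ tie) ρ ρh ξ R (T - 1)
  have h2 := card_blockStarts_le (ucb1 A 17 T δ tie) ρ ρh ξ R (N := Real.logb 2 T + 1) (T - 1)
    fun q hq => G.order_add_one_le (t := q + 1) (by omega) (by omega)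
  have h3 := G.order_add_one_le hT le_rfl
  have h4 := (masterState_bounds (ucb1 A 17 T δ tie) ρ ρh ξ R (T - 1)).1
  rw [Nat.sub_add_cancel hT] at h1 h2 h4
  have h5 : ∑ b ∈ 𝓑, (2 : ℝ) ^ (𝒮 (b - 1)).order ≤ 2 * T := by
    exact_mod_cast (by omega : ∑ b ∈ 𝓑, 2 ^ (𝒮 (b - 1)).order ≤ 2 * T)
  rw [← Finset.mul_sum]
  calc _ ≤ ((Real.logb 2 T + 1) * (1 + (𝓜).card)) * (A * ι * (2 * T)) := by
        gcongr
        linarith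
    _ = _ := by ring

/-- Where ρ is capped, ρ̂ ≥ 4, and neither test can fail with rewards and estimates in [0, 1]. -/
theorem rho_lt_one_of_restarts {t : ℕ} (ht1 : 1 ≤ t) (ht : t ≤ T) (h : 𝒳 t) :
    ρ (t - (𝒮 (t - 1)).start + 1) < 1 := by
  by_contra! hge
  have hst := start_le (ucb1 A 17 T δ tie) ρ ρh ξ R ht1
  have hsb := one_le_start (ucb1 A 17 T δ tie) ρ ρh ξ R (t - 1)
  have hin : ∀ s, (𝒮 (t - 1)).start ≤ s → ∀ q ∈ Finset.Icc s t, 1 ≤ q ∧ q ≤ T :=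
    fun s hs q hq => by rw [Finset.mem_Icc] at hq; omega
  rcases (masterRestarts_iff _ _ _ _ _ ht1).1 h with ⟨m, hm, hte, hsch, q, hq, h1⟩ | h1
  · have hE := lt_cellStart_add m hst
    have hbs := le_cellStart (𝒮 (t - 1)).start m t
    have hs := cellStart_le m hst
    generalize (𝒮 (t - 1)).start = b at *
    generalize cellStart b m t = s at *
    have h2m : 2 ^ m = t - s + 1 := by omega
    have hρ : ρ (t - b + 1) ≤ ρ (2 ^ m) := G.rho_anti Nat.one_le_two_pow (by omega)
    have h2 := G.four_mul_rho_le (Nat.one_le_two_pow (n := m))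
    have h3 := G.est_nonneg (hin b le_rfl q hq).1 (hin b le_rfl q hq).2
    have hp : (0 : ℝ) < 2 ^ m := by positivity
    have hcard : ((Finset.Icc s t).card : ℝ) = 2 ^ m := by
      rw [Nat.card_Icc, show t + 1 - s = 2 ^ m by omega]; push_cast; rfl
    have h4 : ∑ τ ∈ Finset.Icc s t, R τ ≤ 2 ^ m := by
      rw [← hcard]
      simpa using Finset.sum_le_card_nsmul (Finset.Icc s t) R (1 : ℝ) fun τ hτ =>
        (G.rew_mem τ (Finset.mem_Icc.2 (hin s hbs τ hτ))).2
    rw [one_div, ← div_eq_inv_mul, le_div_iff₀ hp] at h1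
    nlinarith
  · have ht'1 : 1 ≤ t - (𝒮 (t - 1)).start + 1 := by omega
    have h2 := G.four_mul_rho_le ht'1
    have hp : (0 : ℝ) < ((t - (𝒮 (t - 1)).start + 1 : ℕ) : ℝ) := by exact_mod_cast ht'1
    have h4 := Finset.sum_le_card_nsmul (Finset.Icc (𝒮 (t - 1)).start t) _ (1 : ℝ) fun τ hτ =>
      G.est_sub_rew_le_one (hin _ le_rfl τ hτ).1 (hin _ le_rfl τ hτ).2
    rw [Nat.card_Icc, nsmul_eq_mul, mul_one,
      show t + 1 - (𝒮 (t - 1)).start = t - (𝒮 (t - 1)).start + 1 by omega] at h4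
    rw [one_div, ← div_eq_inv_mul, le_div_iff₀ hp] at h1
    nlinarith

/-- For a block that has reached length l, with a = Aι, one has √(al) ≤ l ρ(l) < lΔ; squaring and
dividing by l gives the claim. -/
theorem le_mul_sq_of_restarts {t : ℕ} (ht1 : 1 ≤ t) (ht : t ≤ T) (h : 𝒳 t) :
    A * ι ≤ ((t - (𝒮 (t - 1)).start + 1 : ℕ) : ℝ) * Δ (𝒮 (t - 1)).start t ^ 2 := by
  have h1 := G.lt_totalVar_of_restarts ht1 ht h
  have h2 := G.rho_lt_one_of_restarts ht1 ht h
  have ht'1 : 1 ≤ t - (𝒮 (t - 1)).start + 1 := by omega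
  have hp : (0 : ℝ) < ((t - (𝒮 (t - 1)).start + 1 : ℕ) : ℝ) := by exact_mod_cast ht'1
  have h3 := le_mul_masterRho (by linarith [G.le_K]) G.log_pos.le ht'1 h2
  have ha : 0 ≤ A * ι := mul_nonneg (Nat.cast_nonneg A) G.log_pos.le
  generalize t - (𝒮 (t - 1)).start + 1 = l at *
  have h4 : √(A * ι * l) ≤ l * Δ (𝒮 (t - 1)).start t :=
    (le_mul_of_one_le_left (Real.sqrt_nonneg _) (by linarith [G.le_K])).trans
      (h3.trans (mul_le_mul_of_nonneg_left h1.le hp.le))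
  have h5 := Real.sq_sqrt (mul_nonneg ha hp.le)
  have h6 : √(A * ι * l) ^ 2 ≤ (l * Δ (𝒮 (t - 1)).start t) ^ 2 := by gcongr
  rw [h5] at h6
  refine le_of_mul_le_mul_right (h6.trans (le_of_eq ?_)) hp
  ring

/-- By `lt_totalVar_of_restarts` every restart has a change in its own block. -/
theorem card_restarts_le : (1 : ℝ) + (𝓜).card ≤ numStationary (supVar f) 1 T := by
  classical
  rw [numStationary_eq, ← sum_blockSum (ucb1 A 17 T δ tie) ρ ρh ξ R]
  have h := card_restartRounds_mul_le (ucb1 A 17 T δ tie) ρ ρh ξ R (T := T) (c := 1)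
    (g := 𝓌 (changeInd (supVar f))) (blockSum_nonneg _ _ _ _ _ (changeInd_nonneg _)) fun t ht => by
      obtain ⟨h1, h2⟩ := Finset.mem_filter.1 ht
      rw [Finset.mem_Ico] at h1
      have h3 := G.lt_totalVar_of_restarts h1.1 h1.2.le h2
      have h4 := G.rho_pos (Nat.le_add_left 1 (t - (𝒮 (t - 1)).start))
      exact (one_le_sum_changeInd (h4.trans h3)).trans
        (sum_Ico_le_blockSum _ _ _ _ _ (changeInd_nonneg _) h1.2.le rfl)
  linarith

/-- The cube root of Aι ≤ lΔ², summed over the blocks with a restart, is handled by Hölder with the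
exponents 3 and 3/2. -/
theorem card_restarts_mul_le : (𝓜).card * (A * ι) ^ (1 / 3 : ℝ) ≤
    (T : ℝ) ^ (1 / 3 : ℝ) * Δ 1 T ^ (2 / 3 : ℝ) := by
  classical
  have hw := blockSum_nonneg (ucb1 A 17 T δ tie) ρ ρh ξ R (T := T) (supVar_nonneg f)
  have h := card_restartRounds_mul_le (ucb1 A 17 T δ tie) ρ ρh ξ R (T := T)
    (c := (A * ι) ^ (1 / 3 : ℝ))
    (g := fun b => (𝓁 b : ℝ) ^ (1 / 3 : ℝ) * 𝓌 (supVar f) b ^ (2 / 3 : ℝ))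
    (fun b => mul_nonneg (by positivity) (Real.rpow_nonneg (hw b) _)) fun t ht => by
      obtain ⟨h1, h2⟩ := Finset.mem_filter.1 ht
      rw [Finset.mem_Ico] at h1
      have h3 := G.le_mul_sq_of_restarts h1.1 h1.2.le h2
      have h4 : (A * ι) ≤ 𝓁 (𝒮 (t - 1)).start * 𝓌 (supVar f) (𝒮 (t - 1)).start ^ 2 := by
        refine h3.trans ?_
        have h5 : 0 ≤ Δ (𝒮 (t - 1)).start t := totalVar_nonneg (supVar_nonneg f) _ _
        have h6 : Δ (𝒮 (t - 1)).start t ≤ 𝓌 (supVar f) (𝒮 (t - 1)).start :=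
          sum_Ico_le_blockSum _ _ _ _ _ (supVar_nonneg f) h1.2.le rfl
        have h7 : ((t - (𝒮 (t - 1)).start + 1 : ℕ) : ℝ) ≤ 𝓁 (𝒮 (t - 1)).start :=
          Nat.cast_le.2 (le_blockLength _ _ _ _ _ h1.1 h1.2.le rfl)
        gcongr
      refine le_rpow_third_mul (Nat.cast_nonneg _) (hw _) ?_
      rwa [rpow_third_pow (mul_nonneg (Nat.cast_nonneg A) G.log_pos.le)]
  refine h.trans ((sum_rpow_third_le _ (fun _ _ => Nat.cast_nonneg _) fun b _ => hw b).trans ?_)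
  rw [← Nat.cast_sum, sum_blockLength, sum_blockSum]
  rfl

end UCBRun

end Bandit

namespace Bandit

theorem sqrt_add_le_add_sqrt {x y : ℝ} (hx : 0 ≤ x) (hy : 0 ≤ y) : √(x + y) ≤ √x + √y := by
  refine (Real.sqrt_le_left (by positivity)).2 ?_
  have h : 0 ≤ √x * √y := by positivity
  rw [add_sq, Real.sq_sqrt hx, Real.sq_sqrt hy]
  linarith

namespace UCBRun

variable {A T : ℕ} {δ K : ℝ} {tie : Finset (Fin A) → Fin A} {f : ℕ → Fin A → ℝ}
  {ξ : ℕ → ℕ → unitInterval} {R : ℕ → ℝ} (G : UCBRun A T δ K tie f ξ R)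

local notation "ρ" => masterRho K A T δ
local notation "ρh" => rhoHat T δ (masterRho K A T δ)
local notation "ι" => Real.log (T / δ)
local notation "𝒮" => masterState (ucb1 A 17 T δ tie) (masterRho K A T δ)
  (rhoHat T δ (masterRho K A T δ)) ξ R
local notation "𝓑" => blockStarts (ucb1 A 17 T δ tie) (masterRho K A T δ)
  (rhoHat T δ (masterRho K A T δ)) ξ R T
local notation "𝓜" => restartRounds (ucb1 A 17 T δ tie) (masterRho K A T δ)
  (rhoHat T δ (masterRho K A T δ)) ξ R T
local notation "𝓁" => blockLength (ucb1 A 17 T δ tie) (masterRho K A T δ)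
  (rhoHat T δ (masterRho K A T δ)) ξ R T
local notation "𝓌" => blockSum (ucb1 A 17 T δ tie) (masterRho K A T δ)
  (rhoHat T δ (masterRho K A T δ)) ξ R T
local notation "Δ" => totalVar (supVar f)

include G

/-- Uses log T ≤ ι, 1/log 2 < 3/2 and 1 ≤ (3/2) · 0.69. -/
theorem const_le : Real.logb 2 T + 1 ≤ 3 * ι := by
  have hT : (1 : ℝ) ≤ T := by exact_mod_cast G.one_le_T
  have h1 : Real.log T ≤ ι := by
    refine Real.log_le_log (by linarith) ((le_div_iff₀ G.delta_pos).2 ?_)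
    nlinarith [G.delta_lt]
  have h2 := G.log_gt
  have h3 : Real.logb 2 T ≤ 3 / 2 * ι := by
    have h4 := Real.log_two_gt_d9
    rw [Real.logb, div_le_iff₀ (by linarith)]
    nlinarith
  linarith

theorem regret_le_of_blocks {X : ℕ → ℝ} {Y : ℝ}
    (hX : ∀ b E, b ≤ E → E ≤ T → (𝒮 (E - 1)).start = b →
      ∀ m, √(A * ι * 2 ^ m) * varCount ρ (supVar f) b E m ≤ X b)
    (h1 : ∑ b ∈ 𝓑, √(A * ι * 2 ^ (𝒮 (b - 1)).order) ≤ 4 * (Real.logb 2 T + 1) * ι * Y)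
    (h2 : ∑ b ∈ 𝓑, X b ≤ 4 * (Real.logb 2 T + 1) * ι * Y) (hY : 0 ≤ Y) :
    dynRegret T f R ≤ 2600000 * K * ι ^ 6 * Y := by
  have hι := G.log_gt
  have hN := G.const_le
  have hN1 := G.one_le_const
  have hK := G.le_K
  refine (G.regret_le_blocks hX).trans ?_
  set N := Real.logb 2 T + 1
  have hι0 : 0 < ι := G.log_pos
  calc _ ≤ 6 * N ^ 2 * ι * K * (3850 * ι * (4 * N * ι * Y) + 56 * (4 * N * ι * Y)) := by
        gcongr
    _ = 24 * N ^ 3 * ι ^ 2 * K * Y * (3850 * ι + 56) := by ring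
    -- Replacing each of the three factors log₂ T + 1 by 3ι produces the sixth power of ι.
    _ ≤ 24 * (3 * ι) ^ 3 * ι ^ 2 * K * Y * (4000 * ι) := by
        gcongr
        linarith
    _ = 2592000 * (K * ι ^ 6 * Y) := by ring
    _ ≤ 2600000 * (K * ι ^ 6 * Y) := by
        gcongr
        norm_num
    _ = _ := by ring

theorem regret_le_change :
    dynRegret T f R ≤ 2600000 * K * ι ^ 6 * √(A * numStationary (supVar f) 1 T * T) := by
  have hι := G.log_gt
  have hι0 : 0 < ι := G.log_pos
  have hN1 := G.one_le_const
  have hM := G.card_restarts_le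
  have hw := blockSum_nonneg (ucb1 A 17 T δ tie) ρ ρh ξ R (T := T) (changeInd_nonneg (supVar f))
  have ha : 0 ≤ A * ι := mul_nonneg (Nat.cast_nonneg A) G.log_pos.le
  have hL : ∑ b ∈ 𝓑, 𝓌 (changeInd (supVar f)) b ≤ numStationary (supVar f) 1 T := by
    rw [numStationary_eq, sum_blockSum]
    linarith
  have hkey : ∀ x, x ≤ 2 * (Real.logb 2 T + 1) * (A * ι) * T * numStationary (supVar f) 1 T →
      √x ≤ 4 * (Real.logb 2 T + 1) * ι * √(A * numStationary (supVar f) 1 T * T) := by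
    intro x hx
    rw [Real.sqrt_le_left (by positivity), mul_pow, Real.sq_sqrt (by positivity)]
    refine hx.trans ?_
    set N := Real.logb 2 T + 1
    calc _ = (2 * (N * ι)) * (A * numStationary (supVar f) 1 T * T) := by ring
      _ ≤ (16 * (N * ι) ^ 2) * (A * numStationary (supVar f) 1 T * T) := by
          have : 0.69 ≤ N * ι := by nlinarith
          gcongr ?_ * _
          nlinarith
      _ = _ := by ring
  refine G.regret_le_of_blocks
    (X := fun b => √((2 * (A * ι) * 𝓌 (changeInd (supVar f)) b) * 𝓁 b)) ?_ ?_ ?_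
    (Real.sqrt_nonneg _)
  · rintro b E hbE hE rfl m
    rcases Nat.eq_zero_or_pos E with rfl | hE1
    · have := one_le_start (ucb1 A 17 T δ tie) ρ ρh ξ R (0 - 1)
      omega
    refine (G.sqrt_mul_varCount_le_change hbE m).trans (Real.sqrt_le_sqrt ?_)
    have h1 := sum_Ico_le_blockSum (ucb1 A 17 T δ tie) ρ ρh ξ R
      (changeInd_nonneg (supVar f)) hE rfl
    have h2 := le_blockLength (ucb1 A 17 T δ tie) ρ ρh ξ R hE1 hE rfl
    have h3 := hw (𝒮 (E - 1)).start
    gcongr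
    omega
  · refine G.sum_sqrt_order_le.trans (hkey _ ?_)
    gcongr
  · refine (sum_sqrt_mul_le _ (fun b _ => by have := hw b; positivity)
      fun b _ => Nat.cast_nonneg _).trans (hkey _ ?_)
    rw [← Finset.mul_sum, ← Nat.cast_sum, sum_blockLength]
    calc _ ≤ 2 * (A * ι) * numStationary (supVar f) 1 T * T := by gcongr
      _ = 2 * 1 * (A * ι) * T * numStationary (supVar f) 1 T := by ring
      _ ≤ _ := by gcongr

theorem regret_le_variation :
    dynRegret T f R ≤ 2600000 * K * ι ^ 6 *
      ((A * Δ 1 T) ^ (1 / 3 : ℝ) * (T : ℝ) ^ (2 / 3 : ℝ) + √(A * T)) := by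
  have hι := G.log_gt
  have hι0 : 0 < ι := G.log_pos
  have hN1 := G.one_le_const
  have hM := G.card_restarts_mul_le
  have hw := blockSum_nonneg (ucb1 A 17 T δ tie) ρ ρh ξ R (T := T) (supVar_nonneg f)
  have ha : 0 ≤ A * ι := mul_nonneg (Nat.cast_nonneg A) G.log_pos.le
  have hΔ : 0 ≤ Δ 1 T := totalVar_nonneg (supVar_nonneg f) _ _
  have hA0 : (0 : ℝ) ≤ A := Nat.cast_nonneg A
  have hT0 : (0 : ℝ) ≤ T := Nat.cast_nonneg T
  have hY0 : 0 ≤ (A * Δ 1 T) ^ (1 / 3 : ℝ) * (T : ℝ) ^ (2 / 3 : ℝ) := by positivity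
  have hthird : (2 * ι) ^ (1 / 3 : ℝ) ≤ 2 * ι := by
    conv_rhs => rw [← Real.rpow_one (2 * ι)]
    exact Real.rpow_le_rpow_of_exponent_le (by linarith) (by norm_num)
  refine G.regret_le_of_blocks
    (X := fun b => (2 * (A * ι) * 𝓌 (supVar f) b) ^ (1 / 3 : ℝ) * (𝓁 b : ℝ) ^ (2 / 3 : ℝ)) ?_ ?_ ?_
    (by positivity)
  · rintro b E hbE hE rfl m
    rcases Nat.eq_zero_or_pos E with rfl | hE1
    · have := one_le_start (ucb1 A 17 T δ tie) ρ ρh ξ R (0 - 1)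
      omega
    refine (G.sqrt_mul_varCount_le_var hbE m).trans ?_
    have h1 : Δ (𝒮 (E - 1)).start E ≤ _ := sum_Ico_le_blockSum (ucb1 A 17 T δ tie) ρ ρh ξ R
      (supVar_nonneg f) hE rfl
    have h0 : 0 ≤ Δ (𝒮 (E - 1)).start E := totalVar_nonneg (supVar_nonneg f) _ _
    have h2 := le_blockLength (ucb1 A 17 T δ tie) ρ ρh ξ R hE1 hE rfl
    have h3 := hw (𝒮 (E - 1)).start
    gcongr
    omega
  · refine G.sum_sqrt_order_le.trans ?_
    set N := Real.logb 2 T + 1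
    -- Inserting the bound for the number of restarts into √(AιTM) reproduces the rate (AιΔ)^{1/3}
    -- T^{2/3}; the restarts are no more costly than the variation inside the blocks.
    have h1 : √(A * ι * T * (𝓜).card) ≤
        (2 * ι) * ((A * Δ 1 T) ^ (1 / 3 : ℝ) * (T : ℝ) ^ (2 / 3 : ℝ)) := by
      have h2 : √(A * ι * T * (𝓜).card) ≤
          ((A * ι) ^ (1 / 3 : ℝ)) * (Δ 1 T ^ (1 / 3 : ℝ)) * (T : ℝ) ^ (2 / 3 : ℝ) := by
        refine (Real.sqrt_le_left (by positivity)).2 ?_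
        rw [rpow_two_thirds hT0]
        rw [rpow_two_thirds hΔ] at hM
        have e1 := rpow_third_pow ha
        have e2 := rpow_third_pow hT0
        have p1 : 0 ≤ (A * ι) ^ (1 / 3 : ℝ) := by positivity
        have p2 : 0 ≤ (T : ℝ) ^ (1 / 3 : ℝ) := by positivity
        set α := (A * ι) ^ (1 / 3 : ℝ)
        set τ := (T : ℝ) ^ (1 / 3 : ℝ)
        set d := Δ 1 T ^ (1 / 3 : ℝ)
        calc A * ι * T * (𝓜).card = α ^ 2 * τ ^ 3 * ((𝓜).card * α) := by
              rw [← e1, ← e2]; ring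
          _ ≤ α ^ 2 * τ ^ 3 * (τ * d ^ 2) := by gcongr
          _ = _ := by ring
      refine h2.trans ?_
      rw [← Real.mul_rpow ha hΔ, ← mul_assoc]
      gcongr
      calc (A * ι * Δ 1 T) ^ (1 / 3 : ℝ) ≤ (2 * ι * (A * Δ 1 T)) ^ (1 / 3 : ℝ) := by
            have : 0 ≤ ι * (A * Δ 1 T) := by positivity
            refine Real.rpow_le_rpow (by positivity) ?_ (by norm_num)
            linarith
        _ = (2 * ι) ^ (1 / 3 : ℝ) * (A * Δ 1 T) ^ (1 / 3 : ℝ) :=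
            Real.mul_rpow (by positivity) (by positivity)
        _ ≤ _ := by gcongr
    have h2 : √(2 * N) ≤ 2 * N := (Real.sqrt_le_left (by positivity)).2 (by nlinarith)
    have h3 : √(2 * N * ι) ≤ 2 * N * ι := (Real.sqrt_le_left (by positivity)).2 (by
      have : 0.69 ≤ N * ι := by nlinarith
      nlinarith)
    -- The summand 1, the first sequence of blocks before any restart, is the source of √(AT).
    have h4 : √(2 * N * (A * ι) * T * (1 + (𝓜).card)) ≤
        √(2 * N * ι) * √(A * T) + √(2 * N) * √(A * ι * T * (𝓜).card) := by
      rw [← Real.sqrt_mul (by positivity), ← Real.sqrt_mul (by positivity)]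
      refine le_trans (Real.sqrt_le_sqrt (le_of_eq ?_)) (sqrt_add_le_add_sqrt ?_ ?_)
      · ring
      · positivity
      · positivity
    refine h4.trans ?_
    calc _ ≤ 2 * N * ι * √(A * T) +
          2 * N * ((2 * ι) * ((A * Δ 1 T) ^ (1 / 3 : ℝ) * (T : ℝ) ^ (2 / 3 : ℝ))) := by gcongr
      _ ≤ _ := by
          have : 0 ≤ N * ι * √(A * T) := by positivity
          linarith
  · refine (sum_rpow_third_le _ (fun b _ => by have := hw b; positivity)
      fun b _ => Nat.cast_nonneg _).trans ?_
    rw [← Finset.mul_sum, ← Nat.cast_sum, sum_blockLength, sum_blockSum]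
    change (2 * (A * ι) * Δ 1 T) ^ (1 / 3 : ℝ) * (T : ℝ) ^ (2 / 3 : ℝ) ≤ _
    rw [show 2 * (A * ι) * Δ 1 T = 2 * ι * (A * Δ 1 T) by ring,
      Real.mul_rpow (by positivity) (by positivity), mul_assoc]
    have h1 : 2 * ι ≤ 4 * (Real.logb 2 T + 1) * ι := by gcongr; linarith
    have h2 := Real.sqrt_nonneg (A * T)
    exact mul_le_mul (hthird.trans h1) (by linarith) hY0 (by positivity)

end UCBRun

/-! ### Constants and the trivial regime -/

section Final

variable {A T : ℕ} {δ : ℝ}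

theorem mul_ucbRho_le {ι : ℝ} (hι : ι = Real.log (T / δ)) (h : 0.69 < ι) {t : ℕ} (ht : 1 ≤ t) :
    (t : ℝ) * ucbRho 5000 A T δ t ≤ 10 ^ 11 * ι ^ 6 * (√(A * t) + A) := by
  rw [mul_ucbRho (by rw [← hι]; linarith) ht, ← hι]
  have h1 : (0.1 : ℝ) ≤ ι ^ 6 := by
    calc (0.1 : ℝ) ≤ 0.69 ^ 6 := by norm_num
      _ ≤ ι ^ 6 := by gcongr
  have h2 : 0.1 * ι ≤ ι ^ 6 := by
    calc 0.1 * ι ≤ 0.69 ^ 5 * ι := by gcongr; norm_num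
      _ ≤ ι ^ 5 * ι := by gcongr
      _ = ι ^ 6 := by ring
  have h3 : √(A * ι * t) ≤ 2 * ι * √(A * t) := by
    refine (Real.sqrt_le_left (by positivity)).2 ?_
    rw [mul_pow, Real.sq_sqrt (by positivity)]
    calc A * ι * t = ι * (A * t) := by ring
      _ ≤ (2 * ι) ^ 2 * (A * t) := by
        gcongr
        nlinarith
  calc 5000 * (√(A * ι * t) + A * ι) ≤ 5000 * (2 * ι * √(A * t) + A * (2 * ι)) := by
        gcongr
        linarith
    _ = 10 ^ 5 * (0.1 * ι) * (√(A * t) + A) := by ring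
    _ ≤ 10 ^ 11 * ι ^ 6 * (√(A * t) + A) := by
        have : (10 : ℝ) ^ 5 ≤ 10 ^ 11 := by norm_num
        gcongr

theorem dynRegret_le {f : ℕ → Fin A → ℝ} {R : ℕ → ℝ} (hA : 1 ≤ A) (hf : IsEnvironment T f)
    (hR : ∀ t ∈ Finset.Icc 1 T, R t ∈ Set.Icc (0 : ℝ) 1) : dynRegret T f R ≤ T := by
  have h := Finset.sum_le_card_nsmul (Finset.Icc 1 T) (fun t => optValue f t - R t) (1 : ℝ)
    fun t ht => by
      obtain ⟨a, ha⟩ := exists_eq_optValue hA f t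
      have h1 := (hf t ht a).2
      have h2 := (hR t ht).1
      linarith
  rwa [Nat.card_Icc, Nat.add_sub_cancel, nsmul_eq_mul, mul_one] at h

/-- For T ≤ A already T ≤ √(AT), which is below both rates. -/
theorem le_min_of_le {f : ℕ → Fin A → ℝ} (hAT : T ≤ A) :
    (T : ℝ) ≤ min √(A * (numStationary (supVar f) 1 T : ℝ) * T)
      ((A * totalVar (supVar f) 1 T) ^ (1 / 3 : ℝ) * (T : ℝ) ^ (2 / 3 : ℝ) + √(A * T)) := by
  have hAT' : (T : ℝ) ≤ A := by exact_mod_cast hAT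
  have h1 : (T : ℝ) ≤ √(A * T) := Real.le_sqrt_of_sq_le (by nlinarith)
  have h2 : (1 : ℝ) ≤ numStationary (supVar f) 1 T := by
    exact_mod_cast Nat.le_add_right 1 _
  have h3 := totalVar_nonneg (supVar_nonneg f) 1 T
  refine le_min (h1.trans (Real.sqrt_le_sqrt ?_)) ?_
  · gcongr
    exact le_mul_of_one_le_right (Nat.cast_nonneg A) h2
  · have : 0 ≤ (A * totalVar (supVar f) 1 T) ^ (1 / 3 : ℝ) * (T : ℝ) ^ (2 / 3 : ℝ) := by positivity
    linarith

end Final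

end Bandit

open Bandit MeasureTheory in
/-- UCB1 satisfies the base-algorithm requirement with `C(t) = Õ(√(A t) + A)` and
`Δ(t) = ‖r t - r (t + 1)‖_∞`, and MASTER + UCB1 has dynamic regret
`Õ(min {√(A L T), (A Δ)^{1/3} T^{2/3} + √(A T)})` with probability at least `1 - δ`. -/
theorem mainTheorem3 :
    ∃ (c K B : ℝ) (k : ℕ), 0 < c ∧ 0 < K ∧ 0 < B ∧
      ∀ (A T : ℕ) (δ : ℝ) (tie : Finset (Fin A) → Fin A),
        1 ≤ A → 1 ≤ T → 0 < δ → δ < 1 → 2 * δ ≤ T →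
        (∀ s : Finset (Fin A), s.Nonempty → tie s ∈ s) →
        (BaseAlg.NearStationaryGuarantee.{u, 0} (ucb1 A c T δ tie) T δ (ucbRho K A T δ) supVar ∧
          ∀ t ∈ Finset.Icc 1 T, (t : ℝ) * ucbRho K A T δ t ≤
            B * Real.log (T / δ) ^ k * (√(A * t) + A)) ∧
        BaseAlg.NearStationaryGuarantee.{u, 0} (ucb1 A c T δ tie) T δ
          (fun t => min (ucbRho K A T δ t) 1) supVar ∧
        ∀ (r : ℕ → Fin A → ℝ), IsEnvironment T r →
          ∀ {Ω : Type u} [MeasurableSpace Ω] (P : Measure Ω) [IsProbabilityMeasure P]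
            (ξ : ℕ → Ω → ℕ → unitInterval) (R : ℕ → Ω → ℝ),
            IsMasterRun P (ucb1 A c T δ tie) T δ (fun t => min (ucbRho K A T δ t) 1) r ξ R →
            1 - δ ≤ P.real {ω | dynRegret T r (fun t => R t ω) ≤
              B * Real.log (T / δ) ^ k *
                min √(A * (numStationary (supVar r) 1 T : ℝ) * T)
                  ((A * totalVar (supVar r) 1 T) ^ (1 / 3 : ℝ) * (T : ℝ) ^ (2 / 3 : ℝ)
                    + √(A * T))} := by
  -- 17 = 1 + 16 comes from the tail exponent 16, 5000 from the margin over 16 · 119 in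
  -- `sum_cell_le`, and 10^11 exceeds 2600000 · 5000.
  refine ⟨17, 5000, 10 ^ 11, 6, by norm_num, by norm_num, by norm_num, ?_⟩
  intro A T δ tie hA hT hδ hδ1 h2 htie
  have hι : 0.69 < Real.log (T / δ) := by
    linarith [log_two_le_log hδ h2, Real.log_two_gt_d9]
  refine ⟨⟨ucb1_nearStationaryGuarantee hA hT hδ hδ1 h2 htie (by norm_num),
    fun t ht => mul_ucbRho_le rfl hι (Finset.mem_Icc.1 ht).1⟩,
    ucb1_nearStationaryGuarantee_min hA hT hδ hδ1 h2 htie (by norm_num), ?_⟩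
  intro r hr Ω _ P _ ξ R hrun
  have hB : (1 : ℝ) ≤ 10 ^ 11 * Real.log (T / δ) ^ 6 := by
    calc (1 : ℝ) ≤ 10 ^ 11 * 0.69 ^ 6 := by norm_num
      _ ≤ _ := by gcongr
  -- With more arms than rounds the union bound over the arms would fail, but there the trivial
  -- regret T is enough.
  rcases le_or_gt T A with hAT | hAT
  · have hall : {ω | dynRegret T r (fun t => R t ω) ≤ 10 ^ 11 * Real.log (T / δ) ^ 6 *
        min √(A * (numStationary (supVar r) 1 T : ℝ) * T)
          ((A * totalVar (supVar r) 1 T) ^ (1 / 3 : ℝ) * (T : ℝ) ^ (2 / 3 : ℝ)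
            + √(A * T))} = Set.univ := by
      refine Set.eq_univ_of_forall fun ω => ?_
      have h3 := dynRegret_le (R := fun t => R t ω) hA hr fun t ht => hrun.reward.mem_Icc t ht ω
      have h4 := le_min_of_le (f := r) hAT
      have h5 : (0 : ℝ) ≤ T := Nat.cast_nonneg T
      exact h3.trans (h4.trans (le_mul_of_one_le_left (h5.trans h4) hB))
    rw [hall, probReal_univ]
    linarith
  · have hι0 : 0 < Real.log (T / δ) := by linarith
    refine (goodRun_probability hrun hr hT hAT.le hδ hδ1 h2
      (fun t ht => masterRho_pos hA (by norm_num) hι0 ht)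
      (masterRho_antitoneOn (by norm_num) hι0.le)).trans
      (measureReal_mono fun ω hω => ?_)
    have G : UCBRun A T δ 5000 tie r (fun s m => ξ s ω m) (fun s => R s ω) :=
      ⟨hA, hT, hδ, hδ1, h2, htie, le_rfl, hr, fun t ht => hrun.reward.mem_Icc t ht ω, hω⟩
    have h3 : 2600000 * 5000 * Real.log (T / δ) ^ 6 ≤ 10 ^ 11 * Real.log (T / δ) ^ 6 := by
      gcongr
      norm_num
    have h4 := totalVar_nonneg (supVar_nonneg r) 1 T
    change dynRegret T r (fun t => R t ω) ≤ _
    rw [mul_min_of_nonneg _ _ (by positivity)]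
    exact le_min (G.regret_le_change.trans (mul_le_mul_of_nonneg_right h3 (by positivity)))
      (G.regret_le_variation.trans (mul_le_mul_of_nonneg_right h3 (by positivity)))
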